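/- A \emph{DAG complex} in $\mathbb{R}^d$ is a finite directed acyclic graph, connected as an undirected graph, whose vertices are placed in $\mathbb{R}^d$ and whose edges $p\to q$ are realized by the segments $pq$. A directed path from $s$ to $t$ follows edges in their direction (it has length $0$ only if $s=t$) and is identified with the polygonal curve $[0,1]\to\mathbb{R}^d$ that it traverses. The \emph{monotone Fréchet distance} of two curves $\pi,\sigma:[0,1]\to\mathbb{R}^d$ is $$d_{\mathcal F}(\pi,\sigma)=\inf_{f,g}\ \max_{s\in[0,1]}\|\pi(f(s))-\sigma(g(s))\|,$$ where $f,g$ range over the continuous one-to-one functions $[0,1]\to[0,1]$ that fix $0$ and $1$. The model of computation is a uniform real RAM: arrays of natural numbers and of exact real numbers with indirect addressing; unit cost for memory accesses, for the constants of the program (natural numbers), for addition and truncated subtraction of natural numbers, for $+,-,\cdot,/,\sqrt{\ }$ on real numbers, for the conversion of a natural number to a real number, and for comparisons and Boolean operations on tests; no rounding. \textbf{Lemma.} For every fixed dimension $d$ there is a program for this machine with the following property. Let $\mathcal C_1,\mathcal C_2$ be DAG complexes in $\mathbb{R}^d$, let $n$ be the number of edges in the larger of the two, let $s_i,t_i$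 be vertices of $\mathcal C_i$ ($i=1,2$), and let $\delta\ge 0$. Given the coordinates of the vertices, the lists of edges, $s_1,t_1,s_2,t_2$ and $\delta$, the program decides in $O(n^2)$ time (that is, in at most $C_d\max(1,n)^2$ steps) whether there are directed paths $\pi_1$ in $\mathcal C_1$ from $s_1$ to $t_1$ and $\pi_2$ in $\mathcal C_2$ from $s_2$ to $t_2$ with $d_{\mathcal F}(\pi_1,\pi_2)\le\delta$. Furthermore, if such paths exist, the program returns, within the same time bound, two such paths $\pi_1,\pi_2$ together with continuous nondecreasing piecewise linear functions $f,g:[0,1]\to[0,1]$ with $f(0)=g(0)=0$, $f(1)=g(1)=1$, and $$\max_{s\in[0,1]}\|\pi_1(f(s))-\pi_2(g(s))\|\le\delta .$$ -/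

import Mathlib

/-! ### A real RAM with a step count -/

namespace RealRAM

/-- The memory of the machine: finitely many of the arrays `nat 0, nat 1, …` of natural numbers and
`real 0, real 1, …` of real numbers are used by any one program, which names them by constants;
positions inside an array may be computed at run time. -/
structure State where
  nat : ℕ → ℕ → ℕ
  real : ℕ → ℕ → ℝ

/-- Store `x` at position `i` of the natural-number array `a`. -/
def State.setNat (σ : State) (a i x : ℕ) : State :=
  { σ with nat := Function.update σ.nat a (Function.update (σ.nat a) i x) }

/-- Store `x` at position `i` of the real-number array `a`. -/
noncomputable def State.setReal (σ : State) (a i : ℕ) (x : ℝ) : State :=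
  { σ with real := Function.update σ.real a (Function.update (σ.real a) i x) }

/-- Natural-number expressions: constants, array reads, addition, truncated subtraction. -/
inductive NatExp where
  | const (k : ℕ)
  | get (a : ℕ) (i : NatExp)
  | add (x y : NatExp)
  | sub (x y : NatExp)

namespace NatExp

def eval (σ : State) : NatExp → ℕ
  | const k => k
  | get a i => σ.nat a (i.eval σ)
  | add x y => x.eval σ + y.eval σ
  | sub x y => x.eval σ - y.eval σ

/-- Every constant, memory access and operation costs one time unit. -/
def cost : NatExp → ℕ
  | const _ => 1
  | get _ i => i.cost + 1
  | add x y => x.cost + y.cost + 1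
  | sub x y => x.cost + y.cost + 1

end NatExp

/-- Real expressions: the exact operations of the real RAM with square roots. There is no rounding
operation, and all constants are natural numbers. -/
inductive RealExp where
  | const (k : ℕ)
  | cast (x : NatExp)
  | get (a : ℕ) (i : NatExp)
  | add (x y : RealExp)
  | sub (x y : RealExp)
  | mul (x y : RealExp)
  | div (x y : RealExp)
  | sqrt (x : RealExp)

namespace RealExp

noncomputable def eval (σ : State) : RealExp → ℝ
  | const k => k
  | cast x => (x.eval σ : ℝ)
  | get a i => σ.real a (i.eval σ)
  | add x y => x.eval σ + y.eval σ
  | sub x y => x.eval σ - y.eval σ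
  | mul x y => x.eval σ * y.eval σ
  | div x y => x.eval σ / y.eval σ
  | sqrt x => Real.sqrt (x.eval σ)

def cost : RealExp → ℕ
  | const _ => 1
  | cast x => x.cost + 1
  | get _ i => i.cost + 1
  | add x y => x.cost + y.cost + 1
  | sub x y => x.cost + y.cost + 1
  | mul x y => x.cost + y.cost + 1
  | div x y => x.cost + y.cost + 1
  | sqrt x => x.cost + 1

end RealExp

/-- Tests: exact comparisons of natural numbers and of real numbers. -/
inductive Test where
  | natLe (x y : NatExp)
  | realLe (x y : RealExp)
  | not (b : Test)
  | and (b c : Test)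

namespace Test

def Holds (σ : State) : Test → Prop
  | natLe x y => x.eval σ ≤ y.eval σ
  | realLe x y => x.eval σ ≤ y.eval σ
  | not b => ¬ b.Holds σ
  | and b c => b.Holds σ ∧ c.Holds σ

def cost : Test → ℕ
  | natLe x y => x.cost + y.cost + 1
  | realLe x y => x.cost + y.cost + 1
  | not b => b.cost + 1
  | and b c => b.cost + c.cost + 1

end Test

/-- Programs. `setNat a i e` stores the value of `e` at position `i` of the natural-number array
`a`, and `setReal a i e` does so for the real-number array `a`. -/
inductive Program where
  | skip
  | setNat (a : ℕ) (i : NatExp) (e : NatExp)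
  | setReal (a : ℕ) (i : NatExp) (e : RealExp)
  | seq (P Q : Program)
  | branch (b : Test) (P Q : Program)
  | loop (b : Test) (P : Program)

/-- `Exec P σ τ T`: started in memory `σ`, the program `P` halts in memory `τ` after `T` time
units. -/
inductive Exec : Program → State → State → ℕ → Prop where
  | skip (σ : State) : Exec .skip σ σ 1
  | setNat (a : ℕ) (i e : NatExp) (σ : State) :
      Exec (.setNat a i e) σ (σ.setNat a (i.eval σ) (e.eval σ)) (i.cost + e.cost + 1)
  | setReal (a : ℕ) (i : NatExp) (e : RealExp) (σ : State) :
      Exec (.setReal a i e) σ (σ.setReal a (i.eval σ) (e.eval σ)) (i.cost + e.cost + 1)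
  | seq {P Q : Program} {σ τ υ : State} {S T : ℕ} :
      Exec P σ τ S → Exec Q τ υ T → Exec (.seq P Q) σ υ (S + T + 1)
  | branchTrue {b : Test} {P Q : Program} {σ τ : State} {T : ℕ} :
      b.Holds σ → Exec P σ τ T → Exec (.branch b P Q) σ τ (b.cost + T + 1)
  | branchFalse {b : Test} {P Q : Program} {σ τ : State} {T : ℕ} :
      ¬ b.Holds σ → Exec Q σ τ T → Exec (.branch b P Q) σ τ (b.cost + T + 1)
  | loopTrue {b : Test} {P : Program} {σ τ υ : State} {S T : ℕ} :
      b.Holds σ → Exec P σ τ S → Exec (.loop b P) τ υ T →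
        Exec (.loop b P) σ υ (b.cost + S + T + 1)
  | loopFalse {b : Test} {P : Program} {σ : State} :
      ¬ b.Holds σ → Exec (.loop b P) σ σ (b.cost + 1)

/-- The machine is deterministic: final memory and running time are functions of the program and
of the initial memory. -/
theorem Exec.deterministic {P : Program} {σ τ : State} {T : ℕ} (h : Exec P σ τ T) :
    ∀ {τ' : State} {T' : ℕ}, Exec P σ τ' T' → τ' = τ ∧ T' = T := by
  induction h with
  | skip σ => intro _ _ h'; cases h'; exact ⟨rfl, rfl⟩
  | setNat a i e σ => intro _ _ h'; cases h'; exact ⟨rfl, rfl⟩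
  | setReal a i e σ => intro _ _ h'; cases h'; exact ⟨rfl, rfl⟩
  | seq _ _ ih₁ ih₂ =>
    intro _ _ h'
    cases h' with
    | seq h₁ h₂ =>
      obtain ⟨rfl, rfl⟩ := ih₁ h₁
      obtain ⟨rfl, rfl⟩ := ih₂ h₂
      exact ⟨rfl, rfl⟩
  | branchTrue hb _ ih =>
    intro _ _ h'
    cases h' with
    | branchTrue _ h₁ => obtain ⟨rfl, rfl⟩ := ih h₁; exact ⟨rfl, rfl⟩
    | branchFalse hb' _ => exact absurd hb hb'
  | branchFalse hb _ ih =>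
    intro _ _ h'
    cases h' with
    | branchTrue hb' _ => exact absurd hb' hb
    | branchFalse _ h₁ => obtain ⟨rfl, rfl⟩ := ih h₁; exact ⟨rfl, rfl⟩
  | loopTrue hb _ _ ih₁ ih₂ =>
    intro _ _ h'
    cases h' with
    | loopTrue _ h₁ h₂ =>
      obtain ⟨rfl, rfl⟩ := ih₁ h₁
      obtain ⟨rfl, rfl⟩ := ih₂ h₂
      exact ⟨rfl, rfl⟩
    | loopFalse hb' => exact absurd hb hb'
  | loopFalse hb =>
    intro _ _ h'
    cases h' with
    | loopTrue hb' _ _ => exact absurd hb' hb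
    | loopFalse _ => exact ⟨rfl, rfl⟩

end RealRAM

/-! ### Curves and the monotone Fréchet distance -/

namespace Frechet

/-- The polygonal curve through `p 0, …, p k`, parameterized over `[0,1]`: it passes through `p i`
at time `i / k` and is affine in between (the `i`-th summand is the part of the `i`-th segment that
has been traversed). -/
noncomputable def polyline {E : Type*} [NormedAddCommGroup E] [NormedSpace ℝ E] {k : ℕ}
    (p : Fin (k + 1) → E) : C(unitInterval, E) where
  toFun x := p 0 + ∑ i : Fin k, (max 0 (min 1 ((k : ℝ) * x - i))) • (p i.succ - p i.castSucc)
  continuous_toFun := by fun_prop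

/-- `width c₁ c₂ f g` is the maximum over `s ∈ [0,1]` of the distance of `c₁ (f s)` and
`c₂ (g s)`. -/
noncomputable def width {E : Type*} [MetricSpace E] (c₁ c₂ : C(unitInterval, E))
    (f g : C(unitInterval, unitInterval)) : ℝ :=
  ⨆ s : unitInterval, dist (c₁ (f s)) (c₂ (g s))

/-- Orientation-preserving bijective reparameterizations of `[0,1]`. -/
def Reparam : Type :=
  {f : C(unitInterval, unitInterval) // Function.Injective f ∧ f 0 = 0 ∧ f 1 = 1}

/-- The monotone Fréchet distance. It is an infimum, which need not be attained by injective
reparameterizations. -/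
noncomputable def frechetDist {E : Type*} [MetricSpace E] (c₁ c₂ : C(unitInterval, E)) : ℝ :=
  ⨅ r : Reparam × Reparam, width c₁ c₂ r.1.1 r.2.1

/-- Reparameterizations that are monotone but may rest for a while. -/
structure IsMonotoneReparam (f : C(unitInterval, unitInterval)) : Prop where
  monotone : Monotone f
  map_zero : f 0 = 0
  map_one : f 1 = 1

/-! ### DAG complexes -/

/-- A finite directed acyclic graph, connected as an undirected graph, with its vertices placed in
`ℝᵈ`, given by the list of its edges. An edge `e` is realized by the segment from `pos (tail e)` to
`pos (head e)`. -/
structure DAGComplex (d : ℕ) where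
  numVertices : ℕ
  numEdges : ℕ
  pos : Fin numVertices → EuclideanSpace ℝ (Fin d)
  tail : Fin numEdges → Fin numVertices
  head : Fin numEdges → Fin numVertices
  acyclic : ∀ v, ¬ Relation.TransGen (fun u w => ∃ e, tail e = u ∧ head e = w) v v
  connected : ∀ u v, Relation.EqvGen (fun u w => ∃ e, tail e = u ∧ head e = w) u v

/-- A directed path from `s` to `t` (of length zero only if `s = t`). -/
structure DirectedPath {d : ℕ} (K : DAGComplex d) (s t : Fin K.numVertices) where
  length : ℕ
  vertex : Fin (length + 1) → Fin K.numVertices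
  first : vertex 0 = s
  last : vertex (Fin.last length) = t
  step : ∀ i : Fin length, ∃ e, K.tail e = vertex i.castSucc ∧ K.head e = vertex i.succ

/-- The directed polygonal curve in `ℝᵈ` that a directed path traverses. -/
noncomputable def DirectedPath.curve {d : ℕ} {K : DAGComplex d} {s t : Fin K.numVertices}
    (π : DirectedPath K s t) : C(unitInterval, EuclideanSpace ℝ (Fin d)) :=
  polyline fun i => K.pos (π.vertex i)

/-! ### Input and output conventions -/

/-- A finite sequence as an array, padded by zeros. -/
def toArray {α : Type*} [Zero α] {m : ℕ} (x : Fin m → α) (i : ℕ) : α :=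
  if h : i < m then x ⟨i, h⟩ else 0

/-- The initial memory: nat array `0` holds the vertex and edge numbers and the end vertices, nat
arrays `1, 2` hold the tails and the heads of the edges of `K₁`, nat arrays `3, 4` those of `K₂`;
for `j < d`, real array `j` holds the `j`-th coordinates of the vertices of `K₁` and real array
`d + j` those of `K₂`; real array `2 * d` holds `δ`. All other cells are zero. -/
noncomputable def inputState {d : ℕ} (K₁ K₂ : DAGComplex d) (s₁ t₁ : Fin K₁.numVertices)
    (s₂ t₂ : Fin K₂.numVertices) (δ : ℝ) : RealRAM.State where
  nat a :=
    match a with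
    | 0 => toArray ![K₁.numVertices, K₁.numEdges, (s₁ : ℕ), (t₁ : ℕ),
        K₂.numVertices, K₂.numEdges, (s₂ : ℕ), (t₂ : ℕ)]
    | 1 => toArray fun e => (K₁.tail e : ℕ)
    | 2 => toArray fun e => (K₁.head e : ℕ)
    | 3 => toArray fun e => (K₂.tail e : ℕ)
    | 4 => toArray fun e => (K₂.head e : ℕ)
    | _ => fun _ => 0
  real a :=
    if h : a < d then toArray fun v => K₁.pos v ⟨a, h⟩
    else if h : a - d < d then toArray fun v => K₂.pos v ⟨a - d, h⟩
    else if a = 2 * d then toArray ![δ]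
    else fun _ => 0

/-- The answer of the decision problem (`1` for yes, `0` for no) is read from cell `0` of nat array
`5`. -/
def answer (σ : RealRAM.State) : ℕ := σ.nat 5 0

/-- The path `π` is stored with its length in cell `l` of nat array `5` and its vertices in nat
array `a`. -/
def StoresPath {d : ℕ} {K : DAGComplex d} {s t : Fin K.numVertices} (σ : RealRAM.State)
    (l a : ℕ) (π : DirectedPath K s t) : Prop :=
  σ.nat 5 l = π.length ∧ ∀ i : Fin (π.length + 1), σ.nat a i = π.vertex i

/-- Real array `a` stores the piecewise linear function `f` through its values at the times `i / m`,
`0 ≤ i ≤ m`, where `m` is in cell `3` of nat array `5`. -/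
def StoresReparam (σ : RealRAM.State) (a : ℕ) (f : C(unitInterval, unitInterval)) : Prop :=
  ∀ x : unitInterval, (f x : ℝ) = polyline (fun i : Fin (σ.nat 5 3 + 1) => σ.real a i) x

end Frechet

/-!
The program decides reachability in the free space of the two complexes by dynamic programming, as
for two polygonal curves, but over all pairs of edges at once.

*Locations.* The vertices and the edges of a complex together are its locations (`LocGraph`); a
vertex is treated as an edge that has shrunk to a point. For a vertex `v` of one complex and an edge
`e` of the other, the points of `e` at distance at most `δ` from `v` form an interval, since the
squared distance is a quadratic polynomial along `e`; it can be found by means of a square root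
(`freeSpace_spec`). These intervals lie on the sides of the cells `e × e'` of the free space. Since
balls are convex, the free space in a cell is convex, so a monotone curve from a point of the left
or bottom side to a point of the right or top side exists as soon as the two points are free and in
monotone position. Hence on each side only the least reachable parameter is needed, and it is
determined by four kinds of arcs per cell (`Arc`). Cells in which one location is a vertex
degenerate to segments; the same arcs are correct for them.

*The table.* A topological order of the locations of each complex (`sortLocs_spec`) makes it
possible to deal with the cells in an order in which no cell comes before one that lies weakly below
it. So all arcs remain relaxed once they have been (`Table.Inv.relaxCell`), and the table is final
after one pass (`exists_hasTable_fillTable`).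

*Completeness.* If two paths have Fréchet distance at most `δ`, then some monotone
reparameterizations, which need not be injective, keep the two points at distance at most `δ`
(`exists_monotone_of_frechetDist_le`, a compactness argument). They trace a monotone curve in the
free space, and by induction on the cells that it traverses, the table entry of every side that it
crosses is at most the parameter of the crossing (`lo_le_one_of_traversal`).

*Soundness.* The predecessors that are stored in the table lead from the end back to the start
(`Table.Inv.chain`), because each arc increases the sum of the topological ranks. Forwards, the
chain is a walk on each of the two complexes, from which the paths and the breakpoints of the
reparameterizations are read off (`IsWalk`, `breakpoint`). Between two breakpoints the two points
move affinely, so that their distance is at most its maximum at the breakpoints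
(`dist_le_of_walks`). Finally, nondecreasing reparameterizations of width at most `δ` can be
perturbed to injective ones (`frechetDist_le_of_width_le`).

*Running time.* The program is written in a sublanguage of bounded loops (`Code`), whose bounds are
numbers of locations. A program with loops of at most `M` rounds, nested to depth `2`, takes `O(M²)`
steps (`Code.WellFormed.exec`). The number of locations is at most twice the number of edges plus
one, because the complexes are connected (`DAGComplex.numVertices_le`). Topological sorting takes
quadratic time, which suffices.
-/


/-! ### Bounded loops: a total sublanguage -/

namespace RealRAM

/-- The expression reads only the natural-number arrays with numbers below `n`. -/
def NatExp.Below (n : ℕ) : NatExp → Prop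
  | .const _ => True
  | .get a i => a < n ∧ i.Below n
  | .add x y => x.Below n ∧ y.Below n
  | .sub x y => x.Below n ∧ y.Below n

theorem NatExp.Below.eval_congr {n : ℕ} {e : NatExp} (he : e.Below n) {σ τ : State}
    (h : ∀ a < n, σ.nat a = τ.nat a) : e.eval σ = e.eval τ := by
  induction e with
  | const k => rfl
  | get a i ih => simp only [NatExp.eval, ih he.2, h a he.1]
  | add x y ihx ihy => simp only [NatExp.eval, ihx he.1, ihy he.2]
  | sub x y ihx ihy => simp only [NatExp.eval, ihx he.1, ihy he.2]

@[simp] theorem State.setNat_real (σ : State) (a i x : ℕ) : (σ.setNat a i x).real = σ.real := rfl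

@[simp] theorem State.setReal_nat (σ : State) (a i : ℕ) (x : ℝ) :
    (σ.setReal a i x).nat = σ.nat := rfl

theorem State.setNat_nat (σ : State) (a i x b : ℕ) :
    (σ.setNat a i x).nat b = if b = a then Function.update (σ.nat a) i x else σ.nat b := by
  simp only [State.setNat, Function.update_apply]

theorem State.setReal_real (σ : State) (a i : ℕ) (x : ℝ) (b : ℕ) :
    (σ.setReal a i x).real b = if b = a then Function.update (σ.real a) i x else σ.real b := by
  simp only [State.setReal, Function.update_apply]

/-- Loop programs: `times v N P` runs `P` with cell `0` of the natural-number array `v` counting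
through `0, …, N - 1`. -/
inductive Code where
  | skip
  | setNat (a : ℕ) (i : NatExp) (e : NatExp)
  | setReal (a : ℕ) (i : NatExp) (e : RealExp)
  | seq (P Q : Code)
  | branch (b : Test) (P Q : Code)
  | times (v : ℕ) (N : NatExp) (P : Code)

namespace Code

/-- A bounded loop is a loop that counts upwards and compares with the bound in each round. -/
def toProgram : Code → Program
  | skip => .skip
  | setNat a i e => .setNat a i e
  | setReal a i e => .setReal a i e
  | seq P Q => .seq P.toProgram Q.toProgram
  | branch b P Q => .branch b P.toProgram Q.toProgram
  | .times v N P =>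
    .seq (.setNat v (.const 0) (.const 0))
      (.loop (.natLe (.add (.get v (.const 0)) (.const 1)) N)
        (.seq P.toProgram (.setNat v (.const 0) (.add (.get v (.const 0)) (.const 1)))))

open scoped Classical in
/-- The final memory of a loop program. In a loop, the bound is evaluated only once. -/
noncomputable def den : Code → State → State
  | skip, σ => σ
  | setNat a i e, σ => σ.setNat a (i.eval σ) (e.eval σ)
  | setReal a i e, σ => σ.setReal a (i.eval σ) (e.eval σ)
  | seq P Q, σ => Q.den (P.den σ)
  | branch b P Q, σ => if b.Holds σ then P.den σ else Q.den σ
  | .times v N P, σ =>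
    Nat.rec (σ.setNat v 0 0) (fun k τ => (P.den τ).setNat v 0 (k + 1)) (N.eval σ)

/-- The program does not write to the natural-number array `a`. -/
def NatFree (a : ℕ) : Code → Prop
  | skip => True
  | setNat b _ _ => a ≠ b
  | setReal _ _ _ => True
  | seq P Q => P.NatFree a ∧ Q.NatFree a
  | branch _ P Q => P.NatFree a ∧ Q.NatFree a
  | .times v _ P => a ≠ v ∧ P.NatFree a

/-- The program does not write to the real-number array `a`. -/
def RealFree (a : ℕ) : Code → Prop
  | skip => True
  | setNat _ _ _ => True
  | setReal b _ _ => a ≠ b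
  | seq P Q => P.RealFree a ∧ Q.RealFree a
  | branch _ P Q => P.RealFree a ∧ Q.RealFree a
  | .times _ _ P => P.RealFree a

/-- Loop bounds read only array `0`, array `0` is never written to, and loop bodies do not write to
their loop counter. -/
def WellFormed : Code → Prop
  | skip => True
  | setNat a _ _ => 0 ≠ a
  | setReal _ _ _ => True
  | seq P Q => P.WellFormed ∧ Q.WellFormed
  | branch _ P Q => P.WellFormed ∧ Q.WellFormed
  | .times v N P => 0 ≠ v ∧ N.Below 1 ∧ P.NatFree v ∧ P.WellFormed

/-- All loop bounds are at most `M` if the natural-number array `0` is `x`. -/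
def LoopsLe (M : ℕ) (x : ℕ → ℕ) : Code → Prop
  | skip => True
  | setNat _ _ _ => True
  | setReal _ _ _ => True
  | seq P Q => P.LoopsLe M x ∧ Q.LoopsLe M x
  | branch _ P Q => P.LoopsLe M x ∧ Q.LoopsLe M x
  | .times _ N P => (∀ σ : State, σ.nat 0 = x → N.eval σ ≤ M) ∧ P.LoopsLe M x

/-- Nesting depth of loops. -/
def depth : Code → ℕ
  | skip => 0
  | setNat _ _ _ => 0
  | setReal _ _ _ => 0
  | seq P Q => max P.depth Q.depth
  | branch _ P Q => max P.depth Q.depth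
  | .times _ _ P => P.depth + 1

/-- The running time when every loop is run through once, rounded up. -/
def weight : Code → ℕ
  | skip => 1
  | setNat _ i e => i.cost + e.cost + 1
  | setReal _ i e => i.cost + e.cost + 1
  | seq P Q => P.weight + Q.weight + 1
  | branch b P Q => b.cost + P.weight + Q.weight + 1
  | .times _ N P => P.weight + 2 * N.cost + 23

theorem den_nat {P : Code} {a : ℕ} (h : P.NatFree a) (σ : State) :
    (P.den σ).nat a = σ.nat a := by
  induction P generalizing σ with
  | skip => rfl
  | setNat b i e =>
    rw [den, State.setNat_nat, if_neg h]
  | setReal b i e => rfl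
  | seq P Q ihP ihQ => rw [den, ihQ h.2, ihP h.1]
  | branch b P Q ihP ihQ =>
    rw [den]
    split_ifs
    · exact ihP h.1 σ
    · exact ihQ h.2 σ
  | times v N P ih =>
    rw [den]
    induction N.eval σ with
    | zero => exact (State.setNat_nat ..).trans (if_neg h.1)
    | succ k ihk => simpa only [State.setNat_nat, if_neg h.1, ih h.2] using ihk

theorem den_real {P : Code} {a : ℕ} (h : P.RealFree a) (σ : State) :
    (P.den σ).real a = σ.real a := by
  induction P generalizing σ with
  | skip => rfl
  | setNat b i e => rfl
  | setReal b i e =>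
    rw [den, State.setReal_real, if_neg h]
  | seq P Q ihP ihQ => rw [den, ihQ h.2, ihP h.1]
  | branch b P Q ihP ihQ =>
    rw [den]
    split_ifs
    · exact ihP h.1 σ
    · exact ihQ h.2 σ
  | times v N P ih =>
    rw [den]
    induction N.eval σ with
    | zero => rfl
    | succ k ihk => simpa only [State.setNat_real, ih h] using ihk

/-- The invariant rule for loops. The step may use that arrays to which the body does not write are
unchanged. -/
theorem den_times {v : ℕ} {N : NatExp} {P : Code} {σ : State} {n : ℕ} (hn : N.eval σ = n)
    (I : ℕ → State → Prop) (h0 : I 0 (σ.setNat v 0 0))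
    (hs : ∀ k τ, k < n → τ.nat v 0 = k →
      (∀ a, a ≠ v → P.NatFree a → τ.nat a = σ.nat a) →
      (∀ a, P.RealFree a → τ.real a = σ.real a) →
      I k τ → I (k + 1) ((P.den τ).setNat v 0 (k + 1))) :
    I n ((Code.times v N P).den σ) := by
  rw [den]
  simp only [hn]
  have key : ∀ m, m ≤ n → ∀ τ, τ = (Nat.rec (σ.setNat v 0 0)
      (fun k τ => (P.den τ).setNat v 0 (k + 1)) m : State) →
      τ.nat v 0 = m ∧ (∀ a, a ≠ v → P.NatFree a → τ.nat a = σ.nat a) ∧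
      (∀ a, P.RealFree a → τ.real a = σ.real a) ∧ I m τ := by
    intro m
    induction m with
    | zero =>
      rintro - τ rfl
      refine ⟨by simp [State.setNat_nat], fun a ha _ => ?_, fun a _ => rfl, h0⟩
      simp [State.setNat_nat, ha]
    | succ m ih =>
      rintro hm τ rfl
      obtain ⟨h1, h2, h3, h4⟩ := ih (by omega) _ rfl
      refine ⟨by simp [State.setNat_nat], fun a ha hP => ?_, fun a hP => ?_,
        hs m _ (by omega) h1 h2 h3 h4⟩
      · rw [← h2 a ha hP]
        simp only [State.setNat_nat, if_neg ha, den_nat hP]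
      · rw [← h3 a hP]
        simp only [State.setNat_real, den_real hP]
  exact (key n le_rfl _ rfl).2.2.2

theorem WellFormed.natFree_zero {P : Code} (h : P.WellFormed) : P.NatFree 0 := by
  induction P with
  | skip => trivial
  | setNat b i e => exact h
  | setReal b i e => trivial
  | seq P Q ihP ihQ => exact ⟨ihP h.1, ihQ h.2⟩
  | branch b P Q ihP ihQ => exact ⟨ihP h.1, ihQ h.2⟩
  | times v N P ih => exact ⟨h.1, ih h.2.2.2⟩

/-- A well-formed loop program computes its denotation, within a time that is a monomial in the
largest loop bound, with the loop depth as exponent. -/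
theorem WellFormed.exec {P : Code} (h : P.WellFormed) {M : ℕ} (hM : 1 ≤ M) {σ : State}
    (hL : P.LoopsLe M (σ.nat 0)) :
    ∃ T ≤ P.weight * M ^ P.depth, Exec P.toProgram σ (P.den σ) T := by
  induction P generalizing σ with
  | skip => exact ⟨1, by simp [weight, depth], .skip σ⟩
  | setNat b i e => exact ⟨_, by simp [weight, depth], .setNat b i e σ⟩
  | setReal b i e => exact ⟨_, by simp [weight, depth], .setReal b i e σ⟩
  | seq P Q ihP ihQ =>
    obtain ⟨S, hS, eS⟩ := ihP h.1 hL.1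
    obtain ⟨T, hT, eT⟩ := ihQ h.2 (σ := P.den σ) (by
      rw [den_nat h.1.natFree_zero]; exact hL.2)
    refine ⟨_, ?_, .seq eS eT⟩
    have h1 : M ^ P.depth ≤ M ^ max P.depth Q.depth := Nat.pow_le_pow_right hM (le_max_left _ _)
    have h2 : M ^ Q.depth ≤ M ^ max P.depth Q.depth := Nat.pow_le_pow_right hM (le_max_right _ _)
    have h3 : 1 ≤ M ^ max P.depth Q.depth := Nat.one_le_pow _ _ hM
    have h4 := Nat.mul_le_mul_left P.weight h1
    have h5 := Nat.mul_le_mul_left Q.weight h2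
    simp only [weight, depth, add_mul, one_mul]
    omega
  | branch b P Q ihP ihQ =>
    have h1 : M ^ P.depth ≤ M ^ max P.depth Q.depth := Nat.pow_le_pow_right hM (le_max_left _ _)
    have h2 : M ^ Q.depth ≤ M ^ max P.depth Q.depth := Nat.pow_le_pow_right hM (le_max_right _ _)
    have h3 : 1 ≤ M ^ max P.depth Q.depth := Nat.one_le_pow _ _ hM
    have h4 := Nat.mul_le_mul_left P.weight h1
    have h5 := Nat.mul_le_mul_left Q.weight h2
    have h6 := Nat.mul_le_mul_left b.cost h3
    by_cases hb : b.Holds σ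
    · obtain ⟨S, hS, eS⟩ := ihP h.1 hL.1
      rw [den, if_pos hb]
      refine ⟨_, ?_, .branchTrue hb eS⟩
      simp only [weight, depth, add_mul, one_mul]
      omega
    · obtain ⟨S, hS, eS⟩ := ihQ h.2 hL.2
      rw [den, if_neg hb]
      refine ⟨_, ?_, .branchFalse hb eS⟩
      simp only [weight, depth, add_mul, one_mul]
      omega
  | times v N P ih =>
    obtain ⟨hv, hN, hPv, hP⟩ := h
    set st : ℕ → State := fun m => (Nat.rec (σ.setNat v 0 0)
      (fun k τ => (P.den τ).setNat v 0 (k + 1)) m : State) with hst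
    set n := N.eval σ with hn
    have h0 : ∀ m, (st m).nat 0 = σ.nat 0 := by
      intro m
      induction m with
      | zero => simp [hst, State.setNat_nat, hv]
      | succ m ihm =>
        rw [← ihm]
        simp only [hst, State.setNat_nat, if_neg hv, den_nat hP.natFree_zero]
    have hcnt : ∀ m, (st m).nat v 0 = m := by
      intro m
      cases m <;> simp [hst, State.setNat_nat]
    have hNe : ∀ m, N.eval (st m) = n := fun m =>
      hN.eval_congr fun a ha => by rw [Nat.lt_one_iff.mp ha, h0]
    have hnM : n ≤ M := hL.1 σ rfl
    set W := P.weight * M ^ P.depth with hW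
    set b : Test := .natLe (.add (.get v (.const 0)) (.const 1)) N with hb
    have hbc : b.cost = N.cost + 5 := by simp [hb, Test.cost, NatExp.cost]; ring
    have key : ∀ k m, m + k = n → ∃ T ≤ k * (W + N.cost + 13) + N.cost + 6,
        Exec (.loop b (.seq P.toProgram
          (.setNat v (.const 0) (.add (.get v (.const 0)) (.const 1))))) (st m) (st n) T := by
      intro k
      induction k with
      | zero =>
        rintro m hm
        obtain rfl : m = n := hm
        refine ⟨_, ?_, .loopFalse ?_⟩
        · omega
        · simp [hb, Test.Holds, NatExp.eval, hcnt, hNe]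
      | succ k ihk =>
        intro m hm
        obtain ⟨T, hT, eT⟩ := ihk (m + 1) (by omega)
        obtain ⟨S, hS, eS⟩ := ih hP (σ := st m) (by rw [h0]; exact hL.2)
        have e1 := Exec.setNat v (.const 0) (.add (.get v (.const 0)) (.const 1)) (P.den (st m))
        have e2 : (P.den (st m)).setNat v (NatExp.eval (P.den (st m)) (.const 0))
            (NatExp.eval (P.den (st m)) (.add (.get v (.const 0)) (.const 1))) = st (m + 1) := by
          simp only [NatExp.eval, den_nat hPv, hcnt]
          rfl
        rw [e2] at e1
        refine ⟨_, ?_, .loopTrue ?_ (.seq eS e1) eT⟩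
        · simp only [hbc, NatExp.cost, add_mul, one_mul]
          omega
        · simp only [hb, Test.Holds, NatExp.eval, hcnt, hNe]
          omega
    obtain ⟨T, hT, eT⟩ := key n 0 (by omega)
    refine ⟨_, ?_, .seq (.setNat v (.const 0) (.const 0) σ) eT⟩
    have h1 : n * (W + N.cost + 13) ≤ M * (W + N.cost + 13) := Nat.mul_le_mul_right _ hnM
    have h2 : 1 ≤ M ^ (P.depth) := Nat.one_le_pow _ _ hM
    have h3 : M ≤ M * M ^ P.depth := Nat.le_mul_of_pos_right _ h2
    have h4 : (N.cost + 13) * M ≤ (N.cost + 13) * (M * M ^ P.depth) := Nat.mul_le_mul_left _ h3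
    have h5 : (N.cost + 10) * 1 ≤ (N.cost + 10) * (M * M ^ P.depth) :=
      Nat.mul_le_mul_left _ (hM.trans h3)
    simp only [weight, depth, NatExp.cost]
    calc 1 + 1 + 1 + T + 1 ≤ M * (W + N.cost + 13) + (N.cost + 10) * 1 := by omega
      _ ≤ M * W + (N.cost + 13) * (M * M ^ P.depth)
          + (N.cost + 10) * (M * M ^ P.depth) := by linarith
      _ = (P.weight + 2 * N.cost + 23) * M ^ (P.depth + 1) := by rw [hW]; ring

end Code

end RealRAM

/-! ### Polygonal curves in integer parameterization -/

namespace Frechet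

section Pl

variable {E : Type*} [NormedAddCommGroup E] [NormedSpace ℝ E]

/-- The polygonal curve through `p 0, …, p k`, parameterized over `[0, k]` and passing through `p i`
at time `i`. -/
noncomputable def pl (p : ℕ → E) (k : ℕ) (t : ℝ) : E :=
  p 0 + ∑ i ∈ Finset.range k, (max 0 (min 1 (t - i))) • (p (i + 1) - p i)

theorem polyline_apply {k : ℕ} (p : ℕ → E) (x : unitInterval) :
    polyline (fun i : Fin (k + 1) => p i) x = pl p k (k * x) := by
  simp only [polyline, ContinuousMap.coe_mk, pl, Fin.val_zero, Fin.val_succ, Fin.val_castSucc]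
  rw [Finset.sum_range]

theorem pl_congr {p q : ℕ → E} {k : ℕ} (h : ∀ i ≤ k, p i = q i) (t : ℝ) : pl p k t = pl q k t := by
  rw [pl, pl, h 0 (Nat.zero_le _)]
  congr 1
  refine Finset.sum_congr rfl fun i hi => ?_
  rw [Finset.mem_range] at hi
  rw [h _ hi, h _ hi.le]

theorem pl_eq {p : ℕ → E} {k i : ℕ} (hi : i < k) {t : ℝ} (h0 : (i : ℝ) ≤ t) (h1 : t ≤ i + 1) :
    pl p k t = p i + (t - i) • (p (i + 1) - p i) := by
  obtain ⟨l, rfl⟩ : ∃ l, k = i + (l + 1) := ⟨k - i - 1, by omega⟩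
  have e1 : ∑ j ∈ Finset.range i, (max 0 (min 1 (t - j))) • (p (j + 1) - p j) = p i - p 0 := by
    rw [← Finset.sum_range_sub]
    refine Finset.sum_congr rfl fun j hj => ?_
    rw [Finset.mem_range] at hj
    have : (j : ℝ) + 1 ≤ i := by exact_mod_cast hj
    rw [min_eq_left (by linarith), max_eq_right zero_le_one, one_smul]
  have e2 : ∑ j ∈ Finset.range l, (max 0 (min 1 (t - ((i + (j + 1) : ℕ) : ℝ)))) •
      (p (i + (j + 1) + 1) - p (i + (j + 1))) = 0 := by
    refine Finset.sum_eq_zero fun j _ => ?_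
    have : (0 : ℝ) ≤ j := j.cast_nonneg
    rw [max_eq_left, zero_smul]
    refine (min_le_right _ _).trans ?_
    push_cast
    linarith
  rw [pl, Finset.sum_range_add, e1, Finset.sum_range_succ', e2, zero_add, add_zero,
    min_eq_right (by linarith), max_eq_right (by linarith)]
  abel

theorem pl_natCast {p : ℕ → E} {k i : ℕ} (hi : i ≤ k) : pl p k i = p i := by
  rcases Nat.lt_or_eq_of_le hi with h | rfl
  · rw [pl_eq h le_rfl (by linarith), sub_self, zero_smul, add_zero]
  · rcases Nat.eq_zero_or_pos i with rfl | h
    · simp [pl]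
    · obtain ⟨j, rfl⟩ : ∃ j, i = j + 1 := ⟨i - 1, by omega⟩
      rw [pl_eq (Nat.lt_succ_self j) (by push_cast; linarith) (by push_cast; linarith)]
      simp

/-- Between two times in one segment, the curve is affine. -/
theorem pl_affine {p : ℕ → E} {k i : ℕ} (hi : i < k) {s t l : ℝ} (h0 : (i : ℝ) ≤ s) (hst : s ≤ t)
    (h1 : t ≤ i + 1) (hl0 : 0 ≤ l) (hl1 : l ≤ 1) :
    pl p k (s + l * (t - s)) = (1 - l) • pl p k s + l • pl p k t := by
  have : l * (t - s) ≤ t - s := mul_le_of_le_one_left (by linarith) hl1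
  have : 0 ≤ l * (t - s) := mul_nonneg hl0 (by linarith)
  rw [pl_eq hi h0 (by linarith), pl_eq hi (by linarith) h1, pl_eq hi (by linarith) (by linarith)]
  module

theorem pl_mono {p : ℕ → ℝ} {k : ℕ} (hp : ∀ i < k, p i ≤ p (i + 1)) : Monotone (pl p k) := by
  intro s t hst
  unfold pl
  refine add_le_add le_rfl (Finset.sum_le_sum fun i hi => ?_)
  rw [Finset.mem_range] at hi
  exact mul_le_mul_of_nonneg_right
    (max_le_max le_rfl (min_le_min le_rfl (by linarith))) (by linarith [hp i hi])

theorem continuous_pl (p : ℕ → E) (k : ℕ) : Continuous (pl p k) := by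
  unfold pl
  fun_prop

end Pl

/-- A nondecreasing sequence from `0` to `1` gives a piecewise linear reparameterization. -/
theorem exists_isMonotoneReparam {φ : ℕ → ℝ} {m : ℕ} (hφ : ∀ i < m, φ i ≤ φ (i + 1))
    (h0 : φ 0 = 0) (h1 : φ m = 1) :
    ∃ f : C(unitInterval, unitInterval), IsMonotoneReparam f ∧
      ∀ x : unitInterval, (f x : ℝ) = pl φ m (m * x) := by
  have hm : ∀ x : unitInterval, 0 ≤ (m : ℝ) * x ∧ (m : ℝ) * x ≤ m := fun x =>
    ⟨mul_nonneg m.cast_nonneg x.2.1, mul_le_of_le_one_right m.cast_nonneg x.2.2⟩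
  have e0 : pl φ m 0 = 0 := by
    have := pl_natCast (p := φ) (Nat.zero_le m)
    rwa [Nat.cast_zero, h0] at this
  have e1 : pl φ m m = 1 := by rw [pl_natCast le_rfl, h1]
  have mono := pl_mono hφ
  refine ⟨⟨fun x => ⟨pl φ m (m * x), ?_, ?_⟩, ?_⟩, ⟨?_, ?_, ?_⟩, fun x => rfl⟩
  · rw [← e0]; exact mono (hm x).1
  · rw [← e1]; exact mono (hm x).2
  · have := continuous_pl φ m
    fun_prop
  · intro x y hxy
    exact Subtype.mk_le_mk.mpr
      (mono (mul_le_mul_of_nonneg_left (by exact_mod_cast hxy) m.cast_nonneg))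
  · exact Subtype.ext (by simpa using e0)
  · exact Subtype.ext (by simpa using e1)

/-- Two polygonal curves that move, in each step `i < m`, along one segment each (or rest) keep the
distance `δ` if they do so at the times between the steps. -/
theorem dist_pl_le {E : Type*} [NormedAddCommGroup E] [NormedSpace ℝ E] {p q : ℕ → E} {k l m : ℕ}
    {φ ψ : ℕ → ℝ} {δ : ℝ}
    (hp : ∀ i < m, ∀ r : ℝ, 0 ≤ r → r ≤ 1 → pl p k (k * (φ i + r * (φ (i + 1) - φ i))) =
      (1 - r) • pl p k (k * φ i) + r • pl p k (k * φ (i + 1)))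
    (hq : ∀ i < m, ∀ r : ℝ, 0 ≤ r → r ≤ 1 → pl q l (l * (ψ i + r * (ψ (i + 1) - ψ i))) =
      (1 - r) • pl q l (l * ψ i) + r • pl q l (l * ψ (i + 1)))
    (hd : ∀ i ≤ m, dist (pl p k (k * φ i)) (pl q l (l * ψ i)) ≤ δ) {x : ℝ} (hx0 : 0 ≤ x)
    (hx1 : x ≤ m) (hm : 0 < m) : dist (pl p k (k * pl φ m x)) (pl q l (l * pl ψ m x)) ≤ δ := by
  obtain ⟨i, him, h0, h1⟩ : ∃ i < m, (i : ℝ) ≤ x ∧ x ≤ i + 1 := by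
    by_cases h : ⌊x⌋₊ < m
    · exact ⟨_, h, Nat.floor_le hx0, (Nat.lt_floor_add_one x).le⟩
    · refine ⟨m - 1, by omega, ?_, ?_⟩
      · rw [Nat.cast_sub hm]
        have : (m : ℝ) ≤ ⌊x⌋₊ := by exact_mod_cast not_lt.mp h
        have := Nat.floor_le hx0
        push_cast
        linarith
      · rw [Nat.cast_sub hm]
        push_cast
        linarith
  rw [pl_eq him h0 h1, pl_eq him h0 h1]
  simp only [smul_eq_mul]
  rw [hp i him _ (by linarith) (by linarith), hq i him _ (by linarith) (by linarith)]
  set r := x - i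
  have hr0 : 0 ≤ r := by simp only [r]; linarith
  have hr1 : 0 ≤ 1 - r := by simp only [r]; linarith
  rw [dist_eq_norm]
  have e : ∀ a b c d : E, (1 - r) • a + r • b - ((1 - r) • c + r • d)
    = (1 - r) • (a - c) + r • (b - d) := fun a b c d => by module
  rw [e]
  refine (norm_add_le _ _).trans ?_
  rw [norm_smul, norm_smul, Real.norm_of_nonneg hr0, Real.norm_of_nonneg hr1, ← dist_eq_norm,
    ← dist_eq_norm]
  have i1 := mul_le_mul_of_nonneg_left (hd i him.le) hr1
  have i2 := mul_le_mul_of_nonneg_left (hd (i + 1) him) hr0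
  linarith

/-! ### Fréchet distance and monotone reparameterizations -/

theorem dist_le_width {E : Type*} [MetricSpace E] (c₁ c₂ : C(unitInterval, E))
    (f g : C(unitInterval, unitInterval)) (s : unitInterval) :
    dist (c₁ (f s)) (c₂ (g s)) ≤ width c₁ c₂ f g := by
  have hc : Continuous fun s => dist (c₁ (f s)) (c₂ (g s)) := by fun_prop
  exact le_ciSup (f := fun s => dist (c₁ (f s)) (c₂ (g s))) (isCompact_range hc).bddAbove s

/-- Averaging with the identity makes a monotone reparameterization injective. -/
theorem IsMonotoneReparam.exists_reparam {f : C(unitInterval, unitInterval)}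
    (hf : IsMonotoneReparam f) {l : ℝ} (hl : 0 < l) (hl1 : l ≤ 1) :
    ∃ r : Reparam, ∀ s, dist (r.1 s) (f s) ≤ l := by
  have hmem : ∀ s, (1 - l) * (f s : ℝ) + l * (s : ℝ) ∈ unitInterval := fun s =>
    convex_Icc (0 : ℝ) 1 (f s).2 s.2 (by linarith) hl.le (by ring)
  refine ⟨⟨⟨fun s => ⟨_, hmem s⟩, by fun_prop⟩, ?_, ?_, ?_⟩, ?_⟩
  · apply StrictMono.injective
    intro s t hst
    have h1 : (f s : ℝ) ≤ f t := hf.monotone hst.le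
    have h2 : (s : ℝ) < t := hst
    refine Subtype.mk_lt_mk.mpr ?_
    have h3 := mul_le_mul_of_nonneg_left h1 (sub_nonneg.mpr hl1)
    have h4 := mul_lt_mul_of_pos_left h2 hl
    linarith
  · exact Subtype.ext (by simp [hf.map_zero])
  · exact Subtype.ext (by simp [hf.map_one])
  · intro s
    rw [Subtype.dist_eq, Real.dist_eq]
    have e : (1 - l) * (f s : ℝ) + l * (s : ℝ) - f s = l * (s - f s) := by ring
    change |(1 - l) * (f s : ℝ) + l * (s : ℝ) - f s| ≤ l
    rw [e, abs_mul, abs_of_pos hl]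
    refine mul_le_of_le_one_right hl.le (abs_le.mpr ⟨?_, ?_⟩) <;>
      linarith [s.2.1, s.2.2, (f s).2.1, (f s).2.2]

theorem frechetDist_le_of_width_le {E : Type*} [MetricSpace E] {c₁ c₂ : C(unitInterval, E)}
    {f g : C(unitInterval, unitInterval)} (hf : IsMonotoneReparam f) (hg : IsMonotoneReparam g)
    {δ : ℝ} (h : width c₁ c₂ f g ≤ δ) : frechetDist c₁ c₂ ≤ δ := by
  refine le_of_forall_pos_le_add fun ε hε => ?_
  obtain ⟨a, ha, hca⟩ := Metric.uniformContinuous_iff.mp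
    (CompactSpace.uniformContinuous_of_continuous c₁.continuous) (ε / 2) (half_pos hε)
  obtain ⟨b, hb, hcb⟩ := Metric.uniformContinuous_iff.mp
    (CompactSpace.uniformContinuous_of_continuous c₂.continuous) (ε / 2) (half_pos hε)
  set l := min 1 (min (a / 2) (b / 2))
  have hl : 0 < l := by positivity
  have hl1 : l ≤ 1 := min_le_left _ _
  have hla : l < a := ((min_le_right _ _).trans (min_le_left _ _)).trans_lt (half_lt_self ha)
  have hlb : l < b := ((min_le_right _ _).trans (min_le_right _ _)).trans_lt (half_lt_self hb)
  obtain ⟨r, hr⟩ := hf.exists_reparam hl hl1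
  obtain ⟨q, hq⟩ := hg.exists_reparam hl hl1
  have hbdd : BddBelow (Set.range fun r : Reparam × Reparam => width c₁ c₂ r.1.1 r.2.1) :=
    ⟨0, by rintro _ ⟨r, rfl⟩; exact Real.iSup_nonneg fun s => dist_nonneg⟩
  refine (ciInf_le hbdd (r, q)).trans (ciSup_le fun s => ?_)
  have h1 := (hca ((hr s).trans_lt hla)).le
  have h2 := (hcb ((hq s).trans_lt hlb)).le
  have h3 := (dist_le_width c₁ c₂ f g s).trans h
  have h4 := dist_triangle4 (c₁ (r.1 s)) (c₁ (f s)) (c₂ (g s)) (c₂ (q.1 s))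
  rw [dist_comm (c₂ (g s))] at h4
  change dist (c₁ (r.1 s)) (c₂ (q.1 s)) ≤ δ + ε
  linarith

theorem Reparam.monotone (r : Reparam) : Monotone r.1 := by
  refine (r.1.continuous.strictMono_of_inj_boundedOrder ?_ r.2.1).monotone
  have h0 : r.1 ⊥ = 0 := r.2.2.1
  have h1 : r.1 ⊤ = 1 := r.2.2.2
  rw [h0, h1]
  exact zero_le_one

/-- If the Fréchet distance is at most `δ`, then some pair of monotone, resting, reparameterizations
attains `δ`. The pairs of injective reparameterizations are parameterized by the mean of both
components; the pointwise limit of such parameterizations along an ultrafilter is again continuous,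
since the mean is preserved in the limit. -/
theorem exists_monotone_of_frechetDist_le {E : Type*} [MetricSpace E] {c₁ c₂ : C(unitInterval, E)}
    {δ : ℝ} (h : frechetDist c₁ c₂ ≤ δ) :
    ∃ F G : unitInterval → unitInterval, Monotone F ∧ Monotone G ∧
      (∀ t, (F t : ℝ) + G t = 2 * t) ∧ ∀ t, dist (c₁ (F t)) (c₂ (G t)) ≤ δ := by
  have : Nonempty (Reparam × Reparam) := by
    have : Reparam := ⟨ContinuousMap.id _, fun _ _ h => h, rfl, rfl⟩
    exact ⟨this, this⟩
  have hr : ∀ n : ℕ, ∃ r : Reparam × Reparam, width c₁ c₂ r.1.1 r.2.1 < δ + 1 / (n + 1) := fun n =>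
    exists_lt_of_ciInf_lt (h.trans_lt (lt_add_of_pos_right _ Nat.one_div_pos_of_nat))
  choose r hr using hr
  have hs : ∀ (n : ℕ) (t : unitInterval), ∃ s, ((r n).1.1 s : ℝ) + (r n).2.1 s = 2 * t := by
    intro n t
    have hc : Continuous fun s => ((r n).1.1 s : ℝ) + (r n).2.1 s := by fun_prop
    refine intermediate_value_univ (0 : unitInterval) 1 hc ⟨?_, ?_⟩
    · simp [(r n).1.2.2.1, (r n).2.2.2.1, t.2.1]
    · simp only [(r n).1.2.2.2, (r n).2.2.2.2, Set.Icc.coe_one]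
      linarith [t.2.2]
  choose s hs using hs
  have hmono : ∀ n, Monotone (s n) := by
    intro n t u htu
    by_contra! hlt
    have h1 : ((r n).1.1 (s n u) : ℝ) ≤ (r n).1.1 (s n t) := (r n).1.monotone hlt.le
    have h2 : ((r n).2.1 (s n u) : ℝ) ≤ (r n).2.1 (s n t) := (r n).2.monotone hlt.le
    have h3 : (t : ℝ) ≤ u := htu
    have h4 := hs n t
    have h5 := hs n u
    have h6 : (t : ℝ) = u := by linarith
    have h7 : t = u := Subtype.ext h6
    rw [h7] at hlt
    exact lt_irrefl _ hlt
  set U : Filter ℕ := (Filter.hyperfilter ℕ : Filter ℕ)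
  have hU : ∀ x : ℕ → unitInterval, ∃ y, Filter.Tendsto x U (nhds y) := fun x => by
    obtain ⟨y, -, hy⟩ := isCompact_univ.ultrafilter_le_nhds ((Filter.hyperfilter ℕ).map x)
      (by simp)
    exact ⟨y, hy⟩
  choose F hF using fun t => hU fun n => (r n).1.1 (s n t)
  choose G hG using fun t => hU fun n => (r n).2.1 (s n t)
  refine ⟨F, G, ?_, ?_, fun t => ?_, fun t => ?_⟩
  · exact fun t u htu => le_of_tendsto_of_tendsto' (hF t) (hF u) fun n =>
      (r n).1.monotone (hmono n htu)
  · exact fun t u htu => le_of_tendsto_of_tendsto' (hG t) (hG u) fun n =>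
      (r n).2.monotone (hmono n htu)
  · have h1 : Filter.Tendsto (fun n => ((r n).1.1 (s n t) : ℝ)) U (nhds (F t)) :=
      (continuous_subtype_val.tendsto _).comp (hF t)
    have h2 : Filter.Tendsto (fun n => ((r n).2.1 (s n t) : ℝ)) U (nhds (G t)) :=
      (continuous_subtype_val.tendsto _).comp (hG t)
    refine tendsto_nhds_unique (h1.add h2) ?_
    simp only [hs]
    exact tendsto_const_nhds
  · have h1 := (c₁.continuous.tendsto _).comp (hF t)
    have h2 := (c₂.continuous.tendsto _).comp (hG t)
    have h3 : Filter.Tendsto (fun n : ℕ => δ + 1 / ((n : ℝ) + 1)) U (nhds (δ + 0)) :=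
      (tendsto_const_nhds.add tendsto_one_div_add_atTop_nhds_zero_nat).mono_left
        (Nat.hyperfilter_le_atTop)
    rw [add_zero] at h3
    exact le_of_tendsto_of_tendsto' (h1.dist h2) h3 fun n =>
      ((dist_le_width c₁ c₂ (r n).1.1 (r n).2.1 (s n t)).trans_lt (hr n)).le

/-- Monotone functions on the unit interval with constant speed sum are Lipschitz. -/
theorem continuous_of_add_eq {F G : unitInterval → unitInterval} (hF : Monotone F)
    (hG : Monotone G) (h : ∀ t, (F t : ℝ) + G t = 2 * t) : Continuous F := by
  have hL : LipschitzWith 2 F := by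
    refine LipschitzWith.of_dist_le_mul fun t u => ?_
    wlog htu : t ≤ u generalizing t u
    · rw [dist_comm, dist_comm t]
      exact this u t (le_of_not_ge htu)
    have h1 : (F t : ℝ) ≤ F u := hF htu
    have h2 : (G t : ℝ) ≤ G u := hG htu
    have h3 : (t : ℝ) ≤ u := htu
    rw [Subtype.dist_eq, Subtype.dist_eq, Real.dist_eq, Real.dist_eq, abs_sub_comm,
      abs_sub_comm (t : ℝ), abs_of_nonneg (by linarith), abs_of_nonneg (by linarith)]
    have := h t
    have := h u
    push_cast
    linarith
  exact hL.continuous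

end Frechet

/-! ### Dynamic programming in the free space of two graphs -/

namespace Frechet

/-- A directed graph as the dynamic program sees it. Its locations are the numbers below `L`: the
vertices, which are the numbers below `V`, and the edges. A vertex is its own tail and head. -/
structure LocGraph where
  V : ℕ
  L : ℕ
  tl : ℕ → ℕ
  hd : ℕ → ℕ
  V_le : V ≤ L
  tl_vertex : ∀ c < V, tl c = c
  hd_vertex : ∀ c < V, hd c = c
  tl_lt : ∀ c < L, tl c < V
  hd_lt : ∀ c < L, hd c < V

namespace LocGraph

variable (G : LocGraph)

/-- `ρ` increases from the tail of an edge to the edge, and from the edge to its head. -/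
def IsRank (ρ : ℕ → ℕ) : Prop :=
  ∀ c, G.V ≤ c → c < G.L → ρ (G.tl c) < ρ c ∧ ρ c < ρ (G.hd c)

variable {G} {ρ : ℕ → ℕ}

theorem IsRank.tl_le (h : G.IsRank ρ) {c : ℕ} (hc : c < G.L) : ρ (G.tl c) ≤ ρ c := by
  rcases lt_or_ge c G.V with hV | hV
  · rw [G.tl_vertex c hV]
  · exact (h c hV hc).1.le

theorem IsRank.le_hd (h : G.IsRank ρ) {c : ℕ} (hc : c < G.L) : ρ c ≤ ρ (G.hd c) := by
  rcases lt_or_ge c G.V with hV | hV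
  · rw [G.hd_vertex c hV]
  · exact (h c hV hc).2.le

theorem IsRank.tl_ne_hd (h : G.IsRank ρ) {c : ℕ} (hV : G.V ≤ c) (hc : c < G.L) :
    G.tl c ≠ G.hd c := fun e => by
  have := h c hV hc
  rw [e] at this
  omega

theorem tl_ne {c : ℕ} (hV : G.V ≤ c) (hc : c < G.L) : G.tl c ≠ c :=
  ((G.tl_lt c hc).trans_le hV).ne

theorem hd_ne {c : ℕ} (hV : G.V ≤ c) (hc : c < G.L) : G.hd c ≠ c :=
  ((G.hd_lt c hc).trans_le hV).ne

variable {E : Type*} [NormedAddCommGroup E] [NormedSpace ℝ E]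

/-- The point at parameter `x` on the location `c`, when the vertices are placed by `p`. -/
def pt (G : LocGraph) (p : ℕ → E) (c : ℕ) (x : ℝ) : E := p (G.tl c) + x • (p (G.hd c) - p (G.tl c))

theorem pt_vertex {p : ℕ → E} {c : ℕ} (hc : c < G.V) (x : ℝ) : G.pt p c x = p c := by
  simp [pt, G.tl_vertex c hc, G.hd_vertex c hc]

end LocGraph

/-- `Arc G₁ G₂ a b ν ν' k`: in the cell `a × b` of the free space, the free space on the side `ν'`
can be reached from that on the side `ν`. If `k` is true, the two sides are opposite, and monotone
curves do not return below the parameter at which they start; otherwise all of the free space on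
`ν'` is reachable. If `a` or `b` is a vertex, then the cell degenerates, and some of its sides are
corners. -/
inductive Arc (G₁ G₂ : LocGraph) (a b : ℕ) : ℕ × ℕ → ℕ × ℕ → Bool → Prop
  | leftRight : Arc G₁ G₂ a b (G₁.tl a, b) (G₁.hd a, b) true
  | bottomTop : Arc G₁ G₂ a b (a, G₂.tl b) (a, G₂.hd b) true
  | bottomRight : Arc G₁ G₂ a b (a, G₂.tl b) (G₁.hd a, b) false
  | leftTop : Arc G₁ G₂ a b (G₁.tl a, b) (a, G₂.hd b) false

/-- The cell is not a pair of vertices. -/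
structure IsCell (G₁ G₂ : LocGraph) (a b : ℕ) : Prop where
  fst_lt : a < G₁.L
  snd_lt : b < G₂.L
  not_corner : G₁.V ≤ a ∨ G₂.V ≤ b

section Arc

variable {G₁ G₂ : LocGraph} {a b : ℕ} {ν ν' : ℕ × ℕ} {k : Bool}

theorem Arc.ne_of_false (h : Arc G₁ G₂ a b ν ν' k) (hc : IsCell G₁ G₂ a b) (hk : k = false) :
    ν ≠ ν' := by
  rcases h with _ | _ | _ | _
  · simp at hk
  · simp at hk
  · rcases hc.not_corner with h | h
    · simp [(LocGraph.hd_ne h hc.fst_lt).symm]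
    · simp [LocGraph.tl_ne h hc.snd_lt]
  · rcases hc.not_corner with h | h
    · simp [LocGraph.tl_ne h hc.fst_lt]
    · simp [(LocGraph.hd_ne h hc.snd_lt).symm]

theorem Arc.src_lt (h : Arc G₁ G₂ a b ν ν' k) (hc : IsCell G₁ G₂ a b) :
    ν.1 < G₁.L ∧ ν.2 < G₂.L := by
  have := (G₁.tl_lt a hc.fst_lt).trans_le G₁.V_le
  have := (G₂.tl_lt b hc.snd_lt).trans_le G₂.V_le
  have := hc.fst_lt
  have := hc.snd_lt
  rcases h with _ | _ | _ | _ <;> exact ⟨by assumption, by assumption⟩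

theorem Arc.rank_src_le (h : Arc G₁ G₂ a b ν ν' k) (hc : IsCell G₁ G₂ a b) {ρ₁ ρ₂ : ℕ → ℕ}
    (h₁ : G₁.IsRank ρ₁) (h₂ : G₂.IsRank ρ₂) : ρ₁ ν.1 ≤ ρ₁ a ∧ ρ₂ ν.2 ≤ ρ₂ b := by
  have := h₁.tl_le hc.fst_lt
  have := h₂.tl_le hc.snd_lt
  rcases h with _ | _ | _ | _ <;> simp [*]

theorem Arc.rank_le_tgt (h : Arc G₁ G₂ a b ν ν' k) (hc : IsCell G₁ G₂ a b) {ρ₁ ρ₂ : ℕ → ℕ}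
    (h₁ : G₁.IsRank ρ₁) (h₂ : G₂.IsRank ρ₂) : ρ₁ a ≤ ρ₁ ν'.1 ∧ ρ₂ b ≤ ρ₂ ν'.2 := by
  have := h₁.le_hd hc.fst_lt
  have := h₂.le_hd hc.snd_lt
  rcases h with _ | _ | _ | _ <;> simp [*]

theorem Arc.rank_lt (h : Arc G₁ G₂ a b ν ν' k) (hc : IsCell G₁ G₂ a b) (hne : ν ≠ ν')
    {ρ₁ ρ₂ : ℕ → ℕ} (h₁ : G₁.IsRank ρ₁) (h₂ : G₂.IsRank ρ₂) :
    ρ₁ ν.1 + ρ₂ ν.2 < ρ₁ ν'.1 + ρ₂ ν'.2 := by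
  have e1 := h₁.tl_le hc.fst_lt
  have e2 := h₁.le_hd hc.fst_lt
  have e3 := h₂.tl_le hc.snd_lt
  have e4 := h₂.le_hd hc.snd_lt
  have f1 := fun h => h₁ a h hc.fst_lt
  have f2 := fun h => h₂ b h hc.snd_lt
  have g1 : a < G₁.V → G₁.tl a = G₁.hd a := fun h => by rw [G₁.tl_vertex a h, G₁.hd_vertex a h]
  have g2 : b < G₂.V → G₂.tl b = G₂.hd b := fun h => by rw [G₂.tl_vertex b h, G₂.hd_vertex b h]
  have hc' := hc.not_corner
  rcases h with _ | _ | _ | _ <;> simp only [ne_eq, Prod.mk.injEq, and_true, true_and] at hne ⊢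
  · have := f1 (le_of_not_gt fun h => hne (g1 h))
    omega
  · have := f2 (le_of_not_gt fun h => hne (g2 h))
    omega
  · rcases hc' with h | h
    · have := f1 h; omega
    · have := f2 h; omega
  · rcases hc' with h | h
    · have := f1 h; omega
    · have := f2 h; omega

end Arc

/-- The table of the dynamic program: the least reachable parameter on each side of a cell (more
than `1` if there is none), and the side from which it has been reached. -/
structure Table where
  lo : ℕ × ℕ → ℝ
  pr : ℕ × ℕ → ℕ × ℕ

/-- The lower bound along an arc that starts at parameter `x`. -/
noncomputable def lbound (k : Bool) (x : ℝ) : ℝ := if k then x else 0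

theorem lbound_mono (k : Bool) : Monotone (lbound k) := by
  intro x y h
  cases k <;> simp [lbound, h]

/-- The arc from `ν` to `ν'` cannot improve the entry of `ν'`. Here and below, the free space on a
side `ν` is the interval from `FL ν` to `FH ν`. -/
def Relaxed (FL FH : ℕ × ℕ → ℝ) (lo : ℕ × ℕ → ℝ) (ν ν' : ℕ × ℕ) (k : Bool) : Prop :=
  lo ν ≤ 1 → max (lbound k (lo ν)) (FL ν') ≤ FH ν' → lo ν' ≤ max (lbound k (lo ν)) (FL ν')

/-- All arcs in the cell are relaxed. -/
def CellClosed (G₁ G₂ : LocGraph) (FL FH : ℕ × ℕ → ℝ) (lo : ℕ × ℕ → ℝ) (a b : ℕ) : Prop :=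
  ∀ ν ν' k, Arc G₁ G₂ a b ν ν' k → Relaxed FL FH lo ν ν' k

theorem Relaxed.le_of_free {FL FH : ℕ × ℕ → ℝ} {lo : ℕ × ℕ → ℝ} {ν ν' : ℕ × ℕ} {k : Bool}
    (h : Relaxed FL FH lo ν ν' k) (hν : lo ν ≤ 1) {x : ℝ} (hx : lbound k (lo ν) ≤ x)
    (h0 : FL ν' ≤ x) (h1 : x ≤ FH ν') : lo ν' ≤ x :=
  (h hν ((max_le hx h0).trans h1)).trans (max_le hx h0)

theorem relaxed_self (FL FH : ℕ × ℕ → ℝ) (lo : ℕ × ℕ → ℝ) (ν : ℕ × ℕ) :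
    Relaxed FL FH lo ν ν true := fun _ _ => le_max_left _ _

open scoped Classical in
/-- Improve the entry of `ν'` along an arc from `ν`, if possible. -/
noncomputable def Table.relax (FL FH : ℕ × ℕ → ℝ) (T : Table) (ν ν' : ℕ × ℕ) (k : Bool) : Table :=
  if T.lo ν ≤ 1 ∧ max (lbound k (T.lo ν)) (FL ν') ≤ FH ν' ∧
      max (lbound k (T.lo ν)) (FL ν') < T.lo ν' then
    ⟨Function.update T.lo ν' (max (lbound k (T.lo ν)) (FL ν')), Function.update T.pr ν' ν⟩
  else T

section Relax

variable {FL FH : ℕ × ℕ → ℝ} {T : Table} {ν ν' μ μ' : ℕ × ℕ} {k l : Bool}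

theorem Table.relax_lo_le (μ : ℕ × ℕ) : (T.relax FL FH ν ν' k).lo μ ≤ T.lo μ := by
  unfold Table.relax
  split_ifs with h
  · by_cases hμ : μ = ν'
    · subst hμ
      simpa using h.2.2.le
    · simp [hμ]
  · exact le_rfl

theorem Table.relax_lo_of_ne (h : μ ≠ ν') : (T.relax FL FH ν ν' k).lo μ = T.lo μ := by
  unfold Table.relax
  split_ifs <;> simp [h]

theorem Relaxed.relax_eq (h : Relaxed FL FH T.lo ν ν' k) : T.relax FL FH ν ν' k = T := by
  unfold Table.relax
  rw [if_neg]
  rintro ⟨h1, h2, h3⟩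
  exact absurd (h h1 h2) (not_le.mpr h3)

theorem Relaxed.relax (h : Relaxed FL FH T.lo μ μ' l) (hne : μ ≠ ν') :
    Relaxed FL FH (T.relax FL FH ν ν' k).lo μ μ' l := by
  unfold Relaxed
  rw [Table.relax_lo_of_ne hne]
  exact fun h1 h2 => (Table.relax_lo_le _).trans (h h1 h2)

theorem Table.relaxed_relax (h : ν ≠ ν') : Relaxed FL FH (T.relax FL FH ν ν' k).lo ν ν' k := by
  unfold Relaxed
  rw [Table.relax_lo_of_ne h]
  intro h1 h2
  by_cases h3 : max (lbound k (T.lo ν)) (FL ν') < T.lo ν'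
  · simp [Table.relax, h1, h2, h3]
  · exact (Table.relax_lo_le _).trans (not_lt.mp h3)

end Relax

/-- Relax all arcs in a cell. The order, and the repetition of the last arc, matter only for
degenerate cells: then the target of one of the last two kinds of arcs is the source of the other
kind. -/
noncomputable def Table.relaxCell (G₁ G₂ : LocGraph) (FL FH : ℕ × ℕ → ℝ) (a b : ℕ) (T : Table) :
    Table :=
  ((((T.relax FL FH (G₁.tl a, b) (G₁.hd a, b) true).relax FL FH
    (a, G₂.tl b) (a, G₂.hd b) true).relax FL FH
    (a, G₂.tl b) (G₁.hd a, b) false).relax FL FH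
    (G₁.tl a, b) (a, G₂.hd b) false).relax FL FH
    (a, G₂.tl b) (G₁.hd a, b) false

theorem Table.cellClosed_relaxCell {G₁ G₂ : LocGraph} {FL FH : ℕ × ℕ → ℝ} {a b : ℕ} {T : Table}
    (hc : IsCell G₁ G₂ a b) {ρ₁ ρ₂ : ℕ → ℕ} (h₁ : G₁.IsRank ρ₁) (h₂ : G₂.IsRank ρ₂) :
    CellClosed G₁ G₂ FL FH (T.relaxCell G₁ G₂ FL FH a b).lo a b := by
  have ha := hc.fst_lt
  have hb := hc.snd_lt
  have vEq : a < G₁.V → G₁.tl a = a ∧ G₁.hd a = a := fun h =>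
    ⟨G₁.tl_vertex a h, G₁.hd_vertex a h⟩
  have wEq : b < G₂.V → G₂.tl b = b ∧ G₂.hd b = b := fun h =>
    ⟨G₂.tl_vertex b h, G₂.hd_vertex b h⟩
  have vNe := fun h => And.intro (LocGraph.tl_ne (G := G₁) (c := a) h ha)
    (And.intro (LocGraph.hd_ne (G := G₁) (c := a) h ha) (h₁.tl_ne_hd h ha))
  have wNe := fun h => And.intro (LocGraph.tl_ne (G := G₂) (c := b) h hb)
    (And.intro (LocGraph.hd_ne (G := G₂) (c := b) h hb) (h₂.tl_ne_hd h hb))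
  have hbr : ((a, G₂.tl b) : ℕ × ℕ) ≠ (G₁.hd a, b) :=
    (Arc.bottomRight (G₁ := G₁) (G₂ := G₂)).ne_of_false hc rfl
  have hlt : ((G₁.tl a, b) : ℕ × ℕ) ≠ (a, G₂.hd b) :=
    (Arc.leftTop (G₁ := G₁) (G₂ := G₂)).ne_of_false hc rfl
  intro ν ν' k h
  unfold Table.relaxCell
  rcases h with _ | _ | _ | _
  · rcases lt_or_ge a G₁.V with h | h
    · rw [(vEq h).1, (vEq h).2]
      exact relaxed_self _ _ _ _
    · have hne : ((G₁.tl a, b) : ℕ × ℕ) ≠ (G₁.hd a, b) := by simp [vNe h]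
      exact ((((Table.relaxed_relax hne).relax hlt).relax hne).relax hlt).relax hne
  · rcases lt_or_ge b G₂.V with h | h
    · rw [(wEq h).1, (wEq h).2]
      exact relaxed_self _ _ _ _
    · have hne : ((a, G₂.tl b) : ℕ × ℕ) ≠ (a, G₂.hd b) := by simp [wNe h]
      exact (((Table.relaxed_relax hne).relax hbr).relax hne).relax hbr
  · exact Table.relaxed_relax hbr
  · rcases lt_or_ge a G₁.V with h | h
    · have h' := hc.not_corner.resolve_left (not_le.mpr h)
      have hne : ((a, G₂.tl b) : ℕ × ℕ) ≠ (a, G₂.hd b) := by simp [wNe h']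
      rw [Relaxed.relax_eq (ν := (a, G₂.tl b)) (ν' := (G₁.hd a, b))
        ((Table.relaxed_relax hbr).relax hne)]
      exact Table.relaxed_relax hlt
    · have hne : ((G₁.tl a, b) : ℕ × ℕ) ≠ (G₁.hd a, b) := by simp [vNe h]
      exact (Table.relaxed_relax hlt).relax hne

/-- The invariant of the dynamic program that starts at `st`, when the cells in `done` have been
dealt with. -/
structure Table.Inv (G₁ G₂ : LocGraph) (FL FH : ℕ × ℕ → ℝ) (st : ℕ × ℕ) (done : ℕ → ℕ → Prop)
    (T : Table) : Prop where
  free : ∀ ν, T.lo ν ≤ 1 → FL ν ≤ T.lo ν ∧ T.lo ν ≤ FH ν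
  start : FL st ≤ FH st → T.lo st ≤ FL st
  pred : ∀ ν, T.lo ν ≤ 1 → T.lo (T.pr ν) ≤ 1 ∧ (ν = st ∧ T.pr ν = st ∨
    ν ≠ st ∧ T.pr ν ≠ ν ∧ ∃ a b k, IsCell G₁ G₂ a b ∧ Arc G₁ G₂ a b (T.pr ν) ν k ∧
      lbound k (T.lo (T.pr ν)) ≤ T.lo ν)
  closed : ∀ a b, done a b → CellClosed G₁ G₂ FL FH T.lo a b

section Inv

variable {G₁ G₂ : LocGraph} {FL FH : ℕ × ℕ → ℝ} {st : ℕ × ℕ} {done : ℕ → ℕ → Prop} {T : Table}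

theorem Table.Inv.relax (hT : T.Inv G₁ G₂ FL FH st done) {a b : ℕ} {ν ν' : ℕ × ℕ} {k : Bool}
    (hc : IsCell G₁ G₂ a b) (harc : Arc G₁ G₂ a b ν ν' k)
    (hdone : ∀ a' b', done a' b' → ∀ μ μ' l, Arc G₁ G₂ a' b' μ μ' l → μ ≠ ν') :
    (T.relax FL FH ν ν' k).Inv G₁ G₂ FL FH st done := by
  by_cases hcond : T.lo ν ≤ 1 ∧ max (lbound k (T.lo ν)) (FL ν') ≤ FH ν' ∧
      max (lbound k (T.lo ν)) (FL ν') < T.lo ν'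
  swap
  · rwa [Table.relax, if_neg hcond]
  obtain ⟨h1, h2, h3⟩ := id hcond
  have hne : ν ≠ ν' := by
    rintro rfl
    cases k
    · exact harc.ne_of_false hc rfl rfl
    · exact lt_irrefl _ ((le_max_left _ _).trans_lt h3)
  have hst : ν' ≠ st := by
    rintro rfl
    have := hT.start ((le_max_right _ _).trans h2)
    exact lt_irrefl _ (((le_max_right _ _).trans_lt h3).trans_le this)
  have hlo : (T.relax FL FH ν ν' k).lo ν' = max (lbound k (T.lo ν)) (FL ν') := by
    rw [Table.relax, if_pos hcond]
    exact Function.update_self ..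
  have hpr : (T.relax FL FH ν ν' k).pr ν' = ν := by
    rw [Table.relax, if_pos hcond]
    exact Function.update_self ..
  have hpr' : ∀ μ, μ ≠ ν' → (T.relax FL FH ν ν' k).pr μ = T.pr μ := by
    intro μ hμ
    rw [Table.relax, if_pos hcond]
    exact Function.update_of_ne hμ ..
  refine ⟨fun μ hμ => ?_, fun h => ?_, fun μ hμ => ?_, fun a' b' h μ μ' l hA => ?_⟩
  · by_cases e : μ = ν'
    · subst e
      rw [hlo]
      exact ⟨le_max_right _ _, h2⟩
    · rw [Table.relax_lo_of_ne e] at hμ ⊢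
      exact hT.free μ hμ
  · rw [Table.relax_lo_of_ne hst.symm]
    exact hT.start h
  · by_cases e : μ = ν'
    · subst e
      rw [hpr, Table.relax_lo_of_ne hne, hlo]
      exact ⟨h1, .inr ⟨hst, hne, a, b, k, hc, harc, le_max_left _ _⟩⟩
    · rw [Table.relax_lo_of_ne e] at hμ ⊢
      rw [hpr' μ e]
      obtain ⟨h4, h5⟩ := hT.pred μ hμ
      have h6 : (T.relax FL FH ν ν' k).lo (T.pr μ) ≤ T.lo (T.pr μ) := Table.relax_lo_le _
      refine ⟨h6.trans h4, h5.imp_right ?_⟩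
      rintro ⟨h7, h7', a', b', l, h8, h9, h10⟩
      exact ⟨h7, h7', a', b', l, h8, h9, (lbound_mono l h6).trans h10⟩
  · exact (hT.closed a' b' h μ μ' l hA).relax (hdone a' b' h μ μ' l hA)

/-- Dealing with a cell preserves the invariant, provided that no cell that has been dealt with
lies weakly above it in both coordinates. -/
theorem Table.Inv.relaxCell (hT : T.Inv G₁ G₂ FL FH st done) {a b : ℕ}
    (hc : IsCell G₁ G₂ a b) {ρ₁ ρ₂ : ℕ → ℕ} (h₁ : G₁.IsRank ρ₁) (h₂ : G₂.IsRank ρ₂)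
    (hdone : ∀ a' b', done a' b' → IsCell G₁ G₂ a' b' ∧ ¬ (ρ₁ a ≤ ρ₁ a' ∧ ρ₂ b ≤ ρ₂ b'))
    {done' : ℕ → ℕ → Prop} (hdone' : ∀ a' b', done' a' b' → done a' b' ∨ a' = a ∧ b' = b) :
    (T.relaxCell G₁ G₂ FL FH a b).Inv G₁ G₂ FL FH st done' := by
  have key : ∀ {ν ν' k}, Arc G₁ G₂ a b ν ν' k → ∀ a' b', done a' b' →
      ∀ μ μ' l, Arc G₁ G₂ a' b' μ μ' l → μ ≠ ν' := by
    rintro ν ν' k hA a' b' hd μ μ' l hA' rfl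
    obtain ⟨hc', hn⟩ := hdone a' b' hd
    have e1 := hA.rank_le_tgt hc h₁ h₂
    have e2 := hA'.rank_src_le hc' h₁ h₂
    exact hn ⟨e1.1.trans e2.1, e1.2.trans e2.2⟩
  have h := ((((hT.relax hc .leftRight (key .leftRight)).relax hc .bottomTop
    (key .bottomTop)).relax hc .bottomRight (key .bottomRight)).relax hc .leftTop
    (key .leftTop)).relax hc .bottomRight (key .bottomRight)
  refine ⟨h.free, h.start, h.pred, fun a' b' hd => ?_⟩
  rcases hdone' a' b' hd with hd | ⟨rfl, rfl⟩
  · exact h.closed a' b' hd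
  · exact Table.cellClosed_relaxCell hc h₁ h₂

end Inv

end Frechet

/-! ### Every pair of close curves is found -/

namespace Frechet

/-- `FL ν ≤ x ≤ FH ν` says that the points at parameter `x` on the two locations of `ν` have
distance at most `δ`. -/
def IsFreeSpace {E : Type*} [NormedAddCommGroup E] [NormedSpace ℝ E] (G₁ G₂ : LocGraph)
    (p₁ p₂ : ℕ → E) (δ : ℝ) (FL FH : ℕ × ℕ → ℝ) : Prop :=
  ∀ a b, a < G₁.L → b < G₂.L → ∀ x, (FL (a, b) ≤ x ∧ x ≤ FH (a, b)) ↔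
    (0 ≤ x ∧ x ≤ 1 ∧ dist (G₁.pt p₁ a x) (G₂.pt p₂ b x) ≤ δ)

/-- `w 0, …, w k` are the vertices and `e 0, …, e (k - 1)` the edges of a directed path. -/
structure LocGraph.IsPath (G : LocGraph) (w e : ℕ → ℕ) (k : ℕ) : Prop where
  vertex_lt : ∀ i ≤ k, w i < G.V
  le_edge : ∀ i < k, G.V ≤ e i
  edge_lt : ∀ i < k, e i < G.L
  tl_edge : ∀ i < k, G.tl (e i) = w i
  hd_edge : ∀ i < k, G.hd (e i) = w (i + 1)

section

variable {E : Type*} [NormedAddCommGroup E] [NormedSpace ℝ E] {G : LocGraph} {w e : ℕ → ℕ} {k i : ℕ}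

theorem LocGraph.IsPath.pl_edge (h : G.IsPath w e k) (p : ℕ → E) (hi : i < k) {t : ℝ}
    (h0 : (i : ℝ) ≤ t) (h1 : t ≤ i + 1) : pl (p ∘ w) k t = G.pt p (e i) (t - i) := by
  rw [pl_eq hi h0 h1, LocGraph.pt, h.tl_edge i hi, h.hd_edge i hi]
  rfl

theorem LocGraph.IsPath.pl_vertex (h : G.IsPath w e k) (p : ℕ → E) (hi : i ≤ k) (x : ℝ) :
    pl (p ∘ w) k i = G.pt p (w i) x := by
  rw [pl_natCast hi, LocGraph.pt_vertex (h.vertex_lt i hi)]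
  rfl

end

/-- Before a monotone curve is weakly above `(x, y)`, it crosses one of the rays that bound the
quadrant above `(x, y)`. -/
theorem exists_crossing {X Y : ℝ → ℝ} (hX : Continuous X) (hY : Continuous Y) {x y t : ℝ}
    (ht : 0 ≤ t) (h0 : X 0 ≤ x ∨ Y 0 ≤ y) (hx : x ≤ X t) (hy : y ≤ Y t) :
    ∃ s, 0 ≤ s ∧ s ≤ t ∧ (X s = x ∧ y ≤ Y s ∨ Y s = y ∧ x ≤ X s) := by
  have hc : Continuous fun s => min (X s - x) (Y s - y) := by fun_prop
  have m0 : min (X 0 - x) (Y 0 - y) ≤ 0 := by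
    rcases h0 with h | h
    · exact (min_le_left _ _).trans (by linarith)
    · exact (min_le_right _ _).trans (by linarith)
  have mt : 0 ≤ min (X t - x) (Y t - y) := le_min (by linarith) (by linarith)
  obtain ⟨s, hs, h⟩ := intermediate_value_Icc ht hc.continuousOn ⟨m0, mt⟩
  refine ⟨s, hs.1, hs.2, ?_⟩
  change min (X s - x) (Y s - y) = 0 at h
  rcases min_choice (X s - x) (Y s - y) with e | e
  · have := min_le_right (X s - x) (Y s - y)
    exact .inl ⟨by linarith, by linarith⟩
  · have := min_le_left (X s - x) (Y s - y)
    exact .inr ⟨by linarith, by linarith⟩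

/-- If two paths are traversed monotonically at distance at most `δ`, then a closed table reaches
their pair of end vertices. The induction is along the sides of the cells that the pair of
traversals crosses. -/
theorem lo_le_one_of_traversal {E : Type*} [NormedAddCommGroup E] [NormedSpace ℝ E]
    {G₁ G₂ : LocGraph} {p₁ p₂ : ℕ → E} {δ : ℝ} {FL FH : ℕ × ℕ → ℝ} {lo : ℕ × ℕ → ℝ}
    (hfree : IsFreeSpace G₁ G₂ p₁ p₂ δ FL FH)
    (hclosed : ∀ a b, IsCell G₁ G₂ a b → CellClosed G₁ G₂ FL FH lo a b)
    {w₁ e₁ w₂ e₂ : ℕ → ℕ} {k₁ k₂ : ℕ} (h₁ : G₁.IsPath w₁ e₁ k₁) (h₂ : G₂.IsPath w₂ e₂ k₂)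
    (hstart : FL (w₁ 0, w₂ 0) ≤ FH (w₁ 0, w₂ 0) → lo (w₁ 0, w₂ 0) ≤ FL (w₁ 0, w₂ 0))
    {X Y : ℝ → ℝ} (hX : Continuous X) (hY : Continuous Y) (mX : Monotone X) (mY : Monotone Y)
    (hX0 : X 0 = 0) (hY0 : Y 0 = 0) {T : ℝ} (hT : 0 ≤ T) (hXT : X T = k₁) (hYT : Y T = k₂)
    (hd : ∀ t, 0 ≤ t → dist (pl (p₁ ∘ w₁) k₁ (X t)) (pl (p₂ ∘ w₂) k₂ (Y t)) ≤ δ) :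
    lo (w₁ k₁, w₂ k₂) ≤ 1 := by
  have wL₁ : ∀ i ≤ k₁, w₁ i < G₁.L := fun i hi => (h₁.vertex_lt i hi).trans_le G₁.V_le
  have wL₂ : ∀ i ≤ k₂, w₂ i < G₂.L := fun i hi => (h₂.vertex_lt i hi).trans_le G₂.V_le
  -- The sides through which the pair of traversals passes are free there.
  have freeV : ∀ i j t, 0 ≤ t → i ≤ k₁ → j < k₂ → X t = i → (j : ℝ) ≤ Y t → Y t ≤ j + 1 →
      FL (w₁ i, e₂ j) ≤ Y t - j ∧ Y t - j ≤ FH (w₁ i, e₂ j) := by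
    intro i j t ht hi hj h h0 h1
    refine (hfree _ _ (wL₁ i hi) (h₂.edge_lt j hj) _).2 ⟨by linarith, by linarith, ?_⟩
    have := hd t ht
    rwa [h, h₁.pl_vertex p₁ hi (Y t - j), h₂.pl_edge p₂ hj h0 h1] at this
  have freeH : ∀ i j t, 0 ≤ t → i < k₁ → j ≤ k₂ → Y t = j → (i : ℝ) ≤ X t → X t ≤ i + 1 →
      FL (e₁ i, w₂ j) ≤ X t - i ∧ X t - i ≤ FH (e₁ i, w₂ j) := by
    intro i j t ht hi hj h h0 h1
    refine (hfree _ _ (h₁.edge_lt i hi) (wL₂ j hj) _).2 ⟨by linarith, by linarith, ?_⟩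
    have := hd t ht
    rwa [h, h₂.pl_vertex p₂ hj (X t - i), h₁.pl_edge p₁ hi h0 h1] at this
  have freeC : ∀ i j t, 0 ≤ t → i ≤ k₁ → j ≤ k₂ → X t = i → Y t = j →
      FL (w₁ i, w₂ j) ≤ 0 ∧ 0 ≤ FH (w₁ i, w₂ j) := by
    intro i j t ht hi hj h h'
    refine (hfree _ _ (wL₁ i hi) (wL₂ j hj) _).2 ⟨le_rfl, zero_le_one, ?_⟩
    have := hd t ht
    rwa [h, h', h₁.pl_vertex p₁ hi 0, h₂.pl_vertex p₂ hj 0] at this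
  have key : ∀ n i j, i + j = n →
      (i ≤ k₁ → j ≤ k₂ → ∀ t, 0 ≤ t → X t = i → Y t = j → lo (w₁ i, w₂ j) ≤ 0) ∧
      (i ≤ k₁ → j < k₂ → ∀ t, 0 ≤ t → X t = i → (j : ℝ) ≤ Y t → Y t ≤ j + 1 →
        lo (w₁ i, e₂ j) ≤ Y t - j) ∧
      (i < k₁ → j ≤ k₂ → ∀ t, 0 ≤ t → Y t = j → (i : ℝ) ≤ X t → X t ≤ i + 1 →
        lo (e₁ i, w₂ j) ≤ X t - i) := by
    intro n
    induction n using Nat.strong_induction_on with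
    | _ n ih =>
    intro i j hij
    have hC : i ≤ k₁ → j ≤ k₂ → ∀ t, 0 ≤ t → X t = i → Y t = j → lo (w₁ i, w₂ j) ≤ 0 := by
      intro hi hj t ht hXt hYt
      obtain ⟨f0, f1⟩ := freeC i j t ht hi hj hXt hYt
      rcases Nat.eq_zero_or_pos j with rfl | hj0
      · rcases Nat.eq_zero_or_pos i with rfl | hi0
        · exact (hstart (f0.trans f1)).trans f0
        · obtain ⟨i, rfl⟩ : ∃ i', i = i' + 1 := ⟨i - 1, by omega⟩
          push_cast at hXt
          have h := (ih (i + 0) (by omega) i 0 rfl).2.2 hi hj t ht hYt (by linarith) (by linarith)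
          have hc := hclosed (e₁ i) (w₂ 0) ⟨h₁.edge_lt i hi, wL₂ 0 hj, .inl (h₁.le_edge i hi)⟩
            _ _ _ .bottomRight
          rw [G₂.tl_vertex _ (h₂.vertex_lt 0 hj), h₁.hd_edge i hi] at hc
          exact hc.le_of_free (by linarith) le_rfl f0 f1
      · obtain ⟨j, rfl⟩ : ∃ j', j = j' + 1 := ⟨j - 1, by omega⟩
        push_cast at hYt
        have h := (ih (i + j) (by omega) i j rfl).2.1 hi hj t ht hXt (by linarith) (by linarith)
        have hc := hclosed (w₁ i) (e₂ j) ⟨wL₁ i hi, h₂.edge_lt j hj, .inr (h₂.le_edge j hj)⟩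
          _ _ _ .leftTop
        rw [G₁.tl_vertex _ (h₁.vertex_lt i hi), h₂.hd_edge j hj] at hc
        exact hc.le_of_free (by linarith) le_rfl f0 f1
    refine ⟨hC, ?_, ?_⟩
    · intro hi hj t ht hXt h0 h1
      obtain ⟨f0, f1⟩ := freeV i j t ht hi hj hXt h0 h1
      rcases Nat.eq_zero_or_pos i with rfl | hi0
      · obtain ⟨s, hs, hYs⟩ := intermediate_value_Icc ht hY.continuousOn
          ⟨hY0.trans_le j.cast_nonneg, h0⟩
        have hXs : X s = (0 : ℕ) := by
          have e1 := mX hs.1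
          have e2 := mX hs.2
          push_cast at hXt ⊢
          linarith
        have h := hC hi hj.le s hs.1 hXs hYs
        have hc := hclosed (w₁ 0) (e₂ j) ⟨wL₁ 0 hi, h₂.edge_lt j hj, .inr (h₂.le_edge j hj)⟩
          _ _ _ .bottomRight
        rw [G₁.hd_vertex _ (h₁.vertex_lt 0 hi), h₂.tl_edge j hj] at hc
        exact hc.le_of_free (by linarith) (by simp [lbound, h0]) f0 f1
      · obtain ⟨i, rfl⟩ : ∃ i', i = i' + 1 := ⟨i - 1, by omega⟩
        push_cast at hXt
        obtain ⟨s, hs0, hst, h⟩ := exists_crossing hX hY ht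
          (x := i) (y := j) (.inl (hX0.trans_le i.cast_nonneg)) (by linarith) h0
        have e1 := mX hst
        have e2 := mY hst
        rcases h with ⟨hs, hs'⟩ | ⟨hs, hs'⟩
        · have h := (ih (i + j) (by omega) i j rfl).2.1 (by omega) hj s hs0 hs hs' (by linarith)
          have hc := hclosed (e₁ i) (e₂ j) ⟨h₁.edge_lt i hi, h₂.edge_lt j hj,
            .inr (h₂.le_edge j hj)⟩ _ _ _ .leftRight
          rw [h₁.tl_edge i hi, h₁.hd_edge i hi] at hc
          exact hc.le_of_free (by linarith) (by simp only [lbound]; norm_num; linarith) f0 f1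
        · have h := (ih (i + j) (by omega) i j rfl).2.2 hi hj.le s hs0 hs hs' (by linarith)
          have hc := hclosed (e₁ i) (e₂ j) ⟨h₁.edge_lt i hi, h₂.edge_lt j hj,
            .inr (h₂.le_edge j hj)⟩ _ _ _ .bottomRight
          rw [h₂.tl_edge j hj, h₁.hd_edge i hi] at hc
          exact hc.le_of_free (by linarith) (by simp [lbound, h0]) f0 f1
    · intro hi hj t ht hYt h0 h1
      obtain ⟨f0, f1⟩ := freeH i j t ht hi hj hYt h0 h1
      rcases Nat.eq_zero_or_pos j with rfl | hj0
      · obtain ⟨s, hs, hXs⟩ := intermediate_value_Icc ht hX.continuousOn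
          ⟨hX0.trans_le i.cast_nonneg, h0⟩
        have hYs : Y s = (0 : ℕ) := by
          have e1 := mY hs.1
          have e2 := mY hs.2
          push_cast at hYt ⊢
          linarith
        have h := hC hi.le hj s hs.1 hXs hYs
        have hc := hclosed (e₁ i) (w₂ 0) ⟨h₁.edge_lt i hi, wL₂ 0 hj, .inl (h₁.le_edge i hi)⟩
          _ _ _ .leftTop
        rw [G₂.hd_vertex _ (h₂.vertex_lt 0 hj), h₁.tl_edge i hi] at hc
        exact hc.le_of_free (by linarith) (by simp [lbound, h0]) f0 f1
      · obtain ⟨j, rfl⟩ : ∃ j', j = j' + 1 := ⟨j - 1, by omega⟩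
        push_cast at hYt
        obtain ⟨s, hs0, hst, h⟩ := exists_crossing hX hY ht
          (x := i) (y := j) (.inl (hX0.trans_le i.cast_nonneg)) h0 (by linarith)
        have e1 := mX hst
        have e2 := mY hst
        rcases h with ⟨hs, hs'⟩ | ⟨hs, hs'⟩
        · have h := (ih (i + j) (by omega) i j rfl).2.1 hi.le hj s hs0 hs hs' (by linarith)
          have hc := hclosed (e₁ i) (e₂ j) ⟨h₁.edge_lt i hi, h₂.edge_lt j hj,
            .inr (h₂.le_edge j hj)⟩ _ _ _ .leftTop
          rw [h₁.tl_edge i hi, h₂.hd_edge j hj] at hc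
          exact hc.le_of_free (by linarith) (by simp [lbound, h0]) f0 f1
        · have h := (ih (i + j) (by omega) i j rfl).2.2 hi (by omega) s hs0 hs hs' (by linarith)
          have hc := hclosed (e₁ i) (e₂ j) ⟨h₁.edge_lt i hi, h₂.edge_lt j hj,
            .inr (h₂.le_edge j hj)⟩ _ _ _ .bottomTop
          rw [h₂.tl_edge j hj, h₂.hd_edge j hj] at hc
          exact hc.le_of_free (by linarith) (by simp only [lbound]; norm_num; linarith) f0 f1
  exact ((key _ k₁ k₂ rfl).1 le_rfl le_rfl T hT hXT hYT).trans zero_le_one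

end Frechet

/-! ### Reading off the paths and the reparameterizations -/

namespace Frechet

namespace LocGraph

/-- A monotone move from parameter `x` on the location `a` to parameter `x'` on the location `a'`,
within a single edge. -/
inductive Move (G : LocGraph) : ℕ → ℝ → ℕ → ℝ → Prop
  | stay {a : ℕ} {x x' : ℝ} (h : G.V ≤ a → x ≤ x') : Move G a x a x'
  | enter {a : ℕ} {x x' : ℝ} (hV : G.V ≤ a) (ha : a < G.L) : Move G (G.tl a) x a x'
  | leave {a : ℕ} {x x' : ℝ} (hV : G.V ≤ a) (ha : a < G.L) : Move G a x (G.hd a) x'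
  | cross {a : ℕ} {x x' : ℝ} (hV : G.V ≤ a) (ha : a < G.L) : Move G (G.tl a) x (G.hd a) x'

theorem Move.tail_head (G : LocGraph) {a : ℕ} (ha : a < G.L) (x x' : ℝ) :
    G.Move (G.tl a) x (G.hd a) x' := by
  rcases lt_or_ge a G.V with h | h
  · rw [G.tl_vertex a h, G.hd_vertex a h]
    exact .stay fun h' => absurd h (not_lt.mpr h')
  · exact .cross h ha

theorem Move.tail_self (G : LocGraph) {a : ℕ} (ha : a < G.L) (x x' : ℝ) :
    G.Move (G.tl a) x a x' := by
  rcases lt_or_ge a G.V with h | h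
  · rw [G.tl_vertex a h]
    exact .stay fun h' => absurd h (not_lt.mpr h')
  · exact .enter h ha

theorem Move.self_head (G : LocGraph) {a : ℕ} (ha : a < G.L) (x x' : ℝ) :
    G.Move a x (G.hd a) x' := by
  rcases lt_or_ge a G.V with h | h
  · rw [G.hd_vertex a h]
    exact .stay fun h' => absurd h (not_lt.mpr h')
  · exact .leave h ha

end LocGraph

theorem Arc.move {G₁ G₂ : LocGraph} {a b : ℕ} {ν ν' : ℕ × ℕ} {k : Bool}
    (h : Arc G₁ G₂ a b ν ν' k) (hc : IsCell G₁ G₂ a b) {x x' : ℝ} (hx : lbound k x ≤ x') :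
    G₁.Move ν.1 x ν'.1 x' ∧ G₂.Move ν.2 x ν'.2 x' := by
  have ha := hc.fst_lt
  have hb := hc.snd_lt
  rcases h with _ | _ | _ | _
  · exact ⟨.tail_head G₁ ha x x', .stay fun _ => hx⟩
  · exact ⟨.stay fun _ => hx, .tail_head G₂ hb x x'⟩
  · exact ⟨.self_head G₁ ha x x', .tail_self G₂ hb x x'⟩
  · exact ⟨.tail_self G₁ ha x x', .self_head G₂ hb x x'⟩

/-- The number of vertices, the initial one not counted, that the sequence `a` of locations has
visited up to time `k`; locations below `V` are vertices. -/
def visits (V : ℕ) (a : ℕ → ℕ) : ℕ → ℕ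
  | 0 => 0
  | k + 1 => visits V a k + if a (k + 1) < V ∧ a (k + 1) ≠ a k then 1 else 0

/-- The position at time `k` on the path of all vertices visited. -/
noncomputable def place (V : ℕ) (a : ℕ → ℕ) (x : ℕ → ℝ) (k : ℕ) : ℝ :=
  visits V a k + if a k < V then 0 else x k

/-- The reparameterization of the path of all vertices visited up to time `N`, at its `i`-th
breakpoint. The additional breakpoint `N + 1` serves paths of length zero: for them the division is
by zero, and the other values are `0`. -/
noncomputable def breakpoint (V : ℕ) (a : ℕ → ℕ) (x : ℕ → ℝ) (N i : ℕ) : ℝ :=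
  if i ≤ N then place V a x i / visits V a N else 1

namespace LocGraph

/-- A sequence of monotone moves from a vertex to a vertex. -/
structure IsWalk (G : LocGraph) (a : ℕ → ℕ) (x : ℕ → ℝ) (N : ℕ) : Prop where
  first_lt : a 0 < G.V
  last_lt : a N < G.V
  nonneg : ∀ k ≤ N, 0 ≤ x k
  le_one : ∀ k ≤ N, x k ≤ 1
  move : ∀ k < N, G.Move (a k) (x k) (a (k + 1)) (x (k + 1))

variable {G : LocGraph} {ρ : ℕ → ℕ} {a w : ℕ → ℕ} {x : ℕ → ℝ} {N : ℕ}

theorem visits_mono (V : ℕ) (a : ℕ → ℕ) : Monotone (visits V a) :=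
  monotone_nat_of_le_succ fun _ => Nat.le_add_right _ _

theorem IsWalk.tl_eq (h : G.IsWalk a x N)
    (hw : ∀ k ≤ N, a k < G.V → w (visits G.V a k) = a k) :
    ∀ k ≤ N, G.tl (a k) = w (visits G.V a k) := by
  intro k
  induction k with
  | zero => intro hk; rw [hw 0 hk h.first_lt, G.tl_vertex _ h.first_lt]
  | succ k ih =>
    intro hk
    by_cases hV : a (k + 1) < G.V
    · rw [hw _ hk hV, G.tl_vertex _ hV]
    · have hvis : visits G.V a (k + 1) = visits G.V a k := by simp [visits, hV]
      rw [hvis, ← ih (by omega)]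
      have hm := h.move k hk
      generalize a k = c, x k = y, a (k + 1) = c', x (k + 1) = y' at hm hV
      rcases hm with _ | ⟨h1, h2⟩ | ⟨h1, h2⟩ | ⟨h1, h2⟩
      · rfl
      · rw [G.tl_vertex _ (G.tl_lt _ h2)]
      · exact absurd (G.hd_lt _ h2) hV
      · exact absurd (G.hd_lt _ h2) hV

theorem IsWalk.hd_eq (h : G.IsWalk a x N)
    (hw : ∀ k ≤ N, a k < G.V → w (visits G.V a k) = a k) :
    ∀ k ≤ N, G.V ≤ a k → visits G.V a k < visits G.V a N ∧
      G.hd (a k) = w (visits G.V a k + 1) := by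
  intro k hk
  induction hk using Nat.decreasingInduction with
  | self => intro hV; exact absurd h.last_lt (not_lt.mpr hV)
  | of_succ k hk ih =>
    intro hV
    have hm := h.move k hk
    have hw1 := hw (k + 1) hk
    have hle := visits_mono G.V a (show k + 1 ≤ N from hk)
    have hvis : visits G.V a (k + 1) = visits G.V a k +
      if a (k + 1) < G.V ∧ a (k + 1) ≠ a k then 1 else 0 := rfl
    generalize a k = c, x k = y, a (k + 1) = c', x (k + 1) = y' at hm hV ih hvis hw1
    rcases hm with _ | ⟨h1, h2⟩ | ⟨h1, h2⟩ | ⟨h1, h2⟩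
    · rw [if_neg (by simp), add_zero] at hvis
      rw [← hvis]
      exact ih hV
    · exact absurd (G.tl_lt _ h2) (not_lt.mpr hV)
    · have h3 := G.hd_lt _ h2
      rw [if_pos ⟨h3, G.hd_ne h1 h2⟩] at hvis
      rw [← hvis]
      exact ⟨by omega, (hw1 h3).symm⟩
    · exact absurd (G.tl_lt _ h2) (not_lt.mpr hV)

theorem IsWalk.exists_isPath (h : G.IsWalk a x N) (hρ : G.IsRank ρ)
    (hw : ∀ k ≤ N, a k < G.V → w (visits G.V a k) = a k) :
    ∃ e, G.IsPath w e (visits G.V a N) := by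
  have step : ∀ k ≤ N, ∀ j < visits G.V a k, ∃ c, G.V ≤ c ∧ c < G.L ∧ G.tl c = w j ∧
      G.hd c = w (j + 1) := by
    intro k
    induction k with
    | zero => intro _ j hj; exact absurd hj (Nat.not_lt_zero _)
    | succ k ih =>
      intro hk j hj
      by_cases hjk : j < visits G.V a k
      · exact ih (by omega) j hjk
      have hm := h.move k hk
      have hw1 := hw (k + 1) hk
      have hw0 := h.tl_eq hw k (by omega)
      have hvis : visits G.V a (k + 1) = visits G.V a k +
        if a (k + 1) < G.V ∧ a (k + 1) ≠ a k then 1 else 0 := rfl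
      generalize a k = c, x k = y, a (k + 1) = c', x (k + 1) = y' at hm hvis hw1 hw0
      rcases hm with _ | ⟨h1, h2⟩ | ⟨h1, h2⟩ | ⟨h1, h2⟩
      · rw [if_neg (by simp)] at hvis
        omega
      · rw [if_neg (fun h => absurd h.1 (not_lt.mpr h1))] at hvis
        omega
      · have h3 := G.hd_lt _ h2
        rw [if_pos ⟨h3, G.hd_ne h1 h2⟩] at hvis
        obtain rfl : j = visits G.V a k := by omega
        exact ⟨c, h1, h2, hw0, by rw [← hvis, hw1 h3]⟩
      · rename_i b
        have h3 := G.hd_lt _ h2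
        rw [if_pos ⟨h3, (hρ.tl_ne_hd h1 h2).symm⟩] at hvis
        obtain rfl : j = visits G.V a k := by omega
        rw [G.tl_vertex _ (G.tl_lt _ h2)] at hw0
        exact ⟨b, h1, h2, hw0, by rw [← hvis, hw1 h3]⟩
  have step' : ∀ j, ∃ c, j < visits G.V a N → G.V ≤ c ∧ c < G.L ∧ G.tl c = w j ∧
      G.hd c = w (j + 1) := fun j => by
    by_cases hj : j < visits G.V a N
    · obtain ⟨c, hc⟩ := step N le_rfl j hj
      exact ⟨c, fun _ => hc⟩
    · exact ⟨0, fun h => absurd h hj⟩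
  choose e he using step'
  refine ⟨e, fun i hi => ?_, fun i hi => (he i hi).1, fun i hi => (he i hi).2.1,
    fun i hi => (he i hi).2.2.1, fun i hi => (he i hi).2.2.2⟩
  rcases Nat.lt_or_eq_of_le hi with hi | rfl
  · rw [← (he i hi).2.2.1]
    exact G.tl_lt _ (he i hi).2.1
  · rw [hw N le_rfl h.last_lt]
    exact h.last_lt

variable {E : Type*} [NormedAddCommGroup E] [NormedSpace ℝ E]

theorem place_zero (h : G.IsWalk a x N) : place G.V a x 0 = 0 := by
  simp [place, visits, h.first_lt]

theorem place_last (h : G.IsWalk a x N) : place G.V a x N = visits G.V a N := by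
  simp [place, h.last_lt]

theorem IsWalk.pl_place (h : G.IsWalk a x N)
    (hw : ∀ k ≤ N, a k < G.V → w (visits G.V a k) = a k) (p : ℕ → E) {k : ℕ} (hk : k ≤ N) :
    pl (p ∘ w) (visits G.V a N) (place G.V a x k) = G.pt p (a k) (x k) := by
  by_cases hV : a k < G.V
  · rw [place, if_pos hV, add_zero, pl_natCast (visits_mono _ _ hk), pt_vertex hV,
      Function.comp_apply, hw k hk hV]
  · obtain ⟨h1, h2⟩ := h.hd_eq hw k hk (not_lt.mp hV)
    have h3 := h.nonneg k hk
    have h4 := h.le_one k hk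
    rw [place, if_neg hV, pl_eq h1 (by linarith) (by linarith), add_sub_cancel_left, pt,
      h.tl_eq hw k hk, h2]
    rfl

/-- In each step, the position on the path rests or advances within one segment. -/
theorem IsWalk.place_step (h : G.IsWalk a x N) (hρ : G.IsRank ρ)
    (hw : ∀ k ≤ N, a k < G.V → w (visits G.V a k) = a k) {k : ℕ} (hk : k < N) :
    place G.V a x k = place G.V a x (k + 1) ∨
    (visits G.V a k < visits G.V a N ∧ (visits G.V a k : ℝ) ≤ place G.V a x k ∧
      place G.V a x k ≤ place G.V a x (k + 1) ∧
      place G.V a x (k + 1) ≤ visits G.V a k + 1) := by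
  have hm := h.move k hk
  have n0 := h.nonneg k hk.le
  have n1 := h.nonneg (k + 1) hk
  have l0 := h.le_one k hk.le
  have l1 := h.le_one (k + 1) hk
  have hd0 := h.hd_eq hw k hk.le
  have hd1 := h.hd_eq hw (k + 1) hk
  have hle := visits_mono G.V a (show k + 1 ≤ N from hk)
  have hvis : visits G.V a (k + 1) = visits G.V a k +
    if a (k + 1) < G.V ∧ a (k + 1) ≠ a k then 1 else 0 := rfl
  unfold place
  generalize a k = c, x k = y, a (k + 1) = c', x (k + 1) = y' at *
  rcases hm with hx | ⟨h1, h2⟩ | ⟨h1, h2⟩ | ⟨h1, h2⟩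
  · rw [if_neg (by simp), add_zero] at hvis
    rw [hvis]
    by_cases hV : c < G.V
    · left
      simp [hV]
    · right
      have := hx (not_lt.mp hV)
      refine ⟨(hd0 (not_lt.mp hV)).1, ?_, ?_, ?_⟩ <;> simp only [if_neg hV] <;> linarith
  · rw [if_neg (fun h => absurd h.1 (not_lt.mpr h1)), add_zero] at hvis
    have hV := not_lt.mpr h1
    rw [hvis, if_neg hV, if_pos (G.tl_lt _ h2)]
    exact .inr ⟨hvis ▸ (hd1 h1).1, by linarith, by linarith, by linarith⟩
  · have h3 := G.hd_lt _ h2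
    rw [if_pos ⟨h3, G.hd_ne h1 h2⟩] at hvis
    have hV := not_lt.mpr h1
    rw [hvis, if_neg hV, if_pos h3]
    push_cast
    exact .inr ⟨(hd0 h1).1, by linarith, by linarith, by linarith⟩
  · have h3 := G.hd_lt _ h2
    rw [if_pos ⟨h3, (hρ.tl_ne_hd h1 h2).symm⟩] at hvis
    rw [hvis, if_pos h3, if_pos (G.tl_lt _ h2)]
    push_cast
    exact .inr ⟨by omega, by linarith, by linarith, by linarith⟩

theorem IsWalk.place_le_succ (h : G.IsWalk a x N) (hρ : G.IsRank ρ)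
    (hw : ∀ k ≤ N, a k < G.V → w (visits G.V a k) = a k) {k : ℕ} (hk : k < N) :
    place G.V a x k ≤ place G.V a x (k + 1) := by
  rcases h.place_step hρ hw hk with h | h
  · exact h.le
  · exact h.2.2.1

theorem IsWalk.pl_place_affine (h : G.IsWalk a x N) (hρ : G.IsRank ρ)
    (hw : ∀ k ≤ N, a k < G.V → w (visits G.V a k) = a k) (p : ℕ → E) {k : ℕ} (hk : k < N)
    {r : ℝ} (hr0 : 0 ≤ r) (hr1 : r ≤ 1) :
    pl (p ∘ w) (visits G.V a N)
        (place G.V a x k + r * (place G.V a x (k + 1) - place G.V a x k)) =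
      (1 - r) • pl (p ∘ w) (visits G.V a N) (place G.V a x k) +
        r • pl (p ∘ w) (visits G.V a N) (place G.V a x (k + 1)) := by
  rcases h.place_step hρ hw hk with h | ⟨h1, h2, h3, h4⟩
  · rw [h, sub_self, mul_zero, add_zero]
    module
  · exact pl_affine h1 h2 h3 h4 hr0 hr1

/-- The curve at a breakpoint, by the place to which it corresponds. -/
theorem IsWalk.pl_breakpoint (h : G.IsWalk a x N) (q : ℕ → E) {i : ℕ} (hi : i ≤ N + 1) :
    pl q (visits G.V a N) (visits G.V a N * breakpoint G.V a x N i) =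
      pl q (visits G.V a N) (place G.V a x (min i N)) := by
  rcases Nat.eq_zero_or_pos (visits G.V a N) with h0 | h0
  · simp [h0, pl]
  · have hne : (visits G.V a N : ℝ) ≠ 0 := by positivity
    by_cases hiN : i ≤ N
    · rw [breakpoint, if_pos hiN, min_eq_left hiN, mul_div_cancel₀ _ hne]
    · rw [breakpoint, if_neg hiN, min_eq_right (by omega), place_last h, mul_one]

theorem IsWalk.pl_breakpoint_affine (h : G.IsWalk a x N) (hρ : G.IsRank ρ)
    (hw : ∀ k ≤ N, a k < G.V → w (visits G.V a k) = a k) (p : ℕ → E) {i : ℕ} (hi : i < N + 1)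
    {r : ℝ} (hr0 : 0 ≤ r) (hr1 : r ≤ 1) :
    pl (p ∘ w) (visits G.V a N) (visits G.V a N * (breakpoint G.V a x N i +
        r * (breakpoint G.V a x N (i + 1) - breakpoint G.V a x N i))) =
      (1 - r) • pl (p ∘ w) (visits G.V a N) (visits G.V a N * breakpoint G.V a x N i) +
        r • pl (p ∘ w) (visits G.V a N) (visits G.V a N * breakpoint G.V a x N (i + 1)) := by
  rcases Nat.eq_zero_or_pos (visits G.V a N) with h0 | h0
  · simp only [h0, pl, Finset.range_zero, Finset.sum_empty, add_zero]
    module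
  · have hne : (visits G.V a N : ℝ) ≠ 0 := by positivity
    rcases Nat.lt_or_eq_of_le (Nat.lt_succ_iff.mp hi) with hi | rfl
    · have e1 : ∀ j ≤ N, visits G.V a N * breakpoint G.V a x N j = place G.V a x j := by
        intro j hj
        rw [breakpoint, if_pos hj, mul_div_cancel₀ _ hne]
      rw [mul_add, mul_left_comm, mul_sub, e1 i hi.le, e1 (i + 1) hi]
      exact h.pl_place_affine hρ hw p hi hr0 hr1
    · have e1 : breakpoint G.V a x i i = 1 := by
        rw [breakpoint, if_pos le_rfl, place_last h, div_self hne]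
      have e2 : breakpoint G.V a x i (i + 1) = 1 := by
        rw [breakpoint, if_neg (by omega)]
      rw [e1, e2, sub_self, mul_zero, add_zero]
      module

theorem IsWalk.breakpoint_zero (h : G.IsWalk a x N) : breakpoint G.V a x N 0 = 0 := by
  rw [breakpoint, if_pos (Nat.zero_le _), place_zero h, zero_div]

theorem breakpoint_last (V : ℕ) (a : ℕ → ℕ) (x : ℕ → ℝ) (N : ℕ) :
    breakpoint V a x N (N + 1) = 1 := by
  rw [breakpoint, if_neg (by omega)]

theorem IsWalk.breakpoint_le_succ (h : G.IsWalk a x N) (hρ : G.IsRank ρ)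
    (hw : ∀ k ≤ N, a k < G.V → w (visits G.V a k) = a k) {i : ℕ} (hi : i < N + 1) :
    breakpoint G.V a x N i ≤ breakpoint G.V a x N (i + 1) := by
  unfold breakpoint
  rw [if_pos (by omega)]
  rcases Nat.lt_or_eq_of_le (Nat.lt_succ_iff.mp hi) with hi | rfl
  · rw [if_pos (by omega)]
    exact div_le_div_of_nonneg_right (h.place_le_succ hρ hw hi) (Nat.cast_nonneg _)
  · rw [if_neg (by omega), place_last h]
    exact div_self_le_one _

end LocGraph

/-- Two simultaneous walks whose points have distance at most `δ` at all times give two curves and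
reparameterizations of width at most `δ`. -/
theorem dist_le_of_walks {E : Type*} [NormedAddCommGroup E] [NormedSpace ℝ E]
    {G₁ G₂ : LocGraph} {ρ₁ ρ₂ : ℕ → ℕ} (hρ₁ : G₁.IsRank ρ₁) (hρ₂ : G₂.IsRank ρ₂)
    {a b w₁ w₂ : ℕ → ℕ} {x : ℕ → ℝ} {N : ℕ} (h₁ : G₁.IsWalk a x N) (h₂ : G₂.IsWalk b x N)
    (hw₁ : ∀ k ≤ N, a k < G₁.V → w₁ (visits G₁.V a k) = a k)
    (hw₂ : ∀ k ≤ N, b k < G₂.V → w₂ (visits G₂.V b k) = b k) {p₁ p₂ : ℕ → E} {δ : ℝ}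
    (hd : ∀ k ≤ N, dist (G₁.pt p₁ (a k) (x k)) (G₂.pt p₂ (b k) (x k)) ≤ δ)
    {t : ℝ} (ht0 : 0 ≤ t) (ht1 : t ≤ (N + 1 : ℕ)) :
    dist (pl (p₁ ∘ w₁) (visits G₁.V a N)
        (visits G₁.V a N * pl (breakpoint G₁.V a x N) (N + 1) t))
      (pl (p₂ ∘ w₂) (visits G₂.V b N)
        (visits G₂.V b N * pl (breakpoint G₂.V b x N) (N + 1) t)) ≤ δ := by
  refine dist_pl_le (fun i hi r hr0 hr1 => h₁.pl_breakpoint_affine hρ₁ hw₁ p₁ hi hr0 hr1)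
    (fun i hi r hr0 hr1 => h₂.pl_breakpoint_affine hρ₂ hw₂ p₂ hi hr0 hr1) (fun i hi => ?_)
    ht0 ht1 N.succ_pos
  rw [h₁.pl_breakpoint _ hi, h₂.pl_breakpoint _ hi, h₁.pl_place hw₁ _ (min_le_right _ _),
    h₂.pl_place hw₂ _ (min_le_right _ _)]
  exact hd _ (min_le_right _ _)

/-- Following the predecessors backwards from a reached side `ν`, for `N` steps, leads to the start,
along a pair of walks. -/
theorem Table.Inv.chain {G₁ G₂ : LocGraph} {FL FH : ℕ × ℕ → ℝ} {st : ℕ × ℕ}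
    {done : ℕ → ℕ → Prop} {T : Table} (hT : T.Inv G₁ G₂ FL FH st done) {ρ₁ ρ₂ : ℕ → ℕ}
    (hρ₁ : G₁.IsRank ρ₁) (hρ₂ : G₂.IsRank ρ₂) {ν : ℕ → ℕ × ℕ} {N : ℕ} (h0 : T.lo (ν 0) ≤ 1)
    (hν : ∀ k < N, ν (k + 1) = T.pr (ν k)) (hN : ρ₁ (ν 0).1 + ρ₂ (ν 0).2 ≤ N) :
    (∀ k ≤ N, T.lo (ν k) ≤ 1) ∧ ν N = st ∧
    (∀ k < N, G₁.Move (ν (k + 1)).1 (T.lo (ν (k + 1))) (ν k).1 (T.lo (ν k)) ∧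
      G₂.Move (ν (k + 1)).2 (T.lo (ν (k + 1))) (ν k).2 (T.lo (ν k))) := by
  have hlo : ∀ k ≤ N, T.lo (ν k) ≤ 1 := by
    intro k
    induction k with
    | zero => exact fun _ => h0
    | succ k ih =>
      intro hk
      rw [hν k hk]
      exact (hT.pred _ (ih (by omega))).1
  refine ⟨hlo, ?_, fun k hk => ?_⟩
  · have hst : ∀ k ≤ N, ν k = st ∨ ρ₁ (ν k).1 + ρ₂ (ν k).2 + k ≤ N := by
      intro k
      induction k with
      | zero => exact fun _ => .inr hN
      | succ k ih =>
        intro hk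
        rw [hν k hk]
        rcases (hT.pred _ (hlo k (by omega))).2 with ⟨-, h⟩ | ⟨hs, hne, a, b, l, hc, hA, -⟩
        · exact .inl h
        · have := hA.rank_lt hc hne hρ₁ hρ₂
          rcases ih (by omega) with h | h
          · exact absurd h hs
          · exact .inr (by omega)
    rcases hst N le_rfl with h | h
    · exact h
    · rcases (hT.pred _ (hlo N le_rfl)).2 with ⟨h', -⟩ | ⟨-, hne, a, b, l, hc, hA, -⟩
      · exact h'
      · have := hA.rank_lt hc hne hρ₁ hρ₂
        omega
  · rw [hν k hk]
    rcases (hT.pred _ (hlo k hk.le)).2 with ⟨h, h'⟩ | ⟨-, -, a, b, l, hc, hA, hx⟩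
    · rw [h', h]
      exact ⟨.stay fun _ => le_rfl, .stay fun _ => le_rfl⟩
    · exact hA.move hc hx

end Frechet

/-! ### DAG complexes as graphs of locations -/

namespace Frechet

theorem toArray_of_lt {α : Type*} [Zero α] {m : ℕ} (x : Fin m → α) {i : ℕ} (h : i < m) :
    toArray x i = x ⟨i, h⟩ := dif_pos h

namespace DAGComplex

variable {d : ℕ} (K : DAGComplex d)

/-- The locations of a complex: its vertices, followed by its edges. -/
def locGraph : LocGraph where
  V := K.numVertices
  L := K.numVertices + K.numEdges
  tl c := if c < K.numVertices then c else toArray (fun e => (K.tail e : ℕ)) (c - K.numVertices)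
  hd c := if c < K.numVertices then c else toArray (fun e => (K.head e : ℕ)) (c - K.numVertices)
  V_le := Nat.le_add_right _ _
  tl_vertex _ h := if_pos h
  hd_vertex _ h := if_pos h
  tl_lt c h := by
    split_ifs with hc
    · exact hc
    · rw [toArray_of_lt _ (show c - K.numVertices < K.numEdges by omega)]
      exact Fin.is_lt _
  hd_lt c h := by
    split_ifs with hc
    · exact hc
    · rw [toArray_of_lt _ (show c - K.numVertices < K.numEdges by omega)]
      exact Fin.is_lt _

theorem tl_edge (e : Fin K.numEdges) : K.locGraph.tl (K.numVertices + e) = K.tail e := by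
  simp [locGraph, toArray]

theorem hd_edge (e : Fin K.numEdges) : K.locGraph.hd (K.numVertices + e) = K.head e := by
  simp [locGraph, toArray]

theorem exists_edge {c : ℕ} (hV : K.numVertices ≤ c) (hL : c < K.locGraph.L) :
    ∃ e : Fin K.numEdges, c = K.numVertices + e := by
  have : c < K.numVertices + K.numEdges := hL
  exact ⟨⟨c - K.numVertices, by omega⟩, by simp only; omega⟩

/-- The positions of the vertices, by number. -/
noncomputable def position (v : ℕ) : EuclideanSpace ℝ (Fin d) :=
  if h : v < K.numVertices then K.pos ⟨v, h⟩ else 0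

theorem position_val (v : Fin K.numVertices) : K.position v = K.pos v := dif_pos v.2

/-- A vertex is ranked by the number of its ancestors. -/
theorem exists_rank : ∃ ρ, K.locGraph.IsRank ρ := by
  classical
  set r : Fin K.numVertices → Fin K.numVertices → Prop :=
    fun u w => ∃ e, K.tail e = u ∧ K.head e = w with hr
  set ρ : Fin K.numVertices → ℕ := fun v =>
    (Finset.univ.filter fun u => Relation.TransGen r u v).card with hρ
  have hlt : ∀ u v, r u v → ρ u < ρ v := by
    intro u v h
    refine Finset.card_lt_card (Finset.ssubset_iff_subset_ne.mpr ⟨fun x hx => ?_, fun he => ?_⟩)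
    · rw [Finset.mem_filter] at hx ⊢
      exact ⟨hx.1, hx.2.tail h⟩
    · have hu : u ∈ Finset.univ.filter fun x => Relation.TransGen r x v := by
        simpa using Relation.TransGen.single h
      rw [← he, Finset.mem_filter] at hu
      exact K.acyclic u hu.2
  set ρ' : ℕ → ℕ := fun v => if h : v < K.numVertices then ρ ⟨v, h⟩ else 0 with hρ'
  have hval : ∀ v : Fin K.numVertices, ρ' v = ρ v := fun v => dif_pos v.2
  refine ⟨fun c => if c < K.numVertices then 2 * ρ' c else 2 * ρ' (K.locGraph.tl c) + 1, ?_⟩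
  intro c hV hL
  obtain ⟨e, rfl⟩ := K.exists_edge hV hL
  have h1 := hlt _ _ ⟨e, rfl, rfl⟩
  simp only [tl_edge, hd_edge, hval, Fin.is_lt, if_true, show ¬ K.numVertices + (e : ℕ) <
    K.numVertices by omega, if_false]
  omega

/-- A connected graph has at most one vertex more than it has edges. -/
theorem numVertices_le : K.numVertices ≤ K.numEdges + 1 := by
  rcases Nat.eq_zero_or_pos K.numVertices with h0 | h0
  · omega
  set f : Fin K.numEdges → Sym2 (Fin K.numVertices) := fun e => s(K.tail e, K.head e) with hf
  set G := SimpleGraph.fromEdgeSet (Set.range f) with hG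
  have hreach : ∀ u v, G.Reachable u v := by
    intro u v
    induction K.connected u v with
    | rel u v h =>
      obtain ⟨e, rfl, rfl⟩ := h
      by_cases he : K.tail e = K.head e
      · rw [he]
      · exact SimpleGraph.Adj.reachable ((SimpleGraph.fromEdgeSet_adj _).mpr ⟨⟨e, rfl⟩, he⟩)
    | refl u => exact .refl u
    | symm u v _ ih => exact ih.symm
    | trans u v w _ _ ih ih' => exact ih.trans ih'
  have : Nonempty (Fin K.numVertices) := ⟨⟨0, h0⟩⟩
  have hconn : G.Connected := ⟨hreach⟩
  have h1 := hconn.card_vert_le_card_edgeSet_add_one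
  have h2 : Nat.card G.edgeSet ≤ K.numEdges := by
    have h3 : G.edgeSet ⊆ Set.range f := by
      rw [hG, SimpleGraph.edgeSet_fromEdgeSet]
      exact Set.sdiff_subset
    have h4 := Set.ncard_le_ncard h3 (Set.finite_range f)
    have h5 : (Set.range f).ncard ≤ Nat.card (Fin K.numEdges) := by
      rw [← Set.image_univ, ← Set.ncard_univ]
      exact Set.ncard_image_le Set.finite_univ
    rw [Nat.card_fin] at h5
    exact h4.trans h5
  rw [Nat.card_fin] at h1
  omega

variable {K}

theorem exists_isPath {s t : Fin K.numVertices} (π : DirectedPath K s t) :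
    ∃ w e, K.locGraph.IsPath w e π.length ∧ w 0 = s ∧ w π.length = t ∧
      ∀ x : unitInterval, π.curve x = pl (K.position ∘ w) π.length (π.length * x) := by
  set w : ℕ → ℕ := fun i => if h : i < π.length + 1 then π.vertex ⟨i, h⟩ else 0 with hw
  have hwv : ∀ i : Fin (π.length + 1), w i = π.vertex i := fun i => dif_pos i.2
  have hwlt : ∀ i ≤ π.length, ∃ v : Fin K.numVertices, w i = v := fun i hi =>
    ⟨_, dif_pos (Nat.lt_succ_of_le hi)⟩
  have he : ∀ i, ∃ c, i < π.length → K.locGraph.V ≤ c ∧ c < K.locGraph.L ∧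
      K.locGraph.tl c = w i ∧ K.locGraph.hd c = w (i + 1) := by
    intro i
    by_cases hi : i < π.length
    · obtain ⟨e, h1, h2⟩ := π.step ⟨i, hi⟩
      refine ⟨K.numVertices + e, fun _ => ⟨Nat.le_add_right _ _,
        Nat.add_lt_add_left e.2 _, ?_, ?_⟩⟩
      · rw [tl_edge, h1]
        exact (hwv (Fin.castSucc ⟨i, hi⟩)).symm
      · rw [hd_edge, h2]
        exact (hwv (Fin.succ ⟨i, hi⟩)).symm
    · exact ⟨0, fun h => absurd h hi⟩
  choose e he using he
  refine ⟨w, e, ⟨fun i hi => ?_, fun i hi => (he i hi).1, fun i hi => (he i hi).2.1,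
    fun i hi => (he i hi).2.2.1, fun i hi => (he i hi).2.2.2⟩, ?_, ?_, fun x => ?_⟩
  · obtain ⟨v, hv⟩ := hwlt i hi
    rw [hv]
    exact v.2
  · exact (hwv 0).trans (congrArg Fin.val π.first)
  · exact (hwv (Fin.last _)).trans (congrArg Fin.val π.last)
  · rw [← polyline_apply, DirectedPath.curve]
    simp only [Function.comp_apply, hwv, position_val]

theorem exists_directedPath {w e : ℕ → ℕ} {k : ℕ} (h : K.locGraph.IsPath w e k)
    {s t : Fin K.numVertices} (hs : w 0 = s) (ht : w k = t) :
    ∃ π : DirectedPath K s t, π.length = k ∧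
      (∀ i : Fin (π.length + 1), w i = π.vertex i) ∧
      ∀ x : unitInterval, π.curve x = pl (K.position ∘ w) k (k * x) := by
  refine ⟨⟨k, fun i => ⟨w i, h.vertex_lt i (Nat.lt_succ_iff.mp i.2)⟩, Fin.ext hs, Fin.ext ht,
    fun i => ?_⟩, rfl, fun i => rfl, fun x => ?_⟩
  · obtain ⟨c, hc⟩ := K.exists_edge (h.le_edge i i.2) (h.edge_lt i i.2)
    refine ⟨c, Fin.ext ?_, Fin.ext ?_⟩
    · rw [← tl_edge, ← hc]
      exact h.tl_edge i i.2
    · rw [← hd_edge, ← hc]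
      exact h.hd_edge i i.2
  · rw [← polyline_apply, DirectedPath.curve]
    congr 2
    funext i
    exact (K.position_val ⟨w i, h.vertex_lt i (Nat.lt_succ_iff.mp i.2)⟩).symm

end DAGComplex

theorem lo_le_one_of_frechetDist_le {d : ℕ} {K₁ K₂ : DAGComplex d} {s₁ t₁ : Fin K₁.numVertices}
    {s₂ t₂ : Fin K₂.numVertices} {δ : ℝ} {FL FH lo : ℕ × ℕ → ℝ}
    (hfree : IsFreeSpace K₁.locGraph K₂.locGraph K₁.position K₂.position δ FL FH)
    (hclosed : ∀ a b, IsCell K₁.locGraph K₂.locGraph a b →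
      CellClosed K₁.locGraph K₂.locGraph FL FH lo a b)
    (hstart : FL (s₁, s₂) ≤ FH (s₁, s₂) → lo (s₁, s₂) ≤ FL (s₁, s₂))
    (π₁ : DirectedPath K₁ s₁ t₁) (π₂ : DirectedPath K₂ s₂ t₂)
    (h : frechetDist π₁.curve π₂.curve ≤ δ) : lo (t₁, t₂) ≤ 1 := by
  obtain ⟨F, G, mF, mG, hadd, hd⟩ := exists_monotone_of_frechetDist_le h
  have cF := continuous_of_add_eq mF mG hadd
  have cG := continuous_of_add_eq mG mF fun t => by rw [add_comm]; exact hadd t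
  obtain ⟨w₁, e₁, p₁, f₁, l₁, c₁⟩ := DAGComplex.exists_isPath π₁
  obtain ⟨w₂, e₂, p₂, f₂, l₂, c₂⟩ := DAGComplex.exists_isPath π₂
  have h0 := hadd 0
  have h1 := hadd 1
  simp only [Set.Icc.coe_zero, Set.Icc.coe_one] at h0 h1
  have F0 := (F 0).2.1
  have G0 := (G 0).2.1
  have F1 := (F 1).2.2
  have G1 := (G 1).2.2
  have := lo_le_one_of_traversal hfree hclosed p₁ p₂ (by rwa [f₁, f₂])
    (X := fun t => π₁.length * (F (Set.projIcc 0 1 zero_le_one t) : ℝ))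
    (Y := fun t => π₂.length * (G (Set.projIcc 0 1 zero_le_one t) : ℝ))
    (by fun_prop) (by fun_prop)
    (fun s t hst => mul_le_mul_of_nonneg_left
      (mF (Set.monotone_projIcc _ hst)) (Nat.cast_nonneg _))
    (fun s t hst => mul_le_mul_of_nonneg_left
      (mG (Set.monotone_projIcc _ hst)) (Nat.cast_nonneg _))
    (by
      rw [Set.projIcc_left]
      exact mul_eq_zero_of_right _ (by change (F 0 : ℝ) = 0; linarith))
    (by
      rw [Set.projIcc_left]
      exact mul_eq_zero_of_right _ (by change (G 0 : ℝ) = 0; linarith))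
    zero_le_one
    (by
      rw [Set.projIcc_right]
      rw [show ((F ⟨1, _⟩ : unitInterval) : ℝ) = 1 by change (F 1 : ℝ) = 1; linarith, mul_one])
    (by
      rw [Set.projIcc_right]
      rw [show ((G ⟨1, _⟩ : unitInterval) : ℝ) = 1 by change (G 1 : ℝ) = 1; linarith, mul_one])
    (fun t ht => by
      rw [← c₁, ← c₂]
      exact hd _)
  rwa [l₁, l₂] at this

end Frechet

/-! ### The program -/

namespace Frechet

open RealRAM

/-
The memory of the program. The side `s` is `0` or `1`. Natural-number arrays:
* `s + 6`: the vertices of the path (output);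
* `8`, `9`: the counters of the outer and of the inner loop, in cell `0`;
* `s + 10`, `s + 12`: tails and heads of the locations;
* `s + 14`: the locations in topological order, the number of which is in cell `0` of `s + 20`;
* `s + 16`: flags of the locations that have been listed in this order;
* `s + 18`: marks of the locations that are blocked;
* `22`: the beginnings of the rows of the tables;
* `23`, `24`: the table of predecessors;
* `s + 26`: the chain of predecessors, from the end to the start;
* `s + 28`: the length of the path, in cell `0`.
Real arrays:
* `2 * d + 1 + s`: the positions on the path, then the values of the reparameterization (output);
* `2 * d + 3`, `2 * d + 4`: lower and upper bounds of the free intervals;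
* `2 * d + 5`: the least reachable parameters.
-/

section Program

/-- Cell `k` of the natural-number array `a`. -/
def cell (a k : ℕ) : NatExp := .get a (.const k)

/-- The number of vertices of the complex on side `s`, which is `0` for the first complex and `1`
for the second. -/
def numV (s : ℕ) : NatExp := cell 0 (4 * s)

/-- The number of locations of the complex on side `s`. -/
def numL (s : ℕ) : NatExp := .add (numV s) (cell 0 (4 * s + 1))

/-- One location: a vertex is its own tail and head, and those of an edge are read from the input.
-/
def initStep (s : ℕ) : Code :=
  .branch (.natLe (.add (cell 8 0) (.const 1)) (numV s))
    (.seq (.setNat (s + 10) (cell 8 0) (cell 8 0)) (.setNat (s + 12) (cell 8 0) (cell 8 0)))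
    (.seq
      (.setNat (s + 10) (cell 8 0) (.get (1 + 2 * s) (.sub (cell 8 0) (numV s))))
      (.setNat (s + 12) (cell 8 0) (.get (2 + 2 * s) (.sub (cell 8 0) (numV s)))))

/-- Compute the tails and the heads of all locations on side `s`. -/
def initLocs (s : ℕ) : Code := .times 8 (numL s) (initStep s)

/-- If the location `c` in cell `0` of array `9` is an edge, then it blocks its head unless `c` has
been listed, and is blocked unless its tail has been listed. A mark is the number of the round plus
one, so that the marks of earlier rounds need not be deleted. -/
def markStep (s : ℕ) : Code :=
  .branch (.natLe (numV s) (cell 9 0))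
    (.seq
      (.branch (.natLe (.get (s + 16) (cell 9 0)) (.const 0))
        (.setNat (s + 18) (.get (s + 12) (cell 9 0)) (.add (cell 8 0) (.const 1))) .skip)
      (.branch (.natLe (.get (s + 16) (.get (s + 10) (cell 9 0))) (.const 0))
        (.setNat (s + 18) (cell 9 0) (.add (cell 8 0) (.const 1))) .skip))
    .skip

/-- Mark the locations that are blocked in the current round. -/
def markBlocked (s : ℕ) : Code := .times 9 (numL s) (markStep s)

/-- List a location that has not been listed before and is not blocked in the current round. -/
def listStep (s : ℕ) : Code :=
  .branch (.and (.natLe (.get (s + 16) (cell 9 0)) (.const 0))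
      (.natLe (.get (s + 18) (cell 9 0)) (cell 8 0)))
    (.seq (.setNat (s + 14) (cell (s + 20) 0) (cell 9 0))
      (.seq (.setNat (s + 20) (.const 0) (.add (cell (s + 20) 0) (.const 1)))
        (.setNat (s + 16) (cell 9 0) (.const 1))))
    .skip

/-- List all locations that are not blocked in the current round. -/
def listUnblocked (s : ℕ) : Code := .times 9 (numL s) (listStep s)

/-- Topological sorting of the locations on side `s`. In each round, a location is blocked if one of
its predecessors has not been listed before the round; the others are listed. -/
def sortLocs (s : ℕ) : Code := .times 8 (numL s) (.seq (markBlocked s) (listUnblocked s))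

/-- The rows of the tables are stored one after the other. As the machine has no multiplication of
natural numbers, the beginnings of the rows are computed by repeated addition. -/
def offsetStep : Code :=
  .setNat 22 (.add (cell 8 0) (.const 1)) (.add (.get 22 (cell 8 0)) (numL 1))

/-- Compute the beginnings of all rows of the tables. -/
def offsets : Code := .times 8 (numL 0) offsetStep

/-- The index of a pair of locations in the tables. -/
def pairIndex (ν : NatExp × NatExp) : NatExp := .add (.get 22 ν.1) ν.2

/-- The sum of the first `n` expressions. -/
def sumExp (f : ℕ → RealExp) : ℕ → RealExp
  | 0 => .const 0
  | n + 1 => .add (sumExp f n) (f n)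

/-- Coordinate `j` of the vector between the tails of the current two locations. -/
def offsetExp (d j : ℕ) : RealExp :=
  .sub (.get (d + j) (.get 11 (cell 9 0))) (.get j (.get 10 (cell 8 0)))

/-- Coordinate `j` of the difference of the direction vectors of the current two locations. -/
def directionExp (d j : ℕ) : RealExp :=
  .sub (.sub (.get (d + j) (.get 13 (cell 9 0))) (.get (d + j) (.get 11 (cell 9 0))))
    (.sub (.get j (.get 12 (cell 8 0))) (.get j (.get 10 (cell 8 0))))

/-- The squared distance minus `δ²` of the points at parameter `x` on the current two locations is
`A x² + 2 B x + C`, where `A`, `B` and `C` are given by `quadA`, `quadB` and `quadC`. -/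
def quadA (d : ℕ) : RealExp := sumExp (fun j => .mul (directionExp d j) (directionExp d j)) d

/-- Half of the linear coefficient; see `quadA`. -/
def quadB (d : ℕ) : RealExp := sumExp (fun j => .mul (offsetExp d j) (directionExp d j)) d

/-- The constant coefficient; see `quadA`. -/
def quadC (d : ℕ) : RealExp :=
  .sub (sumExp (fun j => .mul (offsetExp d j) (offsetExp d j)) d)
    (.mul (.get (2 * d) (.const 0)) (.get (2 * d) (.const 0)))

/-- A quarter of the discriminant of the polynomial described at `quadA`. -/
def discExp (d : ℕ) : RealExp := .sub (.mul (quadB d) (quadB d)) (.mul (quadA d) (quadC d))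

/-- The machine has no absolute value; `|x - y|` is the square root of `(x - y)²`. -/
def maxExp (x y : RealExp) : RealExp :=
  .div (.add (.add x y) (.sqrt (.mul (.sub x y) (.sub x y)))) (.const 2)

/-- The minimum, computed in the same way as the maximum. -/
def minExp (x y : RealExp) : RealExp :=
  .div (.sub (.add x y) (.sqrt (.mul (.sub x y) (.sub x y)))) (.const 2)

/-- Store the free interval of the current pair of locations. -/
def setInterval (d : ℕ) (x y : RealExp) : Code :=
  .seq (.setReal (2 * d + 3) (pairIndex (cell 8 0, cell 9 0)) x)
    (.setReal (2 * d + 4) (pairIndex (cell 8 0, cell 9 0)) y)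

/-- Compute the set of all parameters in `[0,1]` at which the points on the current two locations
have distance at most `δ`: the set where a convex quadratic polynomial, possibly a constant, is
nonpositive. If it is empty, then the stored lower bound exceeds the stored upper bound. The table
entry `2` says that the side has not been reached. -/
def freeInterval (d : ℕ) : Code :=
  .seq
    (.branch (.realLe (quadA d) (.const 0))
      (.branch (.realLe (quadC d) (.const 0))
        (setInterval d (.const 0) (.const 1)) (setInterval d (.const 1) (.const 0)))
      (.branch (.realLe (.const 0) (discExp d))
        (setInterval d
          (maxExp (.const 0)
            (.div (.sub (.sub (.const 0) (quadB d)) (.sqrt (discExp d))) (quadA d)))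
          (minExp (.const 1)
            (.div (.add (.sub (.const 0) (quadB d)) (.sqrt (discExp d))) (quadA d))))
        (setInterval d (.const 1) (.const 0))))
    (.setReal (2 * d + 5) (pairIndex (cell 8 0, cell 9 0)) (.const 2))

/-- Compute the free intervals of all pairs of locations. Those of pairs of edges are never used;
those of pairs of vertices say whether the two vertices are close. -/
def freeSpace (d : ℕ) : Code := .times 8 (numL 0) (.times 9 (numL 1) (freeInterval d))

/-- The least parameter on the side `ν'` that is free and at least `lb`, if there is one. -/
def relaxCand (d : ℕ) (ν' : NatExp × NatExp) (lb : RealExp) : RealExp :=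
  maxExp lb (.get (2 * d + 3) (pairIndex ν'))

/-- Improve the table entry of `ν'`, given that the free parameters on `ν'` that are at least `lb`
are reachable if `ν` is. -/
def relaxCode (d : ℕ) (ν ν' : NatExp × NatExp) (lb : RealExp) : Code :=
  .branch (.and (.and (.realLe (.get (2 * d + 5) (pairIndex ν)) (.const 1))
      (.realLe (relaxCand d ν' lb) (.get (2 * d + 4) (pairIndex ν'))))
      (.not (.realLe (.get (2 * d + 5) (pairIndex ν')) (relaxCand d ν' lb))))
    (.seq (.setReal (2 * d + 5) (pairIndex ν') (relaxCand d ν' lb))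
      (.seq (.setNat 23 (pairIndex ν') ν.1) (.setNat 24 (pairIndex ν') ν.2)))
    .skip

/-- The code for `Table.relax`. -/
def relaxArc (d : ℕ) (ν ν' : NatExp × NatExp) (k : Bool) : Code :=
  relaxCode d ν ν' (if k then .get (2 * d + 5) (pairIndex ν) else .const 0)

/-- The location on the first side of the current cell. -/
def curA : NatExp := .get 14 (cell 8 0)

/-- The location on the second side of the current cell. -/
def curB : NatExp := .get 15 (cell 9 0)

/-- The code for `Table.relaxCell`. -/
def relaxCellCode (d : ℕ) : Code :=
  .seq (relaxArc d (.get 10 curA, curB) (.get 12 curA, curB) true)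
  (.seq (relaxArc d (curA, .get 11 curB) (curA, .get 13 curB) true)
  (.seq (relaxArc d (curA, .get 11 curB) (.get 12 curA, curB) false)
  (.seq (relaxArc d (.get 10 curA, curB) (curA, .get 13 curB) false)
  (relaxArc d (curA, .get 11 curB) (.get 12 curA, curB) false))))

/-- The pair of start vertices. -/
def startPair : NatExp × NatExp := (cell 0 2, cell 0 6)

/-- Enter the start, which is its own predecessor, into the table if it is free. -/
def initStart (d : ℕ) : Code :=
  .seq
    (.branch (.realLe (.get (2 * d + 3) (pairIndex startPair))
        (.get (2 * d + 4) (pairIndex startPair)))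
      (.setReal (2 * d + 5) (pairIndex startPair) (.get (2 * d + 3) (pairIndex startPair))) .skip)
    (.seq (.setNat 23 (pairIndex startPair) (cell 0 2))
      (.setNat 24 (pairIndex startPair) (cell 0 6)))

/-- Pairs of vertices are skipped. -/
def fillStep (d : ℕ) : Code :=
  .branch (.natLe (.const 1)
      (.add (.sub (.add curA (.const 1)) (numV 0)) (.sub (.add curB (.const 1)) (numV 1))))
    (relaxCellCode d) .skip

/-- Deal with all cells, in the lexicographic order of the sorted locations. -/
def fillTable (d : ℕ) : Code := .times 8 (numL 0) (.times 9 (numL 1) (fillStep d))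

/-- A bound for the number of predecessor steps to the start. -/
def numSteps : NatExp := .add (numL 0) (numL 1)

/-- The current member of the chain of predecessors. -/
def tracePair : NatExp × NatExp := (.get 26 (cell 8 0), .get 27 (cell 8 0))

/-- Append the next predecessor to the chain. -/
def traceStep : Code :=
  .seq (.setNat 26 (.add (cell 8 0) (.const 1)) (.get 23 (pairIndex tracePair)))
    (.setNat 27 (.add (cell 8 0) (.const 1)) (.get 24 (pairIndex tracePair)))

/-- Store the chain of predecessors that begins at the pair of end vertices. It is constant once it
has arrived at the start. -/
def traceBack : Code :=
  .seq (.setNat 26 (.const 0) (cell 0 3))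
  (.seq (.setNat 27 (.const 0) (cell 0 7))
  (.times 8 numSteps traceStep))

/-- The index of the next location in the chain, which is stored in reverse. -/
def nextIndex : NatExp := .sub numSteps (.add (cell 8 0) (.const 1))

/-- The next location on side `s` when the chain is read from the start to the end. -/
def nextLoc (s : ℕ) : NatExp := .get (s + 26) nextIndex

/-- The present location on side `s` when the chain is read from the start to the end. -/
def curLoc (s : ℕ) : NatExp := .get (s + 26) (.sub numSteps (cell 8 0))

/-- The next location is a vertex. -/
def isVertexTest (s : ℕ) : Test := .natLe (.add (nextLoc s) (.const 1)) (numV s)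

/-- If the next location is a vertex other than the present location, then append it to the path.
Store the position on the path, in which every edge has length one. -/
def walkStep (d s : ℕ) : Code :=
  .seq
    (.branch (.and (isVertexTest s)
        (.not (.and (.natLe (nextLoc s) (curLoc s)) (.natLe (curLoc s) (nextLoc s)))))
      (.seq (.setNat (s + 28) (.const 0) (.add (cell (s + 28) 0) (.const 1)))
        (.setNat (s + 6) (cell (s + 28) 0) (nextLoc s)))
      .skip)
    (.branch (isVertexTest s)
      (.setReal (2 * d + 1 + s) (.add (cell 8 0) (.const 1)) (.cast (cell (s + 28) 0)))
      (.setReal (2 * d + 1 + s) (.add (cell 8 0) (.const 1))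
        (.add (.cast (cell (s + 28) 0))
          (.get (2 * d + 5) (pairIndex (nextLoc 0, nextLoc 1))))))

/-- Compute the path on side `s` and the positions on it. -/
def walkCode (d s : ℕ) : Code := .times 8 numSteps (walkStep d s)

/-- Divide a position by the length of the path. -/
def normalizeStep (d s : ℕ) : Code :=
  .setReal (2 * d + 1 + s) (cell 8 0)
    (.div (.get (2 * d + 1 + s) (cell 8 0)) (.cast (cell (s + 28) 0)))

/-- Turn the positions on the path into values of the reparameterization. -/
def normalizeCode (d s : ℕ) : Code := .times 8 (.add numSteps (.const 1)) (normalizeStep d s)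

/-- Output the path and the reparameterization for the side `s`. -/
def outputSide (d s : ℕ) : Code :=
  .seq (.setNat (s + 6) (.const 0) (cell 0 (4 * s + 2)))
  (.seq (walkCode d s)
  (.seq (normalizeCode d s)
  (.seq (.setReal (2 * d + 1 + s) (.add numSteps (.const 1)) (.const 1))
  (.setNat 5 (.const (1 + s)) (cell (s + 28) 0)))))

/-- Output the paths, the reparameterizations and the positive answer. -/
def output (d : ℕ) : Code :=
  .seq traceBack
  (.seq (outputSide d 0)
  (.seq (outputSide d 1)
  (.seq (.setNat 5 (.const 3) (.add numSteps (.const 1)))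
  (.setNat 5 (.const 0) (.const 1)))))

/-- Set up the locations, their topological orders and the free space. -/
def prepare (d : ℕ) : Code :=
  .seq (initLocs 0) (.seq (initLocs 1) (.seq (sortLocs 0) (.seq (sortLocs 1)
  (.seq offsets (freeSpace d)))))

/-- Decide whether there are paths at Fréchet distance at most `δ`, and if so, find such paths. -/
def mainCode (d : ℕ) : Code :=
  .seq (prepare d) (.seq (initStart d) (.seq (fillTable d)
  (.branch (.realLe (.get (2 * d + 5) (pairIndex (cell 0 3, cell 0 7))) (.const 1))
    (output d) .skip)))

end Program

theorem mainCode_depth (d : ℕ) : (mainCode d).depth = 2 := by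
  cases d <;> rfl

theorem mainCode_wellFormed (d : ℕ) : (mainCode d).WellFormed := by
  simp [mainCode, initStep, markStep, listStep, offsetStep, fillStep, traceStep, walkStep,
    normalizeStep, prepare, initLocs, sortLocs, markBlocked, listUnblocked, offsets, freeSpace,
    freeInterval, setInterval, initStart, fillTable, relaxCellCode, relaxArc, relaxCode, output,
    traceBack, outputSide, walkCode, normalizeCode, Code.WellFormed, Code.NatFree, NatExp.Below,
    numL, numV, numSteps, cell]

theorem mainCode_loopsLe (d : ℕ) {x : ℕ → ℕ} {M : ℕ} (h : x 0 + x 1 + (x 4 + x 5) + 1 ≤ M) :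
    (mainCode d).LoopsLe M x := by
  have h0 : ∀ σ : State, σ.nat 0 = x → (numL 0).eval σ ≤ M := by
    rintro σ rfl
    change σ.nat 0 0 + σ.nat 0 1 ≤ M
    omega
  have h1 : ∀ σ : State, σ.nat 0 = x → (numL 1).eval σ ≤ M := by
    rintro σ rfl
    change σ.nat 0 4 + σ.nat 0 5 ≤ M
    omega
  have h3 : ∀ σ : State, σ.nat 0 = x → (NatExp.add numSteps (.const 1)).eval σ ≤ M := by
    rintro σ rfl
    exact h
  have h2 : ∀ σ : State, σ.nat 0 = x → numSteps.eval σ ≤ M := fun σ hσ =>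
    (Nat.le_succ _).trans (h3 σ hσ)
  simp only [mainCode, initStep, markStep, listStep, offsetStep, fillStep, traceStep, walkStep,
    normalizeStep, prepare, initLocs, sortLocs, markBlocked, listUnblocked, offsets, freeSpace,
    freeInterval, setInterval, initStart, fillTable, relaxCellCode, relaxArc, relaxCode, output,
    traceBack, outputSide, walkCode, normalizeCode, Code.LoopsLe, and_true, true_and]
  exact ⟨⟨h0, h1, ⟨h0, h0, h0⟩, ⟨h1, h1, h1⟩, h0, h0, h1⟩, ⟨h0, h1⟩, h2, ⟨h2, h3⟩, h2, h3⟩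

end Frechet

/-! ### Topological sorting -/

namespace Frechet

open RealRAM

/-- The memory holds the numbers of vertices and edges of `G` on side `s`. -/
structure HasSize (σ : State) (s : ℕ) (G : LocGraph) : Prop where
  vertices : σ.nat 0 (4 * s) = G.V
  edges : σ.nat 0 (4 * s + 1) = G.L - G.V

/-- The memory holds the tails and heads of the locations of `G` on side `s`. -/
structure HasLocs (σ : State) (s : ℕ) (G : LocGraph) : Prop where
  tl : ∀ c < G.L, σ.nat (s + 10) c = G.tl c
  hd : ∀ c < G.L, σ.nat (s + 12) c = G.hd c

theorem HasSize.eval_numV {σ : State} {s : ℕ} {G : LocGraph} (h : HasSize σ s G) :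
    (numV s).eval σ = G.V := h.vertices

theorem HasSize.eval_numL {σ : State} {s : ℕ} {G : LocGraph} (h : HasSize σ s G) :
    (numL s).eval σ = G.L := by
  have := G.V_le
  have h1 := h.vertices
  have h2 := h.edges
  simp only [numL, numV, cell, NatExp.eval]
  omega

theorem HasSize.congr {σ τ : State} {s : ℕ} {G : LocGraph} (h : HasSize σ s G)
    (h0 : τ.nat 0 = σ.nat 0) : HasSize τ s G :=
  ⟨by rw [h0]; exact h.vertices, by rw [h0]; exact h.edges⟩

theorem HasLocs.congr {σ τ : State} {s : ℕ} {G : LocGraph} (h : HasLocs σ s G)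
    (h0 : τ.nat (s + 10) = σ.nat (s + 10)) (h1 : τ.nat (s + 12) = σ.nat (s + 12)) :
    HasLocs τ s G :=
  ⟨by rw [h0]; exact h.tl, by rw [h1]; exact h.hd⟩

theorem hasLocs_initLocs {d : ℕ} {K : DAGComplex d} {σ : State} {s : ℕ} (hs : s ≤ 1)
    (h : HasSize σ s K.locGraph) (htl : σ.nat (1 + 2 * s) = toArray fun e => (K.tail e : ℕ))
    (hhd : σ.nat (2 + 2 * s) = toArray fun e => (K.head e : ℕ)) :
    HasLocs ((initLocs s).den σ) s K.locGraph := by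
  suffices key : ∀ c < K.locGraph.L, ((initLocs s).den σ).nat (s + 10) c = K.locGraph.tl c ∧
      ((initLocs s).den σ).nat (s + 12) c = K.locGraph.hd c from
    ⟨fun c hc => (key c hc).1, fun c hc => (key c hc).2⟩
  refine Code.den_times h.eval_numL
    (fun k τ => ∀ c < k, τ.nat (s + 10) c = K.locGraph.tl c ∧ τ.nat (s + 12) c = K.locGraph.hd c)
    (fun c hc => absurd hc (Nat.not_lt_zero c)) (fun k τ hk hv hN _ hI c hc => ?_)
  have h0 : τ.nat 0 = σ.nat 0 := hN 0 (by simp) (by simp [initStep, Code.NatFree])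
  have f1 : 1 + 2 * s ≠ s + 10 := by omega
  have f2 : 2 + 2 * s ≠ s + 10 := by omega
  have f3 : 1 + 2 * s ≠ s + 12 := by omega
  have f4 : 2 + 2 * s ≠ s + 12 := by omega
  have f5 : 1 + 2 * s ≠ 8 := by omega
  have f6 : 2 + 2 * s ≠ 8 := by omega
  have e1 : τ.nat (1 + 2 * s) = σ.nat (1 + 2 * s) := hN _ f5 (by simp [initStep, Code.NatFree, *])
  have e2 : τ.nat (2 + 2 * s) = σ.nat (2 + 2 * s) := hN _ f6 (by simp [initStep, Code.NatFree, *])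
  have hV : τ.nat 0 (4 * s) = K.locGraph.V := (h.congr h0).vertices
  simp only [initStep, Code.den, Test.Holds, NatExp.eval, cell, hv, numV, hV]
  rcases Nat.lt_succ_iff_lt_or_eq.mp hc with hc | rfl
  · have := hI c hc
    split_ifs <;> simp [State.setNat_nat, *, hc.ne]
  · split_ifs with hlt
    · have hlt' : c < K.numVertices := hlt
      simp [State.setNat_nat, *, DAGComplex.locGraph]
    · have hlt' : ¬ c < K.numVertices := hlt
      simp [State.setNat_nat, *, DAGComplex.locGraph]

namespace LocGraph

/-- `c'` has to precede `c` in a topological order of the locations. -/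
def Prec (G : LocGraph) (c' c : ℕ) : Prop :=
  c' < G.L ∧ c < G.L ∧ (G.V ≤ c ∧ c' = G.tl c ∨ G.V ≤ c' ∧ c = G.hd c')

theorem IsRank.lt_of_prec {G : LocGraph} {ρ : ℕ → ℕ} (hρ : G.IsRank ρ) {c c' : ℕ}
    (h : G.Prec c' c) : ρ c' < ρ c := by
  obtain ⟨h1, h2, ⟨h3, rfl⟩ | ⟨h3, rfl⟩⟩ := h
  · exact (hρ c h3 h2).1
  · exact (hρ c' h3 h1).2

/-- `ord` lists the locations in topological order, and `pos` is the inverse of `ord`. -/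
structure IsOrder (G : LocGraph) (ord pos : ℕ → ℕ) : Prop where
  ord_lt : ∀ i < G.L, ord i < G.L
  pos_ord : ∀ i < G.L, pos (ord i) = i
  pos_lt : ∀ c < G.L, pos c < G.L
  ord_pos : ∀ c < G.L, ord (pos c) = c
  rank : G.IsRank pos

/-- The first `n` locations of a topological order, all of whose predecessors precede them. -/
structure IsPartialOrder (G : LocGraph) (ord : ℕ → ℕ) (n : ℕ) : Prop where
  lt : ∀ i < n, ord i < G.L
  inj : ∀ i < n, ∀ j < n, ord i = ord j → i = j
  prec : ∀ i < n, ∀ c, G.Prec c (ord i) → ∃ j < i, ord j = c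

variable {G : LocGraph} {ord : ℕ → ℕ} {n : ℕ}

theorem IsPartialOrder.image (h : G.IsPartialOrder ord n) :
    (Finset.range n).image ord ⊆ Finset.range G.L ∧ ((Finset.range n).image ord).card = n := by
  refine ⟨fun c hc => ?_, ?_⟩
  · obtain ⟨i, hi, rfl⟩ := Finset.mem_image.mp hc
    exact Finset.mem_range.mpr (h.lt i (Finset.mem_range.mp hi))
  · rw [Finset.card_image_of_injOn, Finset.card_range]
    intro i hi j hj
    exact h.inj i (by simpa using hi) j (by simpa using hj)

theorem IsPartialOrder.le (h : G.IsPartialOrder ord n) : n ≤ G.L := by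
  have := Finset.card_le_card h.image.1
  rwa [h.image.2, Finset.card_range] at this

theorem IsPartialOrder.snoc (h : G.IsPartialOrder ord n) {c : ℕ} (hc : c < G.L)
    (hnew : ∀ i < n, ord i ≠ c) (hprec : ∀ c', G.Prec c' c → ∃ j < n, ord j = c') :
    G.IsPartialOrder (Function.update ord n c) (n + 1) := by
  have e : ∀ i < n, Function.update ord n c i = ord i := fun i hi => by simp [hi.ne]
  refine ⟨fun i hi => ?_, fun i hi j hj hij => ?_, fun i hi c' hc' => ?_⟩
  · rcases Nat.lt_succ_iff_lt_or_eq.mp hi with hi | rfl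
    · rw [e i hi]; exact h.lt i hi
    · simpa using hc
  · rcases Nat.lt_succ_iff_lt_or_eq.mp hi with hi | rfl <;>
      rcases Nat.lt_succ_iff_lt_or_eq.mp hj with hj | rfl
    · rw [e i hi, e j hj] at hij
      exact h.inj i hi j hj hij
    · rw [e i hi, Function.update_self] at hij
      exact absurd hij (hnew i hi)
    · rw [e j hj, Function.update_self] at hij
      exact absurd hij.symm (hnew j hj)
    · rfl
  · rcases Nat.lt_succ_iff_lt_or_eq.mp hi with hi | rfl
    · rw [e i hi] at hc'
      obtain ⟨j, hj, hjc⟩ := h.prec i hi c' hc'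
      exact ⟨j, hj, by rw [e j (hj.trans hi), hjc]⟩
    · rw [Function.update_self] at hc'
      obtain ⟨j, hj, hjc⟩ := hprec c' hc'
      exact ⟨j, hj, by rw [e j hj, hjc]⟩

/-- As long as some location is not listed, one of them is not blocked. -/
theorem IsPartialOrder.exists_unblocked (h : G.IsPartialOrder ord n) (hn : n < G.L) {ρ : ℕ → ℕ}
    (hρ : G.IsRank ρ) : ∃ c < G.L, (∀ i < n, ord i ≠ c) ∧
      ∀ c', G.Prec c' c → ∃ j < n, ord j = c' := by
  have hne : ((Finset.range G.L) \ (Finset.range n).image ord).Nonempty := by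
    rw [← Finset.card_pos, Finset.card_sdiff_of_subset h.image.1, h.image.2, Finset.card_range]
    omega
  obtain ⟨c, hc, hmin⟩ := Finset.exists_min_image _ ρ hne
  simp only [Finset.mem_sdiff, Finset.mem_range, Finset.mem_image, not_exists, not_and] at hc hmin
  refine ⟨c, hc.1, fun i hi => hc.2 i hi, fun c' hc' => ?_⟩
  by_contra! hcon
  exact absurd (hmin c' ⟨hc'.1, hcon⟩) (not_le.mpr (hρ.lt_of_prec hc'))

theorem IsPartialOrder.exists_isOrder (h : G.IsPartialOrder ord G.L) :
    ∃ pos, G.IsOrder ord pos := by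
  have himg : (Finset.range G.L).image ord = Finset.range G.L :=
    Finset.eq_of_subset_of_card_le h.image.1 (by rw [h.image.2, Finset.card_range])
  have hex : ∀ c, ∃ i, c < G.L → i < G.L ∧ ord i = c := by
    intro c
    by_cases hc : c < G.L
    · have : c ∈ (Finset.range G.L).image ord := by rw [himg]; exact Finset.mem_range.mpr hc
      obtain ⟨i, hi, hic⟩ := Finset.mem_image.mp this
      exact ⟨i, fun _ => ⟨Finset.mem_range.mp hi, hic⟩⟩
    · exact ⟨0, fun h => absurd h hc⟩
  choose pos hpos using hex
  have hprec : ∀ c c', G.Prec c' c → pos c' < pos c := by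
    intro c c' hc
    obtain ⟨h1, h2⟩ := hpos c hc.2.1
    obtain ⟨h3, h4⟩ := hpos c' hc.1
    obtain ⟨j, hj, hjc⟩ := h.prec (pos c) h1 c' (by rwa [h2])
    rwa [← h.inj j (hj.trans h1) (pos c') h3 (by rw [hjc, h4])]
  refine ⟨pos, h.lt, fun i hi => ?_, fun c hc => (hpos c hc).1, fun c hc => (hpos c hc).2,
    fun c hV hL => ⟨hprec _ _ ?_, hprec _ _ ?_⟩⟩
  · obtain ⟨h1, h2⟩ := hpos (ord i) (h.lt i hi)
    exact h.inj _ h1 _ hi h2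
  · exact ⟨(G.tl_lt c hL).trans_le G.V_le, hL, .inl ⟨hV, rfl⟩⟩
  · exact ⟨hL, (G.hd_lt c hL).trans_le G.V_le, .inr ⟨hV, rfl⟩⟩

end LocGraph

/-- The state of the sorting procedure on side `s`: the listed locations form a partial order, and
are those that are flagged. -/
structure Sorting (σ : State) (s : ℕ) (G : LocGraph) : Prop where
  order : G.IsPartialOrder (σ.nat (s + 14)) (σ.nat (s + 20) 0)
  flag_eq : ∀ c < G.L, σ.nat (s + 16) c = 0 ↔ ∀ i < σ.nat (s + 20) 0, σ.nat (s + 14) i ≠ c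

theorem markBlocked_spec {σ : State} {s : ℕ} {G : LocGraph} (hG : HasSize σ s G)
    (hL : HasLocs σ s G) (hm : ∀ c, σ.nat (s + 18) c ≤ σ.nat 8 0) :
    (∀ c, ((markBlocked s).den σ).nat (s + 18) c ≤ σ.nat 8 0 + 1) ∧
    ∀ c < G.L, σ.nat 8 0 < ((markBlocked s).den σ).nat (s + 18) c ↔
      ∃ c', G.Prec c' c ∧ σ.nat (s + 16) c' = 0 := by
  set r := σ.nat 8 0 with hr
  suffices key : (∀ c, ((markBlocked s).den σ).nat (s + 18) c ≤ r + 1) ∧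
      ∀ c, r < ((markBlocked s).den σ).nat (s + 18) c ↔ ∃ e < G.L, G.V ≤ e ∧
        (c = G.hd e ∧ σ.nat (s + 16) e = 0 ∨ c = e ∧ σ.nat (s + 16) (G.tl e) = 0) by
    refine ⟨key.1, fun c hc => (key.2 c).trans ⟨?_, ?_⟩⟩
    · rintro ⟨e, he, hV, ⟨rfl, h⟩ | ⟨rfl, h⟩⟩
      · exact ⟨e, ⟨he, hc, .inr ⟨hV, rfl⟩⟩, h⟩
      · exact ⟨G.tl c, ⟨(G.tl_lt c hc).trans_le G.V_le, hc, .inl ⟨hV, rfl⟩⟩, h⟩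
    · rintro ⟨c', ⟨h1, h2, ⟨h3, rfl⟩ | ⟨h3, rfl⟩⟩, h⟩
      · exact ⟨c, hc, h3, .inr ⟨rfl, h⟩⟩
      · exact ⟨c', h1, h3, .inl ⟨rfl, h⟩⟩
  refine Code.den_times hG.eval_numL
    (fun k τ => (∀ c, τ.nat (s + 18) c ≤ r + 1) ∧
      ∀ c, r < τ.nat (s + 18) c ↔ ∃ e < k, G.V ≤ e ∧
        (c = G.hd e ∧ σ.nat (s + 16) e = 0 ∨ c = e ∧ σ.nat (s + 16) (G.tl e) = 0))
    ?_ (fun k τ hk hv hN _ hI => ?_)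
  · have h1 : ∀ c, (σ.setNat 9 0 0).nat (s + 18) c ≤ r := fun c => by
      simpa [State.setNat_nat] using hm c
    exact ⟨fun c => (h1 c).trans (Nat.le_succ _), fun c => by simp [h1]⟩
  · have h0 : τ.nat 0 = σ.nat 0 := hN 0 (by simp) (by simp [markStep, Code.NatFree])
    have h8 : τ.nat 8 = σ.nat 8 := hN 8 (by simp) (by simp [markStep, Code.NatFree])
    have h10 : τ.nat (s + 10) = σ.nat (s + 10) := hN _ (by simp) (by simp [markStep, Code.NatFree])
    have h12 : τ.nat (s + 12) = σ.nat (s + 12) := hN _ (by simp) (by simp [markStep, Code.NatFree])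
    have h16 : τ.nat (s + 16) = σ.nat (s + 16) := hN _ (by simp) (by simp [markStep, Code.NatFree])
    have hV : τ.nat 0 (4 * s) = G.V := (hG.congr h0).vertices
    have ht := hL.tl k hk
    have hh := hL.hd k hk
    have hex : ∀ c, (∃ e < k + 1, G.V ≤ e ∧
        (c = G.hd e ∧ σ.nat (s + 16) e = 0 ∨ c = e ∧ σ.nat (s + 16) (G.tl e) = 0)) ↔
        r < τ.nat (s + 18) c ∨ G.V ≤ k ∧
        (c = G.hd k ∧ σ.nat (s + 16) k = 0 ∨ c = k ∧ σ.nat (s + 16) (G.tl k) = 0) := by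
      intro c
      rw [hI.2 c]
      simp only [Nat.lt_succ_iff_lt_or_eq, or_and_right, exists_or, exists_eq_left]
    simp only [hex]
    have hbody : ∀ c, (((markStep s).den τ).setNat 9 0 (k + 1)).nat (s + 18) c =
        if G.V ≤ k ∧ (c = G.hd k ∧ σ.nat (s + 16) k = 0 ∨ c = k ∧ σ.nat (s + 16) (G.tl k) = 0)
        then r + 1 else τ.nat (s + 18) c := by
      intro c
      have h8' : τ.nat 8 0 = r := by rw [h8]
      simp only [markStep, Code.den, Test.Holds, NatExp.eval, cell, hv, numV, hV]
      by_cases c1 : G.V ≤ k <;> by_cases c2 : σ.nat (s + 16) k = 0 <;>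
        by_cases c3 : σ.nat (s + 16) (G.tl k) = 0 <;>
        simp [State.setNat_nat, c1, c2, c3, h16, h10, h12, ht, hh, h8', hv, Function.update_apply]
      split_ifs <;> simp_all
    refine ⟨fun c => ?_, fun c => ?_⟩
    · rw [hbody c]
      split_ifs
      · exact le_rfl
      · exact hI.1 c
    · rw [hbody c]
      split_ifs with h
      · simp [h]
      · simp [h]

theorem listUnblocked_spec {σ : State} {s : ℕ} {G : LocGraph} (hG : HasSize σ s G)
    (hS : Sorting σ s G)
    (hm : ∀ c < G.L, σ.nat 8 0 < σ.nat (s + 18) c ↔ ∃ c', G.Prec c' c ∧ σ.nat (s + 16) c' = 0)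
    {ρ : ℕ → ℕ} (hρ : G.IsRank ρ) :
    Sorting ((listUnblocked s).den σ) s G ∧
      (σ.nat (s + 20) 0 < G.L →
        σ.nat (s + 20) 0 < ((listUnblocked s).den σ).nat (s + 20) 0) ∧
      σ.nat (s + 20) 0 ≤ ((listUnblocked s).den σ).nat (s + 20) 0 := by
  set n := σ.nat (s + 20) 0 with hn
  suffices key : Sorting ((listUnblocked s).den σ) s G ∧
      n ≤ ((listUnblocked s).den σ).nat (s + 20) 0 ∧
      (∀ i < n, ((listUnblocked s).den σ).nat (s + 14) i = σ.nat (s + 14) i) ∧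
      ∀ c < G.L, (∀ i < n, σ.nat (s + 14) i ≠ c) → σ.nat (s + 18) c ≤ σ.nat 8 0 →
        n < ((listUnblocked s).den σ).nat (s + 20) 0 by
    refine ⟨key.1, fun hlt => ?_, key.2.1⟩
    obtain ⟨c, hc, h1, h2⟩ := hS.order.exists_unblocked hlt hρ
    refine key.2.2.2 c hc h1 (not_lt.mp fun h => ?_)
    obtain ⟨c', h3, h4⟩ := (hm c hc).mp h
    obtain ⟨j, hj, hjc⟩ := h2 c' h3
    exact (hS.flag_eq c' h3.1).mp h4 j hj hjc
  refine Code.den_times hG.eval_numL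
    (fun k τ => Sorting τ s G ∧ n ≤ τ.nat (s + 20) 0 ∧
      (∀ i < n, τ.nat (s + 14) i = σ.nat (s + 14) i) ∧
      ∀ c < k, (∀ i < n, σ.nat (s + 14) i ≠ c) → σ.nat (s + 18) c ≤ σ.nat 8 0 →
        n < τ.nat (s + 20) 0)
    ?_ (fun k τ hk hv hN _ hI => ?_)
  · refine ⟨⟨?_, ?_⟩, ?_, ?_, fun c hc => absurd hc (Nat.not_lt_zero c)⟩
    · simpa [State.setNat_nat] using hS.order
    · simpa [State.setNat_nat] using hS.flag_eq
    · simp [State.setNat_nat, hn]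
    · simp [State.setNat_nat]
  · have h8 : τ.nat 8 = σ.nat 8 := hN 8 (by simp) (by simp [listStep, Code.NatFree])
    have h18 : τ.nat (s + 18) = σ.nat (s + 18) := hN _ (by simp) (by simp [listStep, Code.NatFree])
    obtain ⟨hS', hle, hpre, hprog⟩ := hI
    set m := τ.nat (s + 20) 0 with hmdef
    by_cases hcond : τ.nat (s + 16) k = 0 ∧ τ.nat (s + 18) k ≤ τ.nat 8 0
    · have e14 : ((listStep s).den τ).nat (s + 14) =
          Function.update (τ.nat (s + 14)) m k := by
        simp [listStep, Code.den, Test.Holds, NatExp.eval, cell, hv, hcond,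
          State.setNat_nat, hmdef]
      have e16 : ((listStep s).den τ).nat (s + 16) =
          Function.update (τ.nat (s + 16)) k 1 := by
        simp [listStep, Code.den, Test.Holds, NatExp.eval, cell, hv, hcond,
          State.setNat_nat]
      have e20 : ((listStep s).den τ).nat (s + 20) 0 = m + 1 := by
        simp [listStep, Code.den, Test.Holds, NatExp.eval, cell, hv, hcond,
          State.setNat_nat, hmdef]
      change Sorting (((listStep s).den τ).setNat 9 0 (k + 1)) s G ∧
        n ≤ (((listStep s).den τ).setNat 9 0 (k + 1)).nat (s + 20) 0 ∧
        (∀ i < n, (((listStep s).den τ).setNat 9 0 (k + 1)).nat (s + 14) i = _) ∧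
        ∀ c < k + 1, _ → _ →
          n < (((listStep s).den τ).setNat 9 0 (k + 1)).nat (s + 20) 0
      have f14 : (((listStep s).den τ).setNat 9 0 (k + 1)).nat (s + 14) =
          Function.update (τ.nat (s + 14)) m k := by simp [State.setNat_nat, e14]
      have f16 : (((listStep s).den τ).setNat 9 0 (k + 1)).nat (s + 16) =
          Function.update (τ.nat (s + 16)) k 1 := by simp [State.setNat_nat, e16]
      have f20 : (((listStep s).den τ).setNat 9 0 (k + 1)).nat (s + 20) 0 =
          m + 1 := by simp [State.setNat_nat, e20]
      have hnew := (hS'.flag_eq k hk).mp hcond.1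
      refine ⟨⟨?_, fun c hc => ?_⟩, ?_, fun i hi => ?_, fun c hc _ _ => ?_⟩
      · rw [f14, f20]
        refine hS'.order.snoc hk hnew fun c' hc' => ?_
        have hc'' : σ.nat (s + 16) c' ≠ 0 := fun h0 =>
          absurd ((hm k hk).mpr ⟨c', hc', h0⟩) (not_lt.mpr (by rw [← h18, ← h8]; exact hcond.2))
        rw [ne_eq, hS.flag_eq c' hc'.1] at hc''
        push Not at hc''
        obtain ⟨i, hi, hic⟩ := hc''
        exact ⟨i, lt_of_lt_of_le hi hle, by rw [hpre i hi, hic]⟩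
      · rw [f14, f16, f20]
        by_cases hck : c = k
        · subst hck
          simp only [Function.update_self, one_ne_zero, false_iff, not_forall]
          exact ⟨m, Nat.lt_succ_self m, by simp⟩
        · rw [Function.update_of_ne hck, hS'.flag_eq c hc]
          refine ⟨fun h i hi => ?_, fun h i hi => ?_⟩
          · rcases Nat.lt_succ_iff_lt_or_eq.mp hi with hi | rfl
            · rw [Function.update_of_ne hi.ne]
              exact h i hi
            · rw [Function.update_self]
              exact Ne.symm hck
          · have := h i (hi.trans (Nat.lt_succ_self _))
            rwa [Function.update_of_ne hi.ne] at this
      · rw [f20]; omega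
      · rw [f14, Function.update_of_ne (by omega)]
        exact hpre i hi
      · rw [f20]; omega
    · have e : (listStep s).den τ = τ := by
        simp [listStep, Code.den, Test.Holds, NatExp.eval, cell, hv]
        exact fun h1 h2 => absurd ⟨h1, h2⟩ hcond
      have e' : ∀ a, a ≠ 9 → (((listStep s).den τ).setNat 9 0 (k + 1)).nat a =
          τ.nat a := fun a ha => by rw [e, State.setNat_nat, if_neg ha]
      change Sorting (((listStep s).den τ).setNat 9 0 (k + 1)) s G ∧
        n ≤ (((listStep s).den τ).setNat 9 0 (k + 1)).nat (s + 20) 0 ∧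
        (∀ i < n, (((listStep s).den τ).setNat 9 0 (k + 1)).nat (s + 14) i = _) ∧
        ∀ c < k + 1, _ → _ →
          n < (((listStep s).den τ).setNat 9 0 (k + 1)).nat (s + 20) 0
      rw [e' (s + 20) (by simp), e' (s + 14) (by simp)]
      refine ⟨⟨?_, ?_⟩, hle, hpre, fun c hc h1 h2 => ?_⟩
      · rw [e' (s + 20) (by simp), e' (s + 14) (by simp)]
        exact hS'.order
      · rw [e' (s + 20) (by simp), e' (s + 14) (by simp), e' (s + 16) (by simp)]
        exact hS'.flag_eq
      · rcases Nat.lt_succ_iff_lt_or_eq.mp hc with hc | rfl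
        · exact hprog c hc h1 h2
        · -- An unblocked location that is not listed now has been listed in this round.
          have h3 : τ.nat (s + 16) c ≠ 0 := fun h => hcond ⟨h, by rwa [h18, h8]⟩
          rw [ne_eq, hS'.flag_eq c hk] at h3
          push Not at h3
          obtain ⟨i, hi, hic⟩ := h3
          by_contra hnlt
          have hin : i < n := lt_of_lt_of_le hi (not_lt.mp hnlt)
          exact h1 i hin (by rw [← hpre i hin, hic])

theorem sortLocs_spec {σ : State} {s : ℕ} {G : LocGraph} (hG : HasSize σ s G)
    (hL : HasLocs σ s G) {ρ : ℕ → ℕ} (hρ : G.IsRank ρ) (h16 : ∀ c, σ.nat (s + 16) c = 0)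
    (h18 : ∀ c, σ.nat (s + 18) c = 0) (h20 : σ.nat (s + 20) 0 = 0) :
    ∃ pos, G.IsOrder (((sortLocs s).den σ).nat (s + 14)) pos := by
  suffices key : Sorting ((sortLocs s).den σ) s G ∧ (∀ c, ((sortLocs s).den σ).nat (s + 18) c ≤ G.L)
      ∧ G.L ≤ ((sortLocs s).den σ).nat (s + 20) 0 by
    have h := key.1.order
    rw [h.le.antisymm key.2.2] at h
    exact h.exists_isOrder
  refine Code.den_times hG.eval_numL
    (fun r τ => Sorting τ s G ∧ (∀ c, τ.nat (s + 18) c ≤ r) ∧ r ≤ τ.nat (s + 20) 0)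
    ?_ (fun r τ hr hv hN _ hI => ?_)
  · refine ⟨⟨⟨?_, ?_, ?_⟩, ?_⟩, ?_, ?_⟩ <;> simp [State.setNat_nat, h16, h18, h20]
  · have h0 : τ.nat 0 = σ.nat 0 :=
      hN 0 (by simp) (by simp [Code.NatFree, markBlocked, listUnblocked, markStep, listStep])
    have h10 : τ.nat (s + 10) = σ.nat (s + 10) :=
      hN _ (by simp) (by simp [Code.NatFree, markBlocked, listUnblocked, markStep, listStep])
    have h12 : τ.nat (s + 12) = σ.nat (s + 12) :=
      hN _ (by simp) (by simp [Code.NatFree, markBlocked, listUnblocked, markStep, listStep])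
    obtain ⟨hS, hM, hC⟩ := hI
    obtain ⟨m1, m2⟩ := markBlocked_spec (hG.congr h0) (hL.congr h10 h12) (by rwa [hv])
    set υ := (markBlocked s).den τ with hυ
    have g : ∀ a, a ≠ 9 → a ≠ s + 18 → υ.nat a = τ.nat a := fun a h1 h2 =>
      Code.den_nat (by simp [markBlocked, markStep, Code.NatFree, h1, h2]) τ
    have hS' : Sorting υ s G := by
      refine ⟨?_, ?_⟩
      · rw [g (s + 14) (by simp) (by simp), g (s + 20) (by simp) (by simp)]
        exact hS.order
      · rw [g (s + 14) (by simp) (by simp), g (s + 20) (by simp) (by simp),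
          g (s + 16) (by simp) (by simp)]
        exact hS.flag_eq
    obtain ⟨l1, l2, l3⟩ := listUnblocked_spec (hG.congr ((g 0 (by simp) (by simp)).trans h0)) hS'
      (by rwa [g 8 (by simp) (by simp), g (s + 16) (by simp) (by simp)]) hρ
    rw [g (s + 20) (by simp) (by simp)] at l2 l3
    have k18 : ((listUnblocked s).den υ).nat (s + 18) = υ.nat (s + 18) :=
      Code.den_nat (by simp [listUnblocked, listStep, Code.NatFree]) υ
    rw [hv] at m1
    have e : ∀ a, a ≠ 8 → (((Code.seq (markBlocked s) (listUnblocked s)).den τ).setNat 8 0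
        (r + 1)).nat a = ((listUnblocked s).den υ).nat a := fun a ha => by
      rw [State.setNat_nat, if_neg ha]
      rfl
    refine ⟨⟨?_, ?_⟩, ?_, ?_⟩
    · rw [e (s + 20) (by simp), e (s + 14) (by simp)]
      exact l1.order
    · rw [e (s + 20) (by simp), e (s + 14) (by simp), e (s + 16) (by simp)]
      exact l1.flag_eq
    · rw [e (s + 18) (by simp), k18]
      exact m1
    · rw [e (s + 20) (by simp)]
      by_cases hlt : τ.nat (s + 20) 0 < G.L
      · have := l2 hlt
        omega
      · omega

end Frechet

/-! ### Computing the free space -/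

namespace Frechet

open RealRAM

/-- The memory holds the beginnings of the rows of the tables. -/
def HasOffsets (σ : State) (G₁ G₂ : LocGraph) : Prop := ∀ a < G₁.L, σ.nat 22 a = a * G₂.L

theorem hasOffsets_offsets {σ : State} {G₁ G₂ : LocGraph} (h₁ : HasSize σ 0 G₁)
    (h₂ : HasSize σ 1 G₂) (h22 : σ.nat 22 0 = 0) : HasOffsets (offsets.den σ) G₁ G₂ := by
  suffices key : ∀ a ≤ G₁.L, (offsets.den σ).nat 22 a = a * G₂.L from fun a ha => key a ha.le
  refine Code.den_times h₁.eval_numL (fun k τ => ∀ a ≤ k, τ.nat 22 a = a * G₂.L) ?_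
    (fun k τ hk hv hN _ hI a ha => ?_)
  · intro a ha
    obtain rfl := Nat.le_zero.mp ha
    simpa [State.setNat_nat] using h22
  · have h0 : τ.nat 0 = σ.nat 0 := hN 0 (by simp) (by simp [offsetStep, Code.NatFree])
    have hL := (h₂.congr h0).eval_numL
    have e : ((offsetStep.den τ).setNat 8 0 (k + 1)).nat 22 =
        Function.update (τ.nat 22) (k + 1) (τ.nat 22 k + G₂.L) := by
      simp [offsetStep, Code.den, NatExp.eval, cell, hv, State.setNat_nat, hL]
    rw [e]
    rcases Nat.lt_or_eq_of_le ha with ha | rfl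
    · rw [Function.update_of_ne ha.ne]
      exact hI a (Nat.lt_succ_iff.mp ha)
    · rw [Function.update_self, hI k le_rfl]
      ring

theorem pairIndex_inj {L a b a' b' : ℕ} (hb : b < L) (hb' : b' < L)
    (h : a * L + b = a' * L + b') : a = a' ∧ b = b' := by
  have hL : 0 < L := by omega
  have h1 := congrArg (· / L) h
  simp only [mul_comm _ L, Nat.mul_add_div hL,
    Nat.div_eq_of_lt hb, Nat.div_eq_of_lt hb', add_zero] at h1
  subst h1
  exact ⟨rfl, by omega⟩

theorem quadratic_le_zero_iff {A B C x : ℝ} (hA : 0 < A) :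
    C + 2 * x * B + x ^ 2 * A ≤ 0 ↔ 0 ≤ B * B - A * C ∧
      (0 - B - √(B * B - A * C)) / A ≤ x ∧ x ≤ (0 - B + √(B * B - A * C)) / A := by
  have e : A * (C + 2 * x * B + x ^ 2 * A) = (A * x + B) ^ 2 - (B * B - A * C) := by ring
  rw [div_le_iff₀ hA, le_div_iff₀ hA]
  have h1 : C + 2 * x * B + x ^ 2 * A ≤ 0 ↔ (A * x + B) ^ 2 ≤ B * B - A * C := by
    rw [← sub_nonpos (a := (A * x + B) ^ 2), ← e]
    constructor
    · exact fun h => mul_nonpos_of_nonneg_of_nonpos hA.le h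
    · exact fun h => nonpos_of_mul_nonpos_right h hA
  rw [h1]
  constructor
  · intro h
    have h2 := abs_le.mp (Real.abs_le_sqrt h)
    exact ⟨(sq_nonneg _).trans h, by linarith [h2.1], by linarith [h2.2]⟩
  · rintro ⟨h2, h3, h4⟩
    rw [← Real.sq_sqrt h2]
    exact sq_le_sq' (by linarith) (by linarith)

theorem maxExp_eval (σ : State) (x y : RealExp) :
    (maxExp x y).eval σ = max (x.eval σ) (y.eval σ) := by
  simp only [maxExp, RealExp.eval, Real.sqrt_mul_self_eq_abs, Nat.cast_ofNat]
  rcases le_total (x.eval σ) (y.eval σ) with h | h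
  · rw [max_eq_right h, abs_of_nonpos (by linarith)]
    ring
  · rw [max_eq_left h, abs_of_nonneg (by linarith)]
    ring

theorem minExp_eval (σ : State) (x y : RealExp) :
    (minExp x y).eval σ = min (x.eval σ) (y.eval σ) := by
  simp only [minExp, RealExp.eval, Real.sqrt_mul_self_eq_abs, Nat.cast_ofNat]
  rcases le_total (x.eval σ) (y.eval σ) with h | h
  · rw [min_eq_left h, abs_of_nonpos (by linarith)]
    ring
  · rw [min_eq_right h, abs_of_nonneg (by linarith)]
    ring

theorem sumExp_eval (σ : State) (f : ℕ → RealExp) (n : ℕ) :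
    (sumExp f n).eval σ = ∑ j : Fin n, (f j).eval σ := by
  induction n with
  | zero => simp [sumExp, RealExp.eval]
  | succ n ih => rw [sumExp, RealExp.eval, ih, Fin.sum_univ_castSucc]; rfl

/-- The memory holds the positions of the vertices and the distance `δ`. -/
structure HasPositions {d : ℕ} (σ : State) (G₁ G₂ : LocGraph)
    (p₁ p₂ : ℕ → EuclideanSpace ℝ (Fin d)) (δ : ℝ) : Prop where
  fst : ∀ v < G₁.V, ∀ j : Fin d, σ.real j v = p₁ v j
  snd : ∀ v < G₂.V, ∀ j : Fin d, σ.real (d + j) v = p₂ v j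
  dist : σ.real (2 * d) 0 = δ

theorem HasPositions.congr {d : ℕ} {σ τ : State} {G₁ G₂ : LocGraph}
    {p₁ p₂ : ℕ → EuclideanSpace ℝ (Fin d)} {δ : ℝ} (h : HasPositions σ G₁ G₂ p₁ p₂ δ)
    (hr : ∀ a ≤ 2 * d, τ.real a = σ.real a) : HasPositions τ G₁ G₂ p₁ p₂ δ := by
  refine ⟨fun v hv j => ?_, fun v hv j => ?_, ?_⟩
  · rw [hr _ (by omega)]; exact h.fst v hv j
  · rw [hr _ (by omega)]; exact h.snd v hv j
  · rw [hr _ le_rfl]; exact h.dist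

section FreeInterval

variable {d : ℕ} {σ : State} {G₁ G₂ : LocGraph} {p₁ p₂ : ℕ → EuclideanSpace ℝ (Fin d)} {δ : ℝ}
  {a b : ℕ}

theorem dist_pt_le_iff (hδ : 0 ≤ δ) (hpos : HasPositions σ G₁ G₂ p₁ p₂ δ) (h₁ : HasLocs σ 0 G₁)
    (h₂ : HasLocs σ 1 G₂) (ha : a < G₁.L) (hb : b < G₂.L) (ha' : σ.nat 8 0 = a)
    (hb' : σ.nat 9 0 = b) (x : ℝ) : dist (G₁.pt p₁ a x) (G₂.pt p₂ b x) ≤ δ ↔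
      (quadC d).eval σ + 2 * x * (quadB d).eval σ + x ^ 2 * (quadA d).eval σ ≤ 0 := by
  have t1 := h₁.tl a ha
  have t2 := h₁.hd a ha
  have t3 := h₂.tl b hb
  have t4 := h₂.hd b hb
  simp only [zero_add, Nat.reduceAdd] at t1 t2 t3 t4
  have e1 : ∀ j : Fin d, (offsetExp d j).eval σ = p₂ (G₂.tl b) j - p₁ (G₁.tl a) j := fun j => by
    simp only [offsetExp, RealExp.eval, NatExp.eval, cell, ha', hb', t1, t3,
      hpos.fst _ (G₁.tl_lt a ha), hpos.snd _ (G₂.tl_lt b hb)]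
  have e2 : ∀ j : Fin d, (directionExp d j).eval σ =
      (p₂ (G₂.hd b) j - p₂ (G₂.tl b) j) - (p₁ (G₁.hd a) j - p₁ (G₁.tl a) j) := fun j => by
    simp only [directionExp, RealExp.eval, NatExp.eval, cell, ha', hb', t1, t2, t3, t4,
      hpos.fst _ (G₁.tl_lt a ha), hpos.snd _ (G₂.tl_lt b hb),
      hpos.fst _ (G₁.hd_lt a ha), hpos.snd _ (G₂.hd_lt b hb)]
  rw [dist_comm, ← sq_le_sq₀ dist_nonneg hδ, EuclideanSpace.dist_sq_eq, ← sub_nonpos]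
  simp only [quadA, quadB, quadC, RealExp.eval, sumExp_eval, e1, e2, NatExp.eval, hpos.dist]
  rw [Finset.mul_sum, Finset.mul_sum, sub_add_eq_add_sub, sub_add_eq_add_sub,
    ← Finset.sum_add_distrib, ← Finset.sum_add_distrib, ← sq]
  have e3 : ∀ j : Fin d, dist (G₂.pt p₂ b x j) (G₁.pt p₁ a x j) ^ 2 =
      (p₂ (G₂.tl b) j - p₁ (G₁.tl a) j) * (p₂ (G₂.tl b) j - p₁ (G₁.tl a) j) +
      2 * x * ((p₂ (G₂.tl b) j - p₁ (G₁.tl a) j) *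
        ((p₂ (G₂.hd b) j - p₂ (G₂.tl b) j) - (p₁ (G₁.hd a) j - p₁ (G₁.tl a) j))) +
      x ^ 2 * (((p₂ (G₂.hd b) j - p₂ (G₂.tl b) j) - (p₁ (G₁.hd a) j - p₁ (G₁.tl a) j)) *
        ((p₂ (G₂.hd b) j - p₂ (G₂.tl b) j) - (p₁ (G₁.hd a) j - p₁ (G₁.tl a) j))) := fun j => by
    rw [Real.dist_eq, sq_abs]
    simp only [LocGraph.pt, PiLp.add_apply, PiLp.smul_apply, PiLp.sub_apply, smul_eq_mul]
    ring
  simp only [e3]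

theorem quadB_eq_zero (h : (quadA d).eval σ ≤ 0) :
    (quadA d).eval σ = 0 ∧ (quadB d).eval σ = 0 := by
  simp only [quadA, quadB, sumExp_eval, RealExp.eval] at h ⊢
  have h0 := h.antisymm (Finset.sum_nonneg fun j _ => mul_self_nonneg _)
  refine ⟨h0, Finset.sum_eq_zero fun j _ => ?_⟩
  rw [mul_self_eq_zero.mp
    ((Finset.sum_eq_zero_iff_of_nonneg fun j _ => mul_self_nonneg _).mp h0 j (Finset.mem_univ j)),
    mul_zero]

theorem freeInterval_spec (hδ : 0 ≤ δ) (hpos : HasPositions σ G₁ G₂ p₁ p₂ δ)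
    (h₁ : HasLocs σ 0 G₁) (h₂ : HasLocs σ 1 G₂) (hoff : HasOffsets σ G₁ G₂) (ha : a < G₁.L)
    (hb : b < G₂.L) (ha' : σ.nat 8 0 = a) (hb' : σ.nat 9 0 = b) :
    ∃ x y : ℝ, (∀ t, (x ≤ t ∧ t ≤ y) ↔
      (0 ≤ t ∧ t ≤ 1 ∧ dist (G₁.pt p₁ a t) (G₂.pt p₂ b t) ≤ δ)) ∧
      ((freeInterval d).den σ).real (2 * d + 3) =
        Function.update (σ.real (2 * d + 3)) (a * G₂.L + b) x ∧
      ((freeInterval d).den σ).real (2 * d + 4) =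
        Function.update (σ.real (2 * d + 4)) (a * G₂.L + b) y ∧
      ((freeInterval d).den σ).real (2 * d + 5) =
        Function.update (σ.real (2 * d + 5)) (a * G₂.L + b) 2 := by
  have hidx : ∀ τ : State, τ.nat = σ.nat →
      (pairIndex (cell 8 0, cell 9 0)).eval τ = a * G₂.L + b := fun τ hτ => by
    simp only [pairIndex, NatExp.eval, cell, hτ, ha', hb', hoff a ha]
  have hset : ∀ x y : RealExp, (∀ τ : State, τ.nat = σ.nat → (∀ c, c ≠ 2 * d + 3 →
      τ.real c = σ.real c) → y.eval τ = y.eval σ) →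
      ((setInterval d x y).den σ).nat = σ.nat ∧
      ((setInterval d x y).den σ).real (2 * d + 3) =
        Function.update (σ.real (2 * d + 3)) (a * G₂.L + b) (x.eval σ) ∧
      ((setInterval d x y).den σ).real (2 * d + 4) =
        Function.update (σ.real (2 * d + 4)) (a * G₂.L + b) (y.eval σ) ∧
      ((setInterval d x y).den σ).real (2 * d + 5) = σ.real (2 * d + 5) := by
    intro x y hy
    have h3 := hy (σ.setReal (2 * d + 3) (a * G₂.L + b) (x.eval σ)) rfl
      (fun c hc => by rw [State.setReal_real, if_neg hc])
    have h4 := hidx (σ.setReal (2 * d + 3) (a * G₂.L + b) (x.eval σ)) rfl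
    simp [setInterval, Code.den, hidx σ rfl, h4, State.setReal_real, h3]
  have hlast : ∀ P : Code, (P.den σ).nat = σ.nat →
      (P.den σ).real (2 * d + 5) = σ.real (2 * d + 5) →
      ((P.seq (.setReal (2 * d + 5) (pairIndex (cell 8 0, cell 9 0)) (.const 2))).den σ).real
        (2 * d + 3) = (P.den σ).real (2 * d + 3) ∧
      ((P.seq (.setReal (2 * d + 5) (pairIndex (cell 8 0, cell 9 0)) (.const 2))).den σ).real
        (2 * d + 4) = (P.den σ).real (2 * d + 4) ∧
      ((P.seq (.setReal (2 * d + 5) (pairIndex (cell 8 0, cell 9 0)) (.const 2))).den σ).real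
        (2 * d + 5) = Function.update (σ.real (2 * d + 5)) (a * G₂.L + b) 2 := by
    intro P h1 h2
    simp [Code.den, State.setReal_real, hidx _ h1, h2, RealExp.eval]
  have hiff := dist_pt_le_iff hδ hpos h₁ h₂ ha hb ha' hb'
  have hset0 : ∀ m n : ℕ, ∃ x y : ℝ, x = m ∧ y = n ∧
      ((setInterval d (.const m) (.const n)).den σ).nat = σ.nat ∧
      ((setInterval d (.const m) (.const n)).den σ).real (2 * d + 3) =
        Function.update (σ.real (2 * d + 3)) (a * G₂.L + b) x ∧
      ((setInterval d (.const m) (.const n)).den σ).real (2 * d + 4) =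
        Function.update (σ.real (2 * d + 4)) (a * G₂.L + b) y ∧
      ((setInterval d (.const m) (.const n)).den σ).real (2 * d + 5) = σ.real (2 * d + 5) :=
    fun m n => ⟨_, _, rfl, rfl, hset (.const m) (.const n) fun _ _ _ => rfl⟩
  -- It suffices that the branch taken stores the right interval.
  suffices ∃ P : Code, (freeInterval d).den σ =
      (P.seq (.setReal (2 * d + 5) (pairIndex (cell 8 0, cell 9 0)) (.const 2))).den σ ∧
      ∃ x y : ℝ, (∀ t, (x ≤ t ∧ t ≤ y) ↔
        (0 ≤ t ∧ t ≤ 1 ∧ dist (G₁.pt p₁ a t) (G₂.pt p₂ b t) ≤ δ)) ∧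
      (P.den σ).nat = σ.nat ∧
      (P.den σ).real (2 * d + 3) =
        Function.update (σ.real (2 * d + 3)) (a * G₂.L + b) x ∧
      (P.den σ).real (2 * d + 4) =
        Function.update (σ.real (2 * d + 4)) (a * G₂.L + b) y ∧
      (P.den σ).real (2 * d + 5) = σ.real (2 * d + 5) by
    obtain ⟨P, hP, x, y, h, h1, h2, h3, h4⟩ := this
    obtain ⟨g1, g2, g3⟩ := hlast P h1 h4
    exact ⟨x, y, h, by rw [hP, g1, h2], by rw [hP, g2, h3], by rw [hP, g3]⟩
  by_cases hA : (quadA d).eval σ ≤ 0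
  · obtain ⟨hA0, hB0⟩ := quadB_eq_zero hA
    simp only [hA0, hB0, mul_zero, add_zero] at hiff
    by_cases hC : (quadC d).eval σ ≤ 0
    · refine ⟨setInterval d (.const 0) (.const 1), ?_, ?_⟩
      · simp [freeInterval, Code.den, Test.Holds, RealExp.eval, hA, hC]
      · obtain ⟨x, y, rfl, rfl, h⟩ := hset0 0 1
        refine ⟨_, _, fun t => ?_, h⟩
        simp [hiff, hC]
    · refine ⟨setInterval d (.const 1) (.const 0), ?_, ?_⟩
      · simp [freeInterval, Code.den, Test.Holds, RealExp.eval, hA, hC]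
      · obtain ⟨x, y, rfl, rfl, h⟩ := hset0 1 0
        refine ⟨_, _, fun t => ?_, h⟩
        simp only [hiff, hC, and_false, iff_false, not_and, not_le, Nat.cast_one, Nat.cast_zero]
        intro; linarith
  · have hA' := not_le.mp hA
    simp only [quadratic_le_zero_iff hA'] at hiff
    by_cases hD : 0 ≤ (discExp d).eval σ
    · refine ⟨_, ?_, _, _, fun t => ?_, hset (maxExp (.const 0)
            (.div (.sub (.sub (.const 0) (quadB d)) (.sqrt (discExp d))) (quadA d)))
          (minExp (.const 1)
            (.div (.add (.sub (.const 0) (quadB d)) (.sqrt (discExp d))) (quadA d)))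
          fun τ h1 h2 => ?_⟩
      · simp [freeInterval, Code.den, Test.Holds, RealExp.eval, hA, hD]
      · simp only [discExp, RealExp.eval] at hD
        simp only [hiff, hD, true_and, maxExp_eval, minExp_eval, RealExp.eval, discExp, max_le_iff,
          le_min_iff, Nat.cast_zero, Nat.cast_one]
        tauto
      · have hr : ∀ c ≤ 2 * d, τ.real c = σ.real c := fun c hc => h2 c (by omega)
        have r1 : ∀ j : Fin d, τ.real j = σ.real j := fun j => hr _ (by omega)
        have r2 : ∀ j : Fin d, τ.real (d + j) = σ.real (d + j) := fun j => hr _ (by omega)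
        have r3 := hr _ le_rfl
        simp only [minExp_eval, RealExp.eval, discExp, quadA, quadB, quadC, sumExp_eval, offsetExp,
          directionExp, NatExp.eval, cell, h1, r1, r2, r3]
    · refine ⟨setInterval d (.const 1) (.const 0), ?_, ?_⟩
      · simp [freeInterval, Code.den, Test.Holds, RealExp.eval, hA, hD]
      · obtain ⟨x, y, rfl, rfl, h⟩ := hset0 1 0
        refine ⟨_, _, fun t => ?_, h⟩
        simp only [discExp, RealExp.eval] at hD
        simp only [hiff, hD, false_and, and_false, iff_false, not_and, not_le, Nat.cast_one,
          Nat.cast_zero]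
        intro; linarith

/-- After the computation of the free space, the tables hold the intervals of free space, and no
side is reached. -/
theorem freeSpace_spec (hδ : 0 ≤ δ) (hpos : HasPositions σ G₁ G₂ p₁ p₂ δ)
    (s₁ : HasSize σ 0 G₁) (s₂ : HasSize σ 1 G₂)
    (h₁ : HasLocs σ 0 G₁) (h₂ : HasLocs σ 1 G₂) (hoff : HasOffsets σ G₁ G₂) :
    IsFreeSpace G₁ G₂ p₁ p₂ δ
      (fun ν => ((freeSpace d).den σ).real (2 * d + 3) (ν.1 * G₂.L + ν.2))
      (fun ν => ((freeSpace d).den σ).real (2 * d + 4) (ν.1 * G₂.L + ν.2)) ∧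
    ∀ a b, a < G₁.L → b < G₂.L →
      ((freeSpace d).den σ).real (2 * d + 5) (a * G₂.L + b) = 2 := by
  set Q : State → ℕ → ℕ → Prop := fun τ a b =>
    (∀ t, (τ.real (2 * d + 3) (a * G₂.L + b) ≤ t ∧ t ≤ τ.real (2 * d + 4) (a * G₂.L + b)) ↔
      (0 ≤ t ∧ t ≤ 1 ∧ dist (G₁.pt p₁ a t) (G₂.pt p₂ b t) ≤ δ)) ∧
    τ.real (2 * d + 5) (a * G₂.L + b) = 2 with hQ
  have fN : ∀ a, a ≠ 8 → a ≠ 9 → Code.NatFree a (.times 9 (numL 1) (freeInterval d)) := by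
    intro a h8 h9
    simp [Code.NatFree, freeInterval, setInterval, h9]
  have fN' : ∀ a, Code.NatFree a (freeInterval d) := by
    intro a
    simp [Code.NatFree, freeInterval, setInterval]
  have fR : ∀ a ≤ 2 * d, Code.RealFree a (freeInterval d) := by
    intro a ha
    simp only [Code.RealFree, freeInterval, setInterval]
    omega
  suffices key : ∀ a b, a < G₁.L → b < G₂.L → Q ((freeSpace d).den σ) a b from
    ⟨fun a b ha hb => (key a b ha hb).1, fun a b ha hb => (key a b ha hb).2⟩
  refine Code.den_times s₁.eval_numL (fun k τ => ∀ a b, a < k → b < G₂.L → Q τ a b)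
    (fun a b ha => absurd ha (Nat.not_lt_zero a)) (fun k τ hk hv hN hR hI => ?_)
  have n0 := hN 0 (by simp) (fN 0 (by simp) (by simp))
  suffices key : ∀ a b, b < G₂.L → (a < k ∨ a = k ∧ b < G₂.L) →
      Q ((Code.times 9 (numL 1) (freeInterval d)).den τ) a b by
    intro a b ha hb
    exact key a b hb ((Nat.lt_succ_iff_lt_or_eq.mp ha).imp_right fun h => ⟨h, hb⟩)
  refine Code.den_times (s₂.congr n0).eval_numL
    (fun l υ => ∀ a b, b < G₂.L → (a < k ∨ a = k ∧ b < l) → Q υ a b)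
    (fun a b hb h => ?_) (fun l υ hl hv' hN' hR' hI' a b hb h => ?_)
  · exact hI a b (h.resolve_right fun h => Nat.not_lt_zero _ h.2) hb
  · have m : ∀ a, a ≠ 8 → a ≠ 9 → υ.nat a = σ.nat a := fun a h8 h9 =>
      (hN' a h9 (fN' a)).trans (hN a h8 (fN a h8 h9))
    have r : ∀ a ≤ 2 * d, υ.real a = σ.real a := fun a ha =>
      (hR' a (fR a ha)).trans (hR a (fR a ha))
    have v8 : υ.nat 8 0 = k := by rw [hN' 8 (by simp) (fN' 8), hv]
    obtain ⟨x, y, hxy, e3, e4, e5⟩ := freeInterval_spec (σ := υ) hδ (hpos.congr r)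
      (h₁.congr (m _ (by simp) (by simp)) (m _ (by simp) (by simp)))
      (h₂.congr (m _ (by simp) (by simp)) (m _ (by simp) (by simp)))
      (by unfold HasOffsets; rwa [m 22 (by simp) (by simp)]) hk hl v8 hv'
    change Q ((freeInterval d).den υ) a b
    simp only [hQ, e3, e4, e5]
    by_cases hab : a = k ∧ b = l
    · obtain ⟨rfl, rfl⟩ := hab
      simp only [Function.update_self]
      exact ⟨hxy, trivial⟩
    · have hne : a * G₂.L + b ≠ k * G₂.L + l := fun h => hab (pairIndex_inj hb hl h)
      simp only [Function.update_of_ne hne]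
      exact hI' a b hb (by omega)

end FreeInterval

end Frechet

/-! ### Verification of the dynamic program -/

namespace Frechet

open RealRAM

/-- The memory holds the free space and the table of the dynamic program. -/
structure HasTable (d : ℕ) (σ : State) (G₁ G₂ : LocGraph) (FL FH : ℕ × ℕ → ℝ) (T : Table) :
    Prop where
  offsets : HasOffsets σ G₁ G₂
  low : ∀ a b, a < G₁.L → b < G₂.L → σ.real (2 * d + 3) (a * G₂.L + b) = FL (a, b)
  high : ∀ a b, a < G₁.L → b < G₂.L → σ.real (2 * d + 4) (a * G₂.L + b) = FH (a, b)
  lo : ∀ a b, a < G₁.L → b < G₂.L → σ.real (2 * d + 5) (a * G₂.L + b) = T.lo (a, b)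
  pr_fst : ∀ a b, a < G₁.L → b < G₂.L → σ.nat 23 (a * G₂.L + b) = (T.pr (a, b)).1
  pr_snd : ∀ a b, a < G₁.L → b < G₂.L → σ.nat 24 (a * G₂.L + b) = (T.pr (a, b)).2

section Fill

variable {d : ℕ} {σ τ : State} {G₁ G₂ : LocGraph} {FL FH : ℕ × ℕ → ℝ} {T : Table}

theorem HasTable.congr (h : HasTable d σ G₁ G₂ FL FH T) (h22 : τ.nat 22 = σ.nat 22)
    (h23 : τ.nat 23 = σ.nat 23) (h24 : τ.nat 24 = σ.nat 24)
    (hr : ∀ a, 2 * d + 3 ≤ a → τ.real a = σ.real a) : HasTable d τ G₁ G₂ FL FH T := by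
  refine ⟨by unfold HasOffsets; rw [h22]; exact h.offsets, ?_, ?_, ?_, ?_, ?_⟩
  · rw [hr _ le_rfl]; exact h.low
  · rw [hr _ (by omega)]; exact h.high
  · rw [hr _ (by omega)]; exact h.lo
  · rw [h23]; exact h.pr_fst
  · rw [h24]; exact h.pr_snd

/-- The pair of expressions evaluates to the pair of locations `n`. It does not read the arrays that
are written to when the table is updated. -/
structure Denotes (σ : State) (G₁ G₂ : LocGraph) (ν : NatExp × NatExp) (n : ℕ × ℕ) : Prop where
  below_fst : ν.1.Below 23
  below_snd : ν.2.Below 23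
  eval_fst : ν.1.eval σ = n.1
  eval_snd : ν.2.eval σ = n.2
  fst_lt : n.1 < G₁.L
  snd_lt : n.2 < G₂.L

theorem Denotes.congr {ν : NatExp × NatExp} {n : ℕ × ℕ} (h : Denotes σ G₁ G₂ ν n)
    (hN : ∀ a < 23, τ.nat a = σ.nat a) : Denotes τ G₁ G₂ ν n :=
  ⟨h.below_fst, h.below_snd, (h.below_fst.eval_congr hN).trans h.eval_fst,
    (h.below_snd.eval_congr hN).trans h.eval_snd, h.fst_lt, h.snd_lt⟩

theorem Denotes.eval_pairIndex {ν : NatExp × NatExp} {n : ℕ × ℕ} (h : Denotes σ G₁ G₂ ν n)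
    (hoff : HasOffsets σ G₁ G₂) : (pairIndex ν).eval σ = n.1 * G₂.L + n.2 := by
  simp only [pairIndex, NatExp.eval, h.eval_fst, h.eval_snd, hoff _ h.fst_lt]

theorem hasTable_relaxArc (hT : HasTable d σ G₁ G₂ FL FH T) {ν ν' : NatExp × NatExp}
    {n n' : ℕ × ℕ} (h : Denotes σ G₁ G₂ ν n) (h' : Denotes σ G₁ G₂ ν' n') (k : Bool) :
    HasTable d ((relaxArc d ν ν' k).den σ) G₁ G₂ FL FH (T.relax FL FH n n' k) := by
  have e0 := h.eval_pairIndex hT.offsets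
  have e1 := h'.eval_pairIndex hT.offsets
  have l0 := hT.lo _ _ h.fst_lt h.snd_lt
  have l1 := hT.lo _ _ h'.fst_lt h'.snd_lt
  have f1 := hT.low _ _ h'.fst_lt h'.snd_lt
  have g1 := hT.high _ _ h'.fst_lt h'.snd_lt
  have hlb : RealExp.eval σ (if k then .get (2 * d + 5) (pairIndex ν) else .const 0) =
      lbound k (T.lo n) := by
    cases k <;> simp [lbound, RealExp.eval, e0, l0]
  have hcand : (relaxCand d ν' (if k then .get (2 * d + 5) (pairIndex ν) else .const 0)).eval σ =
      max (lbound k (T.lo n)) (FL n') := by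
    rw [relaxCand, maxExp_eval, hlb]
    simp only [RealExp.eval, e1, f1]
  have hcond : Test.Holds σ (.and (.and (.realLe (.get (2 * d + 5) (pairIndex ν)) (.const 1))
      (.realLe (relaxCand d ν' (if k then .get (2 * d + 5) (pairIndex ν) else .const 0))
        (.get (2 * d + 4) (pairIndex ν'))))
      (.not (.realLe (.get (2 * d + 5) (pairIndex ν'))
        (relaxCand d ν' (if k then .get (2 * d + 5) (pairIndex ν) else .const 0))))) ↔
      T.lo n ≤ 1 ∧ max (lbound k (T.lo n)) (FL n') ≤ FH n' ∧
      max (lbound k (T.lo n)) (FL n') < T.lo n' := by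
    simp only [Test.Holds, hcand]
    simp only [RealExp.eval, e0, e1, l0, l1, g1, not_le, Nat.cast_one, and_assoc]
  rw [relaxArc, relaxCode, Code.den]
  by_cases hc : T.lo n ≤ 1 ∧ max (lbound k (T.lo n)) (FL n') ≤ FH n' ∧
      max (lbound k (T.lo n)) (FL n') < T.lo n'
  · rw [if_pos (hcond.mpr hc), Table.relax, if_pos hc]
    simp only [Code.den, e1, hcand]
    set υ := σ.setReal (2 * d + 5) (n'.1 * G₂.L + n'.2) (max (lbound k (T.lo n)) (FL n')) with hυ
    have hυN : ∀ a < 23, υ.nat a = σ.nat a := fun a _ => rfl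
    have u1 := (h'.congr hυN).eval_pairIndex (G₁ := G₁) (G₂ := G₂) hT.offsets
    have u2 := (h.congr hυN).eval_fst
    simp only [u1, u2]
    set ω := υ.setNat 23 (n'.1 * G₂.L + n'.2) n.1 with hω
    have hωN : ∀ a < 23, ω.nat a = σ.nat a := fun a ha => by
      rw [hω, State.setNat_nat, if_neg ha.ne]
      exact hυN a ha
    have w1 := (h'.congr hωN).eval_pairIndex (G₁ := G₁) (G₂ := G₂)
      (by unfold HasOffsets; rw [hωN 22 (by simp)]; exact hT.offsets)
    have w2 := (h.congr hωN).eval_snd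
    simp only [w1, w2]
    have hne : ∀ {a b}, b < G₂.L → (a, b) ≠ n' → a * G₂.L + b ≠ n'.1 * G₂.L + n'.2 :=
      fun hb hab he => hab (by
        obtain ⟨h1, h2⟩ := pairIndex_inj hb h'.snd_lt he
        exact Prod.ext h1 h2)
    refine ⟨?_, fun a b ha hb => ?_, fun a b ha hb => ?_, fun a b ha hb => ?_,
      fun a b ha hb => ?_, fun a b ha hb => ?_⟩
    · simpa [HasOffsets, hω, hυ, State.setNat_nat] using hT.offsets
    · simpa [hω, hυ, State.setReal_real] using hT.low a b ha hb
    · simpa [hω, hυ, State.setReal_real] using hT.high a b ha hb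
    · by_cases hab : (a, b) = n'
      · subst hab
        simp [hω, hυ, State.setReal_real]
      · simpa [hω, hυ, State.setReal_real, hne hb hab, hab] using hT.lo a b ha hb
    · by_cases hab : (a, b) = n'
      · subst hab
        simp [hω, hυ, State.setNat_nat]
      · simpa [hω, hυ, State.setNat_nat, hne hb hab, hab] using hT.pr_fst a b ha hb
    · by_cases hab : (a, b) = n'
      · subst hab
        simp [hω, hυ, State.setNat_nat]
      · simpa [hω, hυ, State.setNat_nat, hne hb hab, hab] using hT.pr_snd a b ha hb
  · rw [if_neg (hcond.not.mpr hc), Table.relax, if_neg hc]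
    exact hT

theorem natFree_relaxArc {a : ℕ} (ha : a < 23) (ν ν' : NatExp × NatExp) (k : Bool) :
    Code.NatFree a (relaxArc d ν ν' k) := by
  exact ⟨⟨trivial, ha.ne, (ha.trans (Nat.lt_succ_self 23)).ne⟩, trivial⟩

theorem hasTable_relaxCellCode (hT : HasTable d σ G₁ G₂ FL FH T) (h₁ : HasLocs σ 0 G₁)
    (h₂ : HasLocs σ 1 G₂) {a b : ℕ} (ha : curA.eval σ = a) (hb : curB.eval σ = b)
    (haL : a < G₁.L) (hbL : b < G₂.L) :
    HasTable d ((relaxCellCode d).den σ) G₁ G₂ FL FH (T.relaxCell G₁ G₂ FL FH a b) := by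
  have bA : curA.Below 23 := by simp [curA, cell, NatExp.Below]
  have bB : curB.Below 23 := by simp [curB, cell, NatExp.Below]
  have tA := (G₁.tl_lt a haL).trans_le G₁.V_le
  have hA := (G₁.hd_lt a haL).trans_le G₁.V_le
  have tB := (G₂.tl_lt b hbL).trans_le G₂.V_le
  have hB := (G₂.hd_lt b hbL).trans_le G₂.V_le
  have D1 : Denotes σ G₁ G₂ (.get 10 curA, curB) (G₁.tl a, b) :=
    ⟨⟨by simp, bA⟩, bB, by rw [NatExp.eval, ha]; exact h₁.tl a haL, hb, tA, hbL⟩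
  have D2 : Denotes σ G₁ G₂ (.get 12 curA, curB) (G₁.hd a, b) :=
    ⟨⟨by simp, bA⟩, bB, by rw [NatExp.eval, ha]; exact h₁.hd a haL, hb, hA, hbL⟩
  have D3 : Denotes σ G₁ G₂ (curA, .get 11 curB) (a, G₂.tl b) :=
    ⟨bA, ⟨by simp, bB⟩, ha, by rw [NatExp.eval, hb]; exact h₂.tl b hbL, haL, tB⟩
  have D4 : Denotes σ G₁ G₂ (curA, .get 13 curB) (a, G₂.hd b) :=
    ⟨bA, ⟨by simp, bB⟩, ha, by rw [NatExp.eval, hb]; exact h₂.hd b hbL, haL, hB⟩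
  have step : ∀ {τ : State} {T' : Table} (ν ν' : NatExp × NatExp) (k : Bool),
      (∀ a < 23, τ.nat a = σ.nat a) →
      ∀ a < 23, ((relaxArc d ν ν' k).den τ).nat a = σ.nat a := fun ν ν' k h a ha =>
    (Code.den_nat (natFree_relaxArc ha ν ν' k) _).trans (h a ha)
  have s0 : ∀ a < 23, σ.nat a = σ.nat a := fun _ _ => rfl
  have s1 := step (T' := T) (.get 10 curA, curB) (.get 12 curA, curB) true s0
  have s2 := step (T' := T) (curA, .get 11 curB) (curA, .get 13 curB) true s1
  have s3 := step (T' := T) (curA, .get 11 curB) (.get 12 curA, curB) false s2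
  have s4 := step (T' := T) (.get 10 curA, curB) (curA, .get 13 curB) false s3
  exact hasTable_relaxArc (hasTable_relaxArc (hasTable_relaxArc (hasTable_relaxArc
    (hasTable_relaxArc hT D1 D2 true) (D3.congr s1) (D4.congr s1) true)
    (D3.congr s2) (D2.congr s2) false) (D1.congr s3) (D4.congr s3) false)
    (D3.congr s4) (D2.congr s4) false

/-- At the beginning, only the start is entered into the table, unless it is not free. -/
theorem exists_hasTable_initStart {st : ℕ × ℕ}
    (hlow : ∀ a b, a < G₁.L → b < G₂.L → σ.real (2 * d + 3) (a * G₂.L + b) = FL (a, b))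
    (hhigh : ∀ a b, a < G₁.L → b < G₂.L → σ.real (2 * d + 4) (a * G₂.L + b) = FH (a, b))
    (hlo : ∀ a b, a < G₁.L → b < G₂.L → σ.real (2 * d + 5) (a * G₂.L + b) = 2)
    (hoff : HasOffsets σ G₁ G₂) (hst : Denotes σ G₁ G₂ startPair st) :
    ∃ T, HasTable d ((initStart d).den σ) G₁ G₂ FL FH T ∧
      T.Inv G₁ G₂ FL FH st (fun _ _ => False) := by
  classical
  set T : Table :=
    ⟨fun ν => if ν = st ∧ FL st ≤ FH st then FL st else 2,
      fun ν => if ν = st then st else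
        (σ.nat 23 (ν.1 * G₂.L + ν.2), σ.nat 24 (ν.1 * G₂.L + ν.2))⟩ with hTdef
  have hle : ∀ ν, T.lo ν ≤ 1 → ν = st ∧ FL st ≤ FH st ∧ T.lo ν = FL st := by
    intro ν hν
    simp only [hTdef] at hν ⊢
    by_cases h : ν = st ∧ FL st ≤ FH st
    · exact ⟨h.1, h.2, if_pos h⟩
    · rw [if_neg h] at hν
      norm_num at hν
  refine ⟨T, ?_, ⟨fun ν hν => ?_, fun h => ?_, fun ν hν => ?_, fun _ _ h => h.elim⟩⟩
  · have e := hst.eval_pairIndex hoff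
    have e1 := hlow _ _ hst.fst_lt hst.snd_lt
    have e2 := hhigh _ _ hst.fst_lt hst.snd_lt
    have e3 : σ.nat 0 2 = st.1 := hst.eval_fst
    have e4 : σ.nat 0 6 = st.2 := hst.eval_snd
    set υ := (Code.branch (.realLe (.get (2 * d + 3) (pairIndex startPair))
        (.get (2 * d + 4) (pairIndex startPair)))
      (.setReal (2 * d + 5) (pairIndex startPair) (.get (2 * d + 3) (pairIndex startPair)))
      .skip).den σ with hυ
    have hυN : υ.nat = σ.nat := by
      rw [hυ, Code.den]
      split_ifs <;> rfl
    have hυR : ∀ a, a ≠ 2 * d + 5 → υ.real a = σ.real a := fun a ha => by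
      refine Code.den_real ?_ σ
      exact ⟨ha, trivial⟩
    have hυ5 : υ.real (2 * d + 5) = if FL st ≤ FH st then
        Function.update (σ.real (2 * d + 5)) (st.1 * G₂.L + st.2) (FL st)
        else σ.real (2 * d + 5) := by
      rw [hυ, Code.den]
      simp only [Test.Holds, RealExp.eval, e, e1, e2]
      split_ifs <;> simp [Code.den, State.setReal_real, RealExp.eval, e, e1]
    have ev : (pairIndex startPair).eval υ = st.1 * G₂.L + st.2 :=
      (hst.congr fun a _ => by rw [hυN]).eval_pairIndex (by unfold HasOffsets; rwa [hυN])
    have hfin : (initStart d).den σ = (υ.setNat 23 (st.1 * G₂.L + st.2) st.1).setNat 24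
        (st.1 * G₂.L + st.2) st.2 := by
      have ev' : (pairIndex startPair).eval (υ.setNat 23 (st.1 * G₂.L + st.2) st.1) =
          st.1 * G₂.L + st.2 :=
        (hst.congr fun a ha => by rw [State.setNat_nat, if_neg ha.ne, hυN]).eval_pairIndex (by
          unfold HasOffsets; rwa [State.setNat_nat, if_neg (by simp), hυN])
      rw [initStart, Code.den, ← hυ]
      simp [Code.den, NatExp.eval, cell, ev, ev', hυN, e3, e4, State.setNat_nat]
    rw [hfin]
    have hne : ∀ {a b}, b < G₂.L → (a, b) ≠ st → a * G₂.L + b ≠ st.1 * G₂.L + st.2 :=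
      fun hb hab he => hab (by
        obtain ⟨h1, h2⟩ := pairIndex_inj hb hst.snd_lt he
        exact Prod.ext h1 h2)
    refine ⟨?_, fun a b ha hb => ?_, fun a b ha hb => ?_, fun a b ha hb => ?_,
      fun a b ha hb => ?_, fun a b ha hb => ?_⟩
    · simpa [HasOffsets, State.setNat_nat, hυN] using hoff
    · simpa [hυR] using hlow a b ha hb
    · simpa [hυR] using hhigh a b ha hb
    · simp only [State.setNat_real, hυ5, hTdef]
      by_cases hab : (a, b) = st
      · subst hab
        by_cases hf : FL (a, b) ≤ FH (a, b) <;> simp [hf, hlo a b ha hb]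
      · by_cases hf : FL st ≤ FH st <;> simp [hf, hab, hne hb hab, hlo a b ha hb]
    · by_cases hab : (a, b) = st
      · subst hab
        simp [hTdef, State.setNat_nat]
      · simp [hTdef, State.setNat_nat, hab, hne hb hab, hυN]
    · by_cases hab : (a, b) = st
      · subst hab
        simp [hTdef, State.setNat_nat]
      · simp [hTdef, State.setNat_nat, hab, hne hb hab, hυN]
  · obtain ⟨rfl, h2, h3⟩ := hle ν hν
    exact ⟨h3.ge, h3.le.trans h2⟩
  · exact (if_pos ⟨rfl, h⟩ : T.lo st = FL st).le
  · obtain ⟨rfl, h2, h3⟩ := hle ν hν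
    have h4 : T.pr ν = ν := if_pos rfl
    rw [h4]
    exact ⟨hν, .inl ⟨rfl, rfl⟩⟩

theorem Table.Inv.mono {st : ℕ × ℕ} {done done' : ℕ → ℕ → Prop}
    (hT : T.Inv G₁ G₂ FL FH st done) (h : ∀ a b, done' a b → done a b) :
    T.Inv G₁ G₂ FL FH st done' :=
  ⟨hT.free, hT.start, hT.pred, fun a b hab => hT.closed a b (h a b hab)⟩

/-- The cells are dealt with in the lexicographic order that is induced by topological orders of the
locations, so that no cell is dealt with before one that lies weakly below it. -/
theorem exists_hasTable_fillTable {st : ℕ × ℕ} {pos₁ pos₂ : ℕ → ℕ}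
    (hT : HasTable d σ G₁ G₂ FL FH T) (hI : T.Inv G₁ G₂ FL FH st (fun _ _ => False))
    (s₁ : HasSize σ 0 G₁) (s₂ : HasSize σ 1 G₂) (h₁ : HasLocs σ 0 G₁) (h₂ : HasLocs σ 1 G₂)
    (o₁ : G₁.IsOrder (σ.nat 14) pos₁) (o₂ : G₂.IsOrder (σ.nat 15) pos₂) :
    ∃ T', HasTable d ((fillTable d).den σ) G₁ G₂ FL FH T' ∧
      T'.Inv G₁ G₂ FL FH st (IsCell G₁ G₂) := by
  have fN : ∀ a < 23, Code.NatFree a (fillStep d) := fun a ha =>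
    ⟨⟨natFree_relaxArc ha _ _ _, natFree_relaxArc ha _ _ _, natFree_relaxArc ha _ _ _,
      natFree_relaxArc ha _ _ _, natFree_relaxArc ha _ _ _⟩, trivial⟩
  suffices key : ∃ T', HasTable d ((fillTable d).den σ) G₁ G₂ FL FH T' ∧
      T'.Inv G₁ G₂ FL FH st (fun a b => IsCell G₁ G₂ a b ∧ pos₁ a < G₁.L) by
    obtain ⟨T', h1, h2⟩ := key
    exact ⟨T', h1, h2.mono fun a b h => ⟨h, o₁.pos_lt a h.fst_lt⟩⟩
  refine Code.den_times s₁.eval_numL (fun k τ => ∃ T', HasTable d τ G₁ G₂ FL FH T' ∧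
    T'.Inv G₁ G₂ FL FH st (fun a b => IsCell G₁ G₂ a b ∧ pos₁ a < k))
    ?_ (fun k τ hk hv hN _ hI => ?_)
  · exact ⟨T, hT.congr (by simp [State.setNat_nat]) (by simp [State.setNat_nat])
      (by simp [State.setNat_nat]) (fun _ _ => rfl), hI.mono fun _ _ h => Nat.not_lt_zero _ h.2⟩
  have hN' : ∀ a < 23, a ≠ 8 → a ≠ 9 → τ.nat a = σ.nat a := fun a ha h8 h9 =>
    hN a h8 ⟨h9, fN a ha⟩
  suffices key : ∃ T', HasTable d ((Code.times 9 (numL 1) (fillStep d)).den τ) G₁ G₂ FL FH T' ∧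
      T'.Inv G₁ G₂ FL FH st (fun a b => IsCell G₁ G₂ a b ∧
        (pos₁ a < k ∨ pos₁ a = k ∧ pos₂ b < G₂.L)) by
    obtain ⟨T', h1, h2⟩ := key
    refine ⟨T', h1.congr (by simp [State.setNat_nat]) (by simp [State.setNat_nat])
      (by simp [State.setNat_nat]) (fun _ _ => rfl), h2.mono fun a b h => ⟨h.1, ?_⟩⟩
    exact (Nat.lt_succ_iff_lt_or_eq.mp h.2).imp_right fun e => ⟨e, o₂.pos_lt b h.1.snd_lt⟩
  refine Code.den_times (s₂.congr (hN' 0 (by simp) (by simp) (by simp))).eval_numL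
    (fun l υ => ∃ T', HasTable d υ G₁ G₂ FL FH T' ∧
    T'.Inv G₁ G₂ FL FH st (fun a b => IsCell G₁ G₂ a b ∧
        (pos₁ a < k ∨ pos₁ a = k ∧ pos₂ b < l)))
    ?_ (fun l υ hl hv' hM _ hI' => ?_)
  · obtain ⟨T', h1, h2⟩ := hI
    exact ⟨T', h1.congr (by simp [State.setNat_nat]) (by simp [State.setNat_nat])
      (by simp [State.setNat_nat]) (fun _ _ => rfl), h2.mono fun a b h =>
      ⟨h.1, h.2.resolve_right fun h => Nat.not_lt_zero _ h.2⟩⟩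
  obtain ⟨T', h1, h2⟩ := hI'
  have m : ∀ a < 23, a ≠ 8 → a ≠ 9 → υ.nat a = σ.nat a := fun a ha h8 h9 =>
    (hM a h9 (fN a ha)).trans (hN' a ha h8 h9)
  have v8 : υ.nat 8 0 = k := by rw [hM 8 (by simp) (fN 8 (by simp)), hv]
  set a := σ.nat 14 k with ha
  set b := σ.nat 15 l with hb
  have eA : curA.eval υ = a := by
    simp only [curA, cell, NatExp.eval, v8, m 14 (by simp) (by simp) (by simp), ha]
  have eB : curB.eval υ = b := by
    simp only [curB, cell, NatExp.eval, hv', m 15 (by simp) (by simp) (by simp), hb]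
  have haL : a < G₁.L := o₁.ord_lt k hk
  have hbL : b < G₂.L := o₂.ord_lt l hl
  have pa : pos₁ a = k := o₁.pos_ord k hk
  have pb : pos₂ b = l := o₂.pos_ord l hl
  have eV₁ := (s₁.congr (m 0 (by simp) (by simp) (by simp))).eval_numV
  have eV₂ := (s₂.congr (m 0 (by simp) (by simp) (by simp))).eval_numV
  suffices key : ∃ T', HasTable d ((fillStep d).den υ) G₁ G₂ FL FH T' ∧
      T'.Inv G₁ G₂ FL FH st (fun a b => IsCell G₁ G₂ a b ∧
        (pos₁ a < k ∨ pos₁ a = k ∧ pos₂ b < l + 1)) by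
    obtain ⟨T', h1, h2⟩ := key
    exact ⟨T', h1.congr (by simp [State.setNat_nat]) (by simp [State.setNat_nat])
      (by simp [State.setNat_nat]) (fun _ _ => rfl), h2⟩
  have hdone' : ∀ a' b', IsCell G₁ G₂ a' b' ∧ (pos₁ a' < k ∨ pos₁ a' = k ∧ pos₂ b' < l + 1) →
      (IsCell G₁ G₂ a' b' ∧ (pos₁ a' < k ∨ pos₁ a' = k ∧ pos₂ b' < l)) ∨ a' = a ∧ b' = b := by
    rintro a' b' ⟨hc, h | ⟨h, h'⟩⟩
    · exact .inl ⟨hc, .inl h⟩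
    · rcases Nat.lt_succ_iff_lt_or_eq.mp h' with h' | h'
      · exact .inl ⟨hc, .inr ⟨h, h'⟩⟩
      · refine .inr ⟨?_, ?_⟩
        · rw [← o₁.ord_pos a' hc.fst_lt, h]
        · rw [← o₂.ord_pos b' hc.snd_lt, h']
  rw [fillStep, Code.den]
  simp only [Test.Holds, NatExp.eval, eA, eB, eV₁, eV₂]
  split_ifs with hcell
  · have hc : IsCell G₁ G₂ a b := ⟨haL, hbL, by omega⟩
    refine ⟨_, hasTable_relaxCellCode h1
      (h₁.congr (m _ (by simp) (by simp) (by simp)) (m _ (by simp) (by simp) (by simp)))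
      (h₂.congr (m _ (by simp) (by simp) (by simp)) (m _ (by simp) (by simp) (by simp)))
      eA eB haL hbL, h2.relaxCell hc o₁.rank o₂.rank (fun a' b' h => ⟨h.1, ?_⟩) hdone'⟩
    have := h.2
    omega
  · refine ⟨T', h1, h2.mono fun a' b' h => (hdone' a' b' h).resolve_right ?_⟩
    rintro ⟨rfl, rfl⟩
    have := h.1.not_corner
    omega

end Fill

end Frechet

/-! ### Verification of the output -/

namespace Frechet

open RealRAM

section Output

variable {d : ℕ} {σ τ : State} {G₁ G₂ : LocGraph} {FL FH : ℕ × ℕ → ℝ} {T : Table} {N : ℕ}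
  {ν : ℕ → ℕ × ℕ}

/-- The memory holds the chain `ν` of predecessors. -/
structure HasChain (d : ℕ) (σ : State) (G₁ G₂ : LocGraph) (FL FH : ℕ × ℕ → ℝ) (T : Table) (N : ℕ)
    (ν : ℕ → ℕ × ℕ) : Prop where
  size_fst : HasSize σ 0 G₁
  size_snd : HasSize σ 1 G₂
  table : HasTable d σ G₁ G₂ FL FH T
  length : N = G₁.L + G₂.L
  fst : ∀ k ≤ N, σ.nat 26 k = (ν k).1
  snd : ∀ k ≤ N, σ.nat 27 k = (ν k).2
  fst_lt : ∀ k ≤ N, (ν k).1 < G₁.L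
  snd_lt : ∀ k ≤ N, (ν k).2 < G₂.L

theorem HasChain.congr (h : HasChain d σ G₁ G₂ FL FH T N ν) (h0 : τ.nat 0 = σ.nat 0)
    (hn : ∀ a, 22 ≤ a → a ≤ 27 → τ.nat a = σ.nat a)
    (hr : ∀ a, 2 * d + 3 ≤ a → τ.real a = σ.real a) : HasChain d τ G₁ G₂ FL FH T N ν :=
  ⟨h.size_fst.congr h0, h.size_snd.congr h0,
    h.table.congr (hn _ (by simp) (by simp)) (hn _ (by simp) (by simp))
      (hn _ (by simp) (by simp)) hr, h.length,
    by rw [hn _ (by simp) (by simp)]; exact h.fst, by rw [hn _ (by simp) (by simp)]; exact h.snd,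
    h.fst_lt, h.snd_lt⟩

theorem HasChain.eval_numSteps (h : HasChain d σ G₁ G₂ FL FH T N ν) : numSteps.eval σ = N := by
  rw [h.length, numSteps, NatExp.eval, h.size_fst.eval_numL, h.size_snd.eval_numL]

/-- A predecessor of a reached side is reached. -/
theorem Table.Inv.pr_lt {st : ℕ × ℕ} {done : ℕ → ℕ → Prop} (hT : T.Inv G₁ G₂ FL FH st done)
    (hst : st.1 < G₁.L ∧ st.2 < G₂.L) {μ : ℕ × ℕ} (h : T.lo μ ≤ 1) :
    T.lo (T.pr μ) ≤ 1 ∧ (T.pr μ).1 < G₁.L ∧ (T.pr μ).2 < G₂.L := by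
  obtain ⟨h1, ⟨-, h2⟩ | ⟨-, -, a, b, k, hc, hA, -⟩⟩ := hT.pred μ h
  · exact ⟨h1, by rwa [h2]⟩
  · exact ⟨h1, hA.src_lt hc⟩

theorem exists_hasChain_traceBack (hT : HasTable d σ G₁ G₂ FL FH T) (s₁ : HasSize σ 0 G₁)
    (s₂ : HasSize σ 1 G₂) {st tt : ℕ × ℕ} {done : ℕ → ℕ → Prop}
    (hI : T.Inv G₁ G₂ FL FH st done) (hst : st.1 < G₁.L ∧ st.2 < G₂.L)
    (htt : tt.1 < G₁.L ∧ tt.2 < G₂.L) (hlo : T.lo tt ≤ 1) (h03 : σ.nat 0 3 = tt.1)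
    (h07 : σ.nat 0 7 = tt.2) :
    ∃ ν, HasChain d (traceBack.den σ) G₁ G₂ FL FH T (G₁.L + G₂.L) ν ∧ ν 0 = tt ∧
      ∀ k, ν (k + 1) = T.pr (ν k) := by
  set ν : ℕ → ℕ × ℕ := fun k => T.pr^[k] tt with hν
  have hsucc : ∀ k, ν (k + 1) = T.pr (ν k) := fun k => Function.iterate_succ_apply' T.pr k tt
  have hreach : ∀ k, T.lo (ν k) ≤ 1 ∧ (ν k).1 < G₁.L ∧ (ν k).2 < G₂.L := by
    intro k
    induction k with
    | zero => exact ⟨hlo, htt⟩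
    | succ k ih => rw [hsucc]; exact hI.pr_lt hst ih.1
  set υ := (Code.setNat 27 (.const 0) (cell 0 7)).den
    ((Code.setNat 26 (.const 0) (cell 0 3)).den σ) with hυ
  have u : ∀ a, a ≠ 26 → a ≠ 27 → υ.nat a = σ.nat a := fun a h h' => by
    simp [hυ, Code.den, State.setNat_nat, h, h']
  have u26 : υ.nat 26 0 = tt.1 := by
    simp [hυ, Code.den, State.setNat_nat, NatExp.eval, cell, h03]
  have u27 : υ.nat 27 0 = tt.2 := by
    simp [hυ, Code.den, State.setNat_nat, NatExp.eval, cell, h07]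
  have hυT : HasTable d υ G₁ G₂ FL FH T := hT.congr (u _ (by simp) (by simp))
    (u _ (by simp) (by simp)) (u _ (by simp) (by simp)) fun _ _ => rfl
  have v1 := s₁.congr (u 0 (by simp) (by simp))
  have v2 := s₂.congr (u 0 (by simp) (by simp))
  have hfin : traceBack.den σ = (Code.times 8 numSteps traceStep).den υ := rfl
  have fN : ∀ a, a ≠ 26 → a ≠ 27 → Code.NatFree a traceStep := fun a h h' => ⟨h, h'⟩
  have fR : ∀ a, Code.RealFree a traceStep := fun a => ⟨trivial, trivial⟩
  have key : ∀ k ≤ G₁.L + G₂.L, ((Code.times 8 numSteps traceStep).den υ).nat 26 k = (ν k).1 ∧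
      ((Code.times 8 numSteps traceStep).den υ).nat 27 k = (ν k).2 := by
    refine Code.den_times (n := G₁.L + G₂.L)
      (by rw [numSteps, NatExp.eval, v1.eval_numL, v2.eval_numL])
      (fun n τ => ∀ k ≤ n, τ.nat 26 k = (ν k).1 ∧ τ.nat 27 k = (ν k).2) (fun k hk => ?_)
      (fun n τ hn hv hN hR hJ k hk => ?_)
    · obtain rfl := Nat.le_zero.mp hk
      have e : ∀ b, b ≠ 8 → (υ.setNat 8 0 0).nat b = υ.nat b := fun b h => by
        rw [State.setNat_nat, if_neg h]
      rw [e 26 (by simp), e 27 (by simp)]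
      exact ⟨u26, u27⟩
    · have hτT : HasTable d τ G₁ G₂ FL FH T := hυT.congr
        (hN _ (by simp) (fN _ (by simp) (by simp))) (hN _ (by simp) (fN _ (by simp) (by simp)))
        (hN _ (by simp) (fN _ (by simp) (by simp))) fun a _ => hR a (fR a)
      obtain ⟨j1, j2⟩ := hJ n le_rfl
      have hoff := hτT.offsets _ (hreach n).2.1
      have p1 := hτT.pr_fst _ _ (hreach n).2.1 (hreach n).2.2
      have p2 := hτT.pr_snd _ _ (hreach n).2.1 (hreach n).2.2
      have e26 : ((traceStep.den τ).setNat 8 0 (n + 1)).nat 26 =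
          Function.update (τ.nat 26) (n + 1) (ν (n + 1)).1 := by
        simp [traceStep, Code.den, State.setNat_nat, NatExp.eval, cell, pairIndex, tracePair,
          hv, j1, j2, hoff, p1, hsucc]
      have e27 : ((traceStep.den τ).setNat 8 0 (n + 1)).nat 27 =
          Function.update (τ.nat 27) (n + 1) (ν (n + 1)).2 := by
        simp [traceStep, Code.den, State.setNat_nat, NatExp.eval, cell, pairIndex, tracePair,
          hv, j1, j2, hoff, p2, hsucc]
      rw [e26, e27]
      rcases Nat.lt_or_eq_of_le hk with hk | rfl
      · rw [Function.update_of_ne hk.ne, Function.update_of_ne hk.ne]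
        exact hJ k (Nat.lt_succ_iff.mp hk)
      · simp
  have gN : ∀ a, a ≠ 8 → a ≠ 26 → a ≠ 27 →
      ((Code.times 8 numSteps traceStep).den υ).nat a = υ.nat a := fun a h8 h h' =>
    Code.den_nat (P := .times 8 numSteps traceStep) ⟨h8, fN a h h'⟩ υ
  refine ⟨ν, ?_, rfl, hsucc⟩
  rw [hfin]
  exact ⟨v1.congr (gN _ (by simp) (by simp) (by simp)),
    v2.congr (gN _ (by simp) (by simp) (by simp)),
    hυT.congr (gN _ (by simp) (by simp) (by simp)) (gN _ (by simp) (by simp) (by simp))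
      (gN _ (by simp) (by simp) (by simp)) fun a _ =>
        Code.den_real (P := .times 8 numSteps traceStep) (fR a) υ, rfl,
    fun k hk => (key k hk).1, fun k hk => (key k hk).2, fun k _ => (hreach k).2.1,
    fun k _ => (hreach k).2.2⟩

/-- Here `a` is the sequence of locations on side `s` from the start to the end. -/
theorem walkCode_spec (hC : HasChain d σ G₁ G₂ FL FH T N ν) {s : ℕ} (hs : s ≤ 1) {G : LocGraph}
    (hG : HasSize σ s G) {a : ℕ → ℕ} (ha : ∀ k ≤ N, σ.nat (s + 26) (N - k) = a k)
    (h28 : σ.nat (s + 28) 0 = 0) (hR : σ.real (2 * d + 1 + s) 0 = 0)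
    (h6 : σ.nat (s + 6) 0 = a 0) (ha0 : a 0 < G.V) :
    ((walkCode d s).den σ).nat (s + 28) 0 = visits G.V a N ∧
    (∀ k ≤ N, ((walkCode d s).den σ).real (2 * d + 1 + s) k =
      place G.V a (fun k => T.lo (ν (N - k))) k) ∧
    ∀ k ≤ N, a k < G.V → ((walkCode d s).den σ).nat (s + 6) (visits G.V a k) = a k := by
  have f6 : s + 6 ≠ 8 := by omega
  have f28 : s + 28 ≠ 8 := by omega
  have f26 : s + 26 ≠ 8 := by omega
  have fN : ∀ b, b ≠ s + 28 → b ≠ s + 6 → Code.NatFree b (walkStep d s) := fun b h h' =>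
    ⟨⟨⟨h, h'⟩, trivial⟩, trivial, trivial⟩
  have fR : ∀ b, b ≠ 2 * d + 1 + s → Code.RealFree b (walkStep d s) := fun b h =>
    ⟨⟨⟨trivial, trivial⟩, trivial⟩, h, h⟩
  set x : ℕ → ℝ := fun k => T.lo (ν (N - k)) with hx
  refine Code.den_times hC.eval_numSteps (fun n τ => τ.nat (s + 28) 0 = visits G.V a n ∧
    (∀ k ≤ n, τ.real (2 * d + 1 + s) k = place G.V a x k) ∧
    ∀ k ≤ n, a k < G.V → τ.nat (s + 6) (visits G.V a k) = a k)
    ⟨?_, fun k hk => ?_, fun k hk _ => ?_⟩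
    (fun n τ hn hv hN hR' hI => ?_)
  · simpa [State.setNat_nat, f28, visits] using h28
  · obtain rfl := Nat.le_zero.mp hk
    simpa [place, visits, ha0] using hR
  · obtain rfl := Nat.le_zero.mp hk
    simpa [State.setNat_nat, f6, visits] using h6
  · have hCτ : HasChain d τ G₁ G₂ FL FH T N ν := hC.congr
      (hN 0 (by simp) (fN 0 (by omega) (by omega)))
      (fun b h h' => hN b (by omega) (fN b (by omega) (by omega)))
      (fun b h => hR' b (fR b (by omega)))
    have hA : τ.nat (s + 26) = σ.nat (s + 26) := hN _ f26 (fN _ (by simp) (by simp))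
    have hGτ := (hG.congr (hN 0 (by simp) (fN 0 (by omega) (by omega)))).eval_numV
    have hsteps := hCτ.eval_numSteps
    obtain ⟨i1, i2, i3⟩ := hI
    have eN : (nextLoc s).eval τ = a (n + 1) := by
      simp only [nextLoc, nextIndex, cell, NatExp.eval, hsteps, hv, hA]
      exact ha (n + 1) hn
    have eC : (curLoc s).eval τ = a n := by
      simp only [curLoc, cell, NatExp.eval, hsteps, hv, hA]
      exact ha n hn.le
    set B := Code.branch (.and (isVertexTest s)
        (.not (.and (.natLe (nextLoc s) (curLoc s)) (.natLe (curLoc s) (nextLoc s)))))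
      (.seq (.setNat (s + 28) (.const 0) (.add (cell (s + 28) 0) (.const 1)))
        (.setNat (s + 6) (cell (s + 28) 0) (nextLoc s)))
      .skip with hB
    set υ := B.den τ with hυ
    have uN : ∀ b, b ≠ s + 28 → b ≠ s + 6 → υ.nat b = τ.nat b := fun b h h' =>
      Code.den_nat (P := B) ⟨⟨h, h'⟩, trivial⟩ τ
    have uR : υ.real = τ.real := funext fun b =>
      Code.den_real (P := B) ⟨⟨trivial, trivial⟩, trivial⟩ τ
    have hcond : Test.Holds τ (.and (isVertexTest s)
        (.not (.and (.natLe (nextLoc s) (curLoc s)) (.natLe (curLoc s) (nextLoc s))))) ↔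
        a (n + 1) < G.V ∧ a (n + 1) ≠ a n := by
      simp only [Test.Holds, isVertexTest, NatExp.eval, eN, eC, hGτ]
      omega
    have hCυ : HasChain d υ G₁ G₂ FL FH T N ν := hCτ.congr
      (uN 0 (by omega) (by omega)) (fun b h h' => uN b (by omega) (by omega))
      (fun b h => by rw [uR])
    have eN' : (nextLoc s).eval υ = a (n + 1) := by
      simp only [nextLoc, nextIndex, cell, NatExp.eval, hCυ.eval_numSteps,
        uN 8 (by omega) (by omega), uN (s + 26) (by simp) (by simp), hv, hA]
      exact ha (n + 1) hn
    have hGυ : (numV s).eval υ = G.V := by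
      rw [← hGτ]
      simp only [numV, cell, NatExp.eval, uN 0 (by omega) (by omega)]
    have u1 : υ.nat (s + 28) 0 = visits G.V a (n + 1) := by
      rw [hυ, hB, Code.den, visits]
      by_cases hc : a (n + 1) < G.V ∧ a (n + 1) ≠ a n
      · rw [if_pos (hcond.mpr hc), if_pos hc]
        simp [Code.den, State.setNat_nat, NatExp.eval, cell, i1]
      · rw [if_neg (hcond.not.mpr hc), if_neg hc]
        exact i1
    have u2 : ∀ k ≤ n + 1, a k < G.V → υ.nat (s + 6) (visits G.V a k) = a k := by
      intro k hk hkV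
      by_cases hc : a (n + 1) < G.V ∧ a (n + 1) ≠ a n
      · have hvis : visits G.V a (n + 1) = visits G.V a n + 1 := by rw [visits, if_pos hc]
        have e : υ.nat (s + 6) = Function.update (τ.nat (s + 6)) (visits G.V a n + 1)
            (a (n + 1)) := by
          have eN'' : (nextLoc s).eval (τ.setNat (s + 28) 0 (visits G.V a n + 1)) =
              a (n + 1) := by
            rw [← eN]
            simp [nextLoc, nextIndex, numSteps, numL, numV, cell, NatExp.eval,
              State.setNat_nat]
          rw [hυ, hB, Code.den, if_pos (hcond.mpr hc)]
          simp only [Code.den, NatExp.eval, cell, i1, eN'']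
          simp [State.setNat_nat]
        rw [e]
        rcases Nat.lt_or_eq_of_le hk with hk | rfl
        · have hle := LocGraph.visits_mono G.V a (Nat.lt_succ_iff.mp hk)
          rw [Function.update_of_ne (by omega)]
          exact i3 k (Nat.lt_succ_iff.mp hk) hkV
        · rw [hvis, Function.update_self]
      · have e : υ.nat (s + 6) = τ.nat (s + 6) := by
          rw [hυ, hB, Code.den, if_neg (hcond.not.mpr hc), Code.den]
        rw [e]
        rcases Nat.lt_or_eq_of_le hk with hk | rfl
        · exact i3 k (Nat.lt_succ_iff.mp hk) hkV
        · rw [visits, if_neg hc, add_zero]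
          have heq : a (n + 1) = a n := not_not.mp fun h => hc ⟨hkV, h⟩
          rw [heq] at hkV ⊢
          exact i3 n le_rfl hkV
    have u3 : ((walkStep d s).den τ).real (2 * d + 1 + s) =
        Function.update (τ.real (2 * d + 1 + s)) (n + 1) (place G.V a x (n + 1)) := by
      rw [walkStep, Code.den, ← hB, ← hυ, Code.den]
      have hval : υ.real (2 * d + 5) ((pairIndex (nextLoc 0, nextLoc 1)).eval υ) = x (n + 1) := by
        have e1 : (nextLoc 0).eval υ = (ν (N - (n + 1))).1 := by
          simp only [nextLoc, nextIndex, cell, NatExp.eval, hCυ.eval_numSteps,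
            uN 8 (by omega) (by omega), hv]
          exact hCυ.fst _ (Nat.sub_le _ _)
        have e2 : (nextLoc 1).eval υ = (ν (N - (n + 1))).2 := by
          simp only [nextLoc, nextIndex, cell, NatExp.eval, hCυ.eval_numSteps,
            uN 8 (by omega) (by omega), hv]
          exact hCυ.snd _ (Nat.sub_le _ _)
        have r1 := hC.fst_lt (N - (n + 1)) (Nat.sub_le _ _)
        have r2 := hC.snd_lt (N - (n + 1)) (Nat.sub_le _ _)
        simp only [pairIndex, NatExp.eval, e1, e2, hCυ.table.offsets _ r1]
        exact hCυ.table.lo _ _ r1 r2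
      have h8 : υ.nat 8 0 = n := by rw [uN 8 (by omega) (by omega), hv]
      have hV : Test.Holds υ (isVertexTest s) ↔ a (n + 1) < G.V := by
        simp only [Test.Holds, isVertexTest, NatExp.eval, eN', hGυ]
        omega
      by_cases hc : a (n + 1) < G.V
      · rw [if_pos (hV.mpr hc), place, if_pos hc]
        simp [Code.den, State.setReal_real, RealExp.eval, NatExp.eval, cell, h8, u1, uR]
      · rw [if_neg (hV.not.mpr hc), place, if_neg hc]
        simp only [Code.den, State.setReal_real, RealExp.eval, hval, if_true]
        simp [NatExp.eval, cell, h8, u1, uR]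
    have hnat : ((walkStep d s).den τ).nat = υ.nat := by
      rw [walkStep, Code.den, ← hB, ← hυ, Code.den]
      split_ifs <;> rfl
    refine ⟨?_, fun k hk => ?_, fun k hk hkV => ?_⟩
    · rw [State.setNat_nat, if_neg f28, hnat, u1]
    · rw [State.setNat_real, u3]
      rcases Nat.lt_or_eq_of_le hk with hk | rfl
      · rw [Function.update_of_ne hk.ne]
        exact i2 k (Nat.lt_succ_iff.mp hk)
      · rw [Function.update_self]
    · rw [State.setNat_nat, if_neg f6, hnat]
      exact u2 k hk hkV

theorem normalizeCode_spec (hC : HasChain d σ G₁ G₂ FL FH T N ν) {s : ℕ} :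
    ∀ k ≤ N, ((normalizeCode d s).den σ).real (2 * d + 1 + s) k =
      σ.real (2 * d + 1 + s) k / σ.nat (s + 28) 0 := by
  suffices key : ∀ k, ((normalizeCode d s).den σ).real (2 * d + 1 + s) k =
      if k < N + 1 then σ.real (2 * d + 1 + s) k / σ.nat (s + 28) 0
      else σ.real (2 * d + 1 + s) k from fun k hk =>
    (key k).trans (if_pos (Nat.lt_succ_iff.mpr hk))
  refine Code.den_times (n := N + 1) (by rw [NatExp.eval, hC.eval_numSteps]; rfl)
    (fun n τ => ∀ k, τ.real (2 * d + 1 + s) k =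
      if k < n then σ.real (2 * d + 1 + s) k / σ.nat (s + 28) 0
      else σ.real (2 * d + 1 + s) k) (fun k => by simp) (fun n τ hn hv hN _ hI k => ?_)
  have h28 : τ.nat (s + 28) = σ.nat (s + 28) := hN _ (by omega) trivial
  have e : (((normalizeStep d s).den τ).setNat 8 0 (n + 1)).real (2 * d + 1 + s) =
      Function.update (τ.real (2 * d + 1 + s)) n
        (σ.real (2 * d + 1 + s) n / σ.nat (s + 28) 0) := by
    simp [normalizeStep, Code.den, State.setReal_real, RealExp.eval, NatExp.eval, cell, hv, h28, hI]
  rw [e]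
  by_cases hk : k = n
  · subst hk
    simp
  · rw [Function.update_of_ne hk, hI k]
    by_cases h : k < n
    · rw [if_pos h, if_pos (by omega)]
    · rw [if_neg h, if_neg (by omega)]

/-- The memory holds the output for the side `s`: the number of edges of the path, its vertices and
the breakpoints of its reparameterization. -/
structure HasOutput (d : ℕ) (σ : State) (s V : ℕ) (a : ℕ → ℕ) (x : ℕ → ℝ) (N : ℕ) : Prop where
  length : σ.nat 5 (1 + s) = visits V a N
  vertex : ∀ k ≤ N, a k < V → σ.nat (s + 6) (visits V a k) = a k
  breakpoint : ∀ i ≤ N + 1, σ.real (2 * d + 1 + s) i = breakpoint V a x N i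

theorem hasOutput_outputSide (hC : HasChain d σ G₁ G₂ FL FH T N ν) {s : ℕ} (hs : s ≤ 1)
    {G : LocGraph} (hG : HasSize σ s G) {a : ℕ → ℕ} (ha : ∀ k ≤ N, σ.nat (s + 26) (N - k) = a k)
    (h28 : σ.nat (s + 28) 0 = 0) (hR : σ.real (2 * d + 1 + s) 0 = 0)
    (h0 : σ.nat 0 (4 * s + 2) = a 0) (ha0 : a 0 < G.V) :
    HasOutput d ((outputSide d s).den σ) s G.V a (fun k => T.lo (ν (N - k))) N ∧
      ∀ j ≠ 1 + s, ((outputSide d s).den σ).nat 5 j = σ.nat 5 j := by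
  have f28 : s + 28 ≠ 8 := by omega
  have f6 : s + 6 ≠ 8 := by omega
  set σ₁ := (Code.setNat (s + 6) (.const 0) (cell 0 (4 * s + 2))).den σ with h1
  have n1 : ∀ b, b ≠ s + 6 → σ₁.nat b = σ.nat b := fun b h => Code.den_nat (P := .setNat _ _ _) h σ
  have hC₁ : HasChain d σ₁ G₁ G₂ FL FH T N ν := hC.congr (n1 _ (by omega))
    (fun b h h' => n1 b (by omega)) fun _ _ => rfl
  obtain ⟨w1, w2, w3⟩ := walkCode_spec hC₁ hs (hG.congr (n1 _ (by omega))) (a := a)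
    (by rw [n1 _ (by simp)]; exact ha) (by rw [n1 _ (by simp)]; exact h28) hR
    (by simp [h1, Code.den, State.setNat_nat, NatExp.eval, cell, h0]) ha0
  set σ₂ := (walkCode d s).den σ₁ with h2
  have n2 : ∀ b, b ≠ 8 → b ≠ s + 28 → b ≠ s + 6 → σ₂.nat b = σ₁.nat b := fun b h8 h h' =>
    Code.den_nat (P := walkCode d s) ⟨h8, ⟨⟨h, h'⟩, trivial⟩, trivial, trivial⟩ σ₁
  have r2 : ∀ b, b ≠ 2 * d + 1 + s → σ₂.real b = σ₁.real b := fun b h =>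
    Code.den_real (P := walkCode d s) ⟨⟨⟨trivial, trivial⟩, trivial⟩, h, h⟩ σ₁
  have hC₂ : HasChain d σ₂ G₁ G₂ FL FH T N ν := hC₁.congr (n2 _ (by omega) (by omega) (by omega))
    (fun b h h' => n2 b (by omega) (by omega) (by omega)) fun b hb => r2 b (by omega)
  have z := normalizeCode_spec hC₂ (s := s)
  set σ₃ := (normalizeCode d s).den σ₂ with h3
  have n3 : ∀ b, b ≠ 8 → σ₃.nat b = σ₂.nat b := fun b h8 =>
    Code.den_nat (P := normalizeCode d s) ⟨h8, trivial⟩ σ₂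
  have r3 : ∀ b, b ≠ 2 * d + 1 + s → σ₃.real b = σ₂.real b := fun b h =>
    Code.den_real (P := normalizeCode d s) h σ₂
  have hC₃ : HasChain d σ₃ G₁ G₂ FL FH T N ν := hC₂.congr (n3 _ (by omega))
    (fun b h h' => n3 b (by omega)) fun b hb => r3 b (by omega)
  set σ₄ := (Code.setReal (2 * d + 1 + s) (.add numSteps (.const 1)) (.const 1)).den σ₃ with h4
  have n4 : σ₄.nat = σ₃.nat := rfl
  have r4 : σ₄.real (2 * d + 1 + s) = Function.update (σ₃.real (2 * d + 1 + s)) (N + 1) 1 := by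
    simp [h4, Code.den, State.setReal_real, NatExp.eval, RealExp.eval, hC₃.eval_numSteps]
  have e : (outputSide d s).den σ = σ₄.setNat 5 (1 + s) (σ₄.nat (s + 28) 0) := rfl
  have e28 : σ₄.nat (s + 28) 0 = visits G.V a N := by rw [n4, n3 _ f28, w1]
  rw [e]
  refine ⟨⟨?_, fun k hk hkV => ?_, fun i hi => ?_⟩, ?_⟩
  · simp [State.setNat_nat, e28]
  · rw [State.setNat_nat, if_neg (by omega), n4, n3 _ f6]
    exact w3 k hk hkV
  · rw [State.setNat_real, r4]
    rcases Nat.lt_or_eq_of_le hi with hi | rfl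
    · have hi' := Nat.lt_succ_iff.mp hi
      rw [Function.update_of_ne hi.ne, z i hi', w1, w2 i hi', breakpoint, if_pos hi']
    · rw [Function.update_self, LocGraph.breakpoint_last]
  · intro j hj
    rw [State.setNat_nat, if_pos rfl, Function.update_of_ne hj, n4, n3 _ (by simp),
      n2 _ (by simp) (by omega) (by omega), n1 _ (by omega)]

theorem HasOutput.congr {s V : ℕ} {a : ℕ → ℕ} {x : ℕ → ℝ} (h : HasOutput d σ s V a x N)
    (h5 : τ.nat 5 (1 + s) = σ.nat 5 (1 + s)) (h6 : τ.nat (s + 6) = σ.nat (s + 6))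
    (hr : τ.real (2 * d + 1 + s) = σ.real (2 * d + 1 + s)) : HasOutput d τ s V a x N :=
  ⟨h5.trans h.length, by rw [h6]; exact h.vertex, by rw [hr]; exact h.breakpoint⟩

/-- The chain of predecessors is stored from its end to its beginning. -/
theorem output_spec (hC : HasChain d (traceBack.den σ) G₁ G₂ FL FH T N ν)
    (h28 : σ.nat 28 0 = 0) (h29 : σ.nat 29 0 = 0) (hr₁ : σ.real (2 * d + 1) 0 = 0)
    (hr₂ : σ.real (2 * d + 2) 0 = 0) (h02 : σ.nat 0 2 = (ν N).1) (h06 : σ.nat 0 6 = (ν N).2)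
    (hV₁ : (ν N).1 < G₁.V) (hV₂ : (ν N).2 < G₂.V) :
    HasOutput d ((output d).den σ) 0 G₁.V (fun k => (ν (N - k)).1)
        (fun k => T.lo (ν (N - k))) N ∧
      HasOutput d ((output d).den σ) 1 G₂.V (fun k => (ν (N - k)).2)
        (fun k => T.lo (ν (N - k))) N ∧
      ((output d).den σ).nat 5 3 = N + 1 ∧ ((output d).den σ).nat 5 0 = 1 := by
  set υ := traceBack.den σ with hυ
  have uN : ∀ b, b ≠ 8 → b ≠ 26 → b ≠ 27 → υ.nat b = σ.nat b := fun b h8 h h' =>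
    Code.den_nat (P := traceBack) ⟨h, h', h8, h, h'⟩ σ
  have uR : ∀ b, υ.real b = σ.real b := fun b =>
    Code.den_real (P := traceBack) ⟨trivial, trivial, trivial, trivial⟩ σ
  have frN : ∀ (s : ℕ) (ω : State) (b : ℕ), b ≠ 5 → b ≠ 8 → b ≠ s + 28 → b ≠ s + 6 →
      ((outputSide d s).den ω).nat b = ω.nat b := fun s ω b h5 h8 h h' =>
    Code.den_nat (P := outputSide d s)
      ⟨h', ⟨h8, ⟨⟨h, h'⟩, trivial⟩, trivial, trivial⟩, ⟨h8, trivial⟩, trivial, h5⟩ ω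
  have frR : ∀ (s : ℕ) (ω : State) (b : ℕ), b ≠ 2 * d + 1 + s →
      ((outputSide d s).den ω).real b = ω.real b := fun s ω b h =>
    Code.den_real (P := outputSide d s)
      ⟨trivial, ⟨⟨⟨trivial, trivial⟩, trivial⟩, h, h⟩, h, h, trivial⟩ ω
  obtain ⟨o₁, -⟩ := hasOutput_outputSide hC zero_le_one hC.size_fst
    (a := fun k => (ν (N - k)).1) (fun k hk => hC.fst (N - k) (Nat.sub_le _ _))
    (by rw [uN _ (by simp) (by simp) (by simp)]; exact h28) (by rw [uR]; exact hr₁)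
    (by rw [uN _ (by simp) (by simp) (by simp)]; exact h02) hV₁
  set ω := (outputSide d 0).den υ with hω
  have hCω : HasChain d ω G₁ G₂ FL FH T N ν := hC.congr
    (frN 0 υ 0 (by simp) (by simp) (by simp) (by simp))
    (fun b h h' => frN 0 υ b (by omega) (by omega) (by omega) (by omega))
    (fun b h => frR 0 υ b (by omega))
  obtain ⟨o₂, p₂⟩ := hasOutput_outputSide hCω le_rfl hCω.size_snd
    (a := fun k => (ν (N - k)).2) (fun k hk => hCω.snd (N - k) (Nat.sub_le _ _))
    (by
      rw [frN 0 υ _ (by simp) (by simp) (by simp) (by simp),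
        uN _ (by simp) (by simp) (by simp)]
      exact h29)
    (by rw [frR 0 υ _ (by omega), uR]; exact hr₂)
    (by
      rw [frN 0 υ _ (by simp) (by simp) (by simp) (by simp),
        uN _ (by simp) (by simp) (by simp)]
      exact h06) hV₂
  set χ := (outputSide d 1).den ω with hχ
  have hCχ : HasChain d χ G₁ G₂ FL FH T N ν := hCω.congr
    (frN 1 ω 0 (by simp) (by simp) (by simp) (by simp))
    (fun b h h' => frN 1 ω b (by omega) (by omega) (by omega) (by omega))
    (fun b h => frR 1 ω b (by omega))
  have e : (output d).den σ = (χ.setNat 5 3 (N + 1)).setNat 5 0 1 := by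
    have : (output d).den σ = (χ.setNat 5 3 (numSteps.eval χ + 1)).setNat 5 0 1 := rfl
    rw [this, hCχ.eval_numSteps]
  have e5 : ∀ j, j ≠ 0 → j ≠ 3 → ((output d).den σ).nat 5 j = χ.nat 5 j := fun j h h' => by
    simp [e, State.setNat_nat, h, h']
  have en : ∀ b, b ≠ 5 → ((output d).den σ).nat b = χ.nat b := fun b h => by
    simp [e, State.setNat_nat, h]
  have er : ((output d).den σ).real = χ.real := by rw [e]; rfl
  refine ⟨o₁.congr ?_ ?_ ?_, o₂.congr ?_ ?_ ?_, ?_, ?_⟩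
  · rw [e5 _ (by simp) (by simp), p₂ _ (by simp)]
  · rw [en _ (by simp), frN 1 ω _ (by simp) (by simp) (by simp) (by simp)]
  · rw [er, frR 1 ω _ (by omega)]
  · rw [e5 _ (by simp) (by simp)]
  · rw [en _ (by simp)]
  · rw [er]
  · simp [e, State.setNat_nat]
  · simp [e, State.setNat_nat]

end Output

end Frechet

/-! ### Correctness of the program -/

namespace Frechet

open RealRAM

section Input

variable {d : ℕ} {K₁ K₂ : DAGComplex d} {s₁ t₁ : Fin K₁.numVertices} {s₂ t₂ : Fin K₂.numVertices}
  {δ : ℝ}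

theorem hasSize_inputState_fst : HasSize (inputState K₁ K₂ s₁ t₁ s₂ t₂ δ) 0 K₁.locGraph := by
  constructor <;> simp [inputState, toArray, DAGComplex.locGraph]

theorem hasSize_inputState_snd : HasSize (inputState K₁ K₂ s₁ t₁ s₂ t₂ δ) 1 K₂.locGraph := by
  constructor <;> simp [inputState, toArray, DAGComplex.locGraph]

theorem hasPositions_inputState : HasPositions (inputState K₁ K₂ s₁ t₁ s₂ t₂ δ) K₁.locGraph
    K₂.locGraph K₁.position K₂.position δ := by
  refine ⟨fun v hv j => ?_, fun v hv j => ?_, ?_⟩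
  · have h := K₁.position_val ⟨v, hv⟩
    simp only at h
    simp [inputState, h, toArray_of_lt _ (show v < K₁.numVertices from hv)]
  · have h := K₂.position_val ⟨v, hv⟩
    simp only at h
    simp [inputState, h, toArray_of_lt _ (show v < K₂.numVertices from hv)]
  · have h1 : ¬ 2 * d < d := by omega
    have h2 : ¬ 2 * d - d < d := by omega
    simp [inputState, h1, h2, toArray]

theorem inputState_nat {a : ℕ} (ha : 5 ≤ a) (i : ℕ) :
    (inputState K₁ K₂ s₁ t₁ s₂ t₂ δ).nat a i = 0 := by
  obtain ⟨a, rfl⟩ := Nat.exists_eq_add_of_le' ha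
  rfl

theorem inputState_real {a : ℕ} (ha : 2 * d < a) (i : ℕ) :
    (inputState K₁ K₂ s₁ t₁ s₂ t₂ δ).real a i = 0 := by
  have h1 : ¬ a < d := by omega
  have h2 : ¬ a - d < d := by omega
  have h3 : a ≠ 2 * d := by omega
  simp [inputState, h1, h2, h3]

end Input

theorem natFree_sortLocs {s b : ℕ} (h8 : b ≠ 8) (h9 : b ≠ 9) (h14 : b ≠ s + 14) (h16 : b ≠ s + 16)
    (h18 : b ≠ s + 18) (h20 : b ≠ s + 20) : Code.NatFree b (sortLocs s) := by
  simp [sortLocs, markBlocked, markStep, listUnblocked, listStep, Code.NatFree, *]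

theorem natFree_initLocs {s b : ℕ} (h8 : b ≠ 8) (h10 : b ≠ s + 10) (h12 : b ≠ s + 12) :
    Code.NatFree b (initLocs s) := by
  simp [initLocs, initStep, Code.NatFree, *]

theorem natFree_freeSpace {d b : ℕ} (h8 : b ≠ 8) (h9 : b ≠ 9) : Code.NatFree b (freeSpace d) := by
  simp [freeSpace, freeInterval, setInterval, Code.NatFree, *]

theorem natFree_prepare {d b : ℕ} (hb : b < 8 ∨ 24 < b) : Code.NatFree b (prepare d) := by
  have h1 : ∀ s ≤ 1, Code.NatFree b (initLocs s) := fun s hs =>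
    natFree_initLocs (by omega) (by omega) (by omega)
  have h2 : ∀ s ≤ 1, Code.NatFree b (sortLocs s) := fun s hs =>
    natFree_sortLocs (by omega) (by omega) (by omega) (by omega) (by omega) (by omega)
  have h3 : Code.NatFree b offsets := ⟨by omega, show b ≠ 22 by omega⟩
  have h4 : Code.NatFree b (freeSpace d) := natFree_freeSpace (by omega) (by omega)
  simp only [prepare, Code.NatFree, h1, h2, h3, h4, zero_le, le_refl, and_self]

theorem natFree_initStart {d b : ℕ} (h : b ≠ 23) (h' : b ≠ 24) : Code.NatFree b (initStart d) :=
  ⟨⟨trivial, trivial⟩, h, h'⟩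

theorem natFree_fillTable {d b : ℕ} (h8 : b ≠ 8) (h9 : b ≠ 9) (h : b ≠ 23) (h' : b ≠ 24) :
    Code.NatFree b (fillTable d) := by
  simp [fillTable, fillStep, relaxCellCode, relaxArc, relaxCode, Code.NatFree, *]

theorem realFree_prepare {d b : ℕ} (hb : b < 2 * d + 3) : Code.RealFree b (prepare d) := by
  have h3 : b ≠ 2 * d + 3 := by omega
  have h4 : b ≠ 2 * d + 4 := by omega
  have h5 : b ≠ 2 * d + 5 := by omega
  simp [prepare, initLocs, initStep, sortLocs, markBlocked, markStep, listUnblocked, listStep,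
    offsets, offsetStep, freeSpace, freeInterval, setInterval, Code.RealFree, *]

theorem realFree_fillTable {d b : ℕ} (hb : b < 2 * d + 3) :
    Code.RealFree b (initStart d) ∧ Code.RealFree b (fillTable d) := by
  have h5 : b ≠ 2 * d + 5 := by omega
  simp [initStart, fillTable, fillStep, relaxCellCode, relaxArc, relaxCode, Code.RealFree, *]

/-- The effect of the preparations: the free space is computed, no side is reached, and the
locations are sorted topologically. -/
theorem prepare_spec {d : ℕ} {K₁ K₂ : DAGComplex d} {s₁ t₁ : Fin K₁.numVertices}
    {s₂ t₂ : Fin K₂.numVertices} {δ : ℝ} (hδ : 0 ≤ δ) {σ : State}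
    (hσ : (prepare d).den (inputState K₁ K₂ s₁ t₁ s₂ t₂ δ) = σ) :
    HasLocs σ 0 K₁.locGraph ∧ HasLocs σ 1 K₂.locGraph ∧
    (∃ pos₁, K₁.locGraph.IsOrder (σ.nat 14) pos₁) ∧
    (∃ pos₂, K₂.locGraph.IsOrder (σ.nat 15) pos₂) ∧ HasOffsets σ K₁.locGraph K₂.locGraph ∧
    IsFreeSpace K₁.locGraph K₂.locGraph K₁.position K₂.position δ
      (fun ν => σ.real (2 * d + 3) (ν.1 * K₂.locGraph.L + ν.2))
      (fun ν => σ.real (2 * d + 4) (ν.1 * K₂.locGraph.L + ν.2)) ∧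
    ∀ a b, a < K₁.locGraph.L → b < K₂.locGraph.L →
      σ.real (2 * d + 5) (a * K₂.locGraph.L + b) = 2 := by
  simp only [prepare, Code.den] at hσ
  set G₁ := K₁.locGraph with hG₁
  set G₂ := K₂.locGraph with hG₂
  obtain ⟨ρ₁, hρ₁⟩ := K₁.exists_rank
  obtain ⟨ρ₂, hρ₂⟩ := K₂.exists_rank
  set σ₀ := inputState K₁ K₂ s₁ t₁ s₂ t₂ δ with h0
  set σ₁ := (initLocs 0).den σ₀ with h1
  set σ₂ := (initLocs 1).den σ₁ with h2
  set σ₃ := (sortLocs 0).den σ₂ with h3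
  set σ₄ := (sortLocs 1).den σ₃ with h4
  set σ₅ := offsets.den σ₄ with h5
  have n1 : ∀ b, b ≠ 8 → b ≠ 10 → b ≠ 12 → σ₁.nat b = σ₀.nat b := fun b h h' h'' =>
    Code.den_nat (natFree_initLocs h h' h'') σ₀
  have n2 : ∀ b, b ≠ 8 → b ≠ 11 → b ≠ 13 → σ₂.nat b = σ₁.nat b := fun b h h' h'' =>
    Code.den_nat (natFree_initLocs h h' h'') σ₁
  have n3 : ∀ b, b ≠ 8 → b ≠ 9 → b ≠ 14 → b ≠ 16 → b ≠ 18 → b ≠ 20 → σ₃.nat b = σ₂.nat b :=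
    fun b e1 e2 e3 e4 e5 e6 => Code.den_nat (natFree_sortLocs e1 e2 e3 e4 e5 e6) σ₂
  have n4 : ∀ b, b ≠ 8 → b ≠ 9 → b ≠ 15 → b ≠ 17 → b ≠ 19 → b ≠ 21 → σ₄.nat b = σ₃.nat b :=
    fun b e1 e2 e3 e4 e5 e6 => Code.den_nat (natFree_sortLocs e1 e2 e3 e4 e5 e6) σ₃
  have n5 : ∀ b, b ≠ 8 → b ≠ 22 → σ₅.nat b = σ₄.nat b := fun b h h' =>
    Code.den_nat (P := offsets) ⟨h, h'⟩ σ₄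
  have n6 : ∀ b, b ≠ 8 → b ≠ 9 → σ.nat b = σ₅.nat b := fun b h h' => by
    rw [← hσ]
    exact Code.den_nat (natFree_freeSpace h h') σ₅
  have r5 : ∀ b, σ₅.real b = σ₀.real b := fun b => by
    have a5 : σ₅.real b = σ₄.real b := Code.den_real (P := offsets) trivial σ₄
    have a4 : σ₄.real b = σ₃.real b :=
      Code.den_real (by simp [sortLocs, markBlocked, markStep, listUnblocked, listStep,
        Code.RealFree]) σ₃
    have a3 : σ₃.real b = σ₂.real b :=
      Code.den_real (by simp [sortLocs, markBlocked, markStep, listUnblocked, listStep,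
        Code.RealFree]) σ₂
    have a2 : σ₂.real b = σ₁.real b :=
      Code.den_real (by simp [initLocs, initStep, Code.RealFree]) σ₁
    have a1 : σ₁.real b = σ₀.real b :=
      Code.den_real (by simp [initLocs, initStep, Code.RealFree]) σ₀
    rw [a5, a4, a3, a2, a1]
  have z1 : σ₁.nat 0 = σ₀.nat 0 := n1 0 (by simp) (by simp) (by simp)
  have z2 : σ₂.nat 0 = σ₀.nat 0 := (n2 0 (by simp) (by simp) (by simp)).trans z1
  have z3 : σ₃.nat 0 = σ₀.nat 0 :=
    (n3 0 (by simp) (by simp) (by simp) (by simp) (by simp) (by simp)).trans z2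
  have z4 : σ₄.nat 0 = σ₀.nat 0 :=
    (n4 0 (by simp) (by simp) (by simp) (by simp) (by simp) (by simp)).trans z3
  have z5 : σ₅.nat 0 = σ₀.nat 0 := (n5 0 (by simp) (by simp)).trans z4
  have S₁ : HasSize σ₀ 0 G₁ := hasSize_inputState_fst
  have S₂ : HasSize σ₀ 1 G₂ := hasSize_inputState_snd
  have L1 : HasLocs σ₁ 0 G₁ := hasLocs_initLocs (by simp) S₁ rfl rfl
  have L2 : HasLocs σ₂ 1 G₂ := hasLocs_initLocs (by simp) (S₂.congr z1)
    (n1 3 (by simp) (by simp) (by simp)) (n1 4 (by simp) (by simp) (by simp))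
  have L1' : HasLocs σ₂ 0 G₁ := L1.congr (n2 _ (by simp) (by simp) (by simp))
    (n2 _ (by simp) (by simp) (by simp))
  have zero2 : ∀ b, 14 ≤ b → ∀ i, σ₂.nat b i = 0 := fun b hb i => by
    rw [n2 b (by omega) (by omega) (by omega), n1 b (by omega) (by omega) (by omega)]
    exact inputState_nat (by omega) i
  obtain ⟨pos₁, O₁⟩ := sortLocs_spec (S₁.congr z2) L1' hρ₁ (zero2 _ (by simp))
    (zero2 _ (by simp)) (zero2 _ (by simp) 0)
  have L2' : HasLocs σ₃ 1 G₂ := L2.congr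
    (n3 _ (by simp) (by simp) (by simp) (by simp) (by simp) (by simp))
    (n3 _ (by simp) (by simp) (by simp) (by simp) (by simp) (by simp))
  have zero3 : ∀ b, 14 ≤ b → b ≠ 14 → b ≠ 16 → b ≠ 18 → b ≠ 20 → ∀ i, σ₃.nat b i = 0 :=
    fun b hb e1 e2 e3 e4 i => by
      rw [n3 b (by omega) (by omega) e1 e2 e3 e4]
      exact zero2 b hb i
  obtain ⟨pos₂, O₂⟩ := sortLocs_spec (S₂.congr z3) L2' hρ₂
    (zero3 _ (by simp) (by simp) (by simp) (by simp) (by simp))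
    (zero3 _ (by simp) (by simp) (by simp) (by simp) (by simp))
    (zero3 _ (by simp) (by simp) (by simp) (by simp) (by simp) 0)
  have hoff : HasOffsets σ₅ G₁ G₂ := hasOffsets_offsets (S₁.congr z4) (S₂.congr z4) (by
    rw [n4 _ (by simp) (by simp) (by simp) (by simp) (by simp) (by simp)]
    exact zero3 _ (by simp) (by simp) (by simp) (by simp) (by simp) 0)
  have c₁ : ∀ b, b = 10 ∨ b = 12 → σ₅.nat b = σ₁.nat b := fun b hb => by
    rw [n5 b (by omega) (by omega),
      n4 b (by omega) (by omega) (by omega) (by omega) (by omega) (by omega),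
      n3 b (by omega) (by omega) (by omega) (by omega) (by omega) (by omega),
      n2 b (by omega) (by omega) (by omega)]
  have c₂ : ∀ b, b = 11 ∨ b = 13 → σ₅.nat b = σ₂.nat b := fun b hb => by
    rw [n5 b (by omega) (by omega),
      n4 b (by omega) (by omega) (by omega) (by omega) (by omega) (by omega),
      n3 b (by omega) (by omega) (by omega) (by omega) (by omega) (by omega)]
  have M1 : HasLocs σ₅ 0 G₁ := L1.congr (c₁ 10 (by simp)) (c₁ 12 (by simp))
  have M2 : HasLocs σ₅ 1 G₂ := L2.congr (c₂ 11 (by simp)) (c₂ 13 (by simp))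
  obtain ⟨F1, F2⟩ := freeSpace_spec hδ (hasPositions_inputState.congr fun a _ => r5 a)
    (S₁.congr z5) (S₂.congr z5) M1 M2 hoff
  rw [hσ] at F1 F2
  refine ⟨M1.congr (n6 _ (by simp) (by simp)) (n6 _ (by simp) (by simp)),
    M2.congr (n6 _ (by simp) (by simp)) (n6 _ (by simp) (by simp)), ⟨pos₁, ?_⟩, ⟨pos₂, ?_⟩, ?_,
    F1, F2⟩
  · rw [n6 _ (by simp) (by simp), n5 _ (by simp) (by simp),
      n4 _ (by simp) (by simp) (by simp) (by simp) (by simp) (by simp)]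
    exact O₁
  · rw [n6 _ (by simp) (by simp), n5 _ (by simp) (by simp)]
    exact O₂
  · unfold HasOffsets
    rw [n6 _ (by simp) (by simp)]
    exact hoff

/-- After the table has been filled, it satisfies the invariant for the set of all cells. -/
theorem exists_hasTable {d : ℕ} {K₁ K₂ : DAGComplex d} {s₁ t₁ : Fin K₁.numVertices}
    {s₂ t₂ : Fin K₂.numVertices} {δ : ℝ} (hδ : 0 ≤ δ) {σ : State}
    (hσ : (fillTable d).den ((initStart d).den
      ((prepare d).den (inputState K₁ K₂ s₁ t₁ s₂ t₂ δ))) = σ) :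
    ∃ FL FH T pos₁ pos₂, HasTable d σ K₁.locGraph K₂.locGraph FL FH T ∧
      T.Inv K₁.locGraph K₂.locGraph FL FH (s₁, s₂) (IsCell K₁.locGraph K₂.locGraph) ∧
      IsFreeSpace K₁.locGraph K₂.locGraph K₁.position K₂.position δ FL FH ∧
      K₁.locGraph.IsRank pos₁ ∧ K₂.locGraph.IsRank pos₂ ∧
      (∀ c < K₁.locGraph.L, pos₁ c < K₁.locGraph.L) ∧
      ∀ c < K₂.locGraph.L, pos₂ c < K₂.locGraph.L := by
  have n1 : ((prepare d).den (inputState K₁ K₂ s₁ t₁ s₂ t₂ δ)).nat 0 =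
      (inputState K₁ K₂ s₁ t₁ s₂ t₂ δ).nat 0 := Code.den_nat (natFree_prepare (.inl (by simp))) _
  obtain ⟨σ₁, h1⟩ : ∃ σ₁, (prepare d).den (inputState K₁ K₂ s₁ t₁ s₂ t₂ δ) = σ₁ := ⟨_, rfl⟩
  obtain ⟨L₁, L₂, ⟨pos₁, O₁⟩, ⟨pos₂, O₂⟩, hoff, hfree, hlo⟩ := prepare_spec hδ h1
  rw [h1] at hσ n1
  have n2 : ∀ b, b ≠ 23 → b ≠ 24 → ((initStart d).den σ₁).nat b = σ₁.nat b := fun b h h' =>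
    Code.den_nat (natFree_initStart h h') σ₁
  obtain ⟨σ₂, h2⟩ : ∃ σ₂, (initStart d).den σ₁ = σ₂ := ⟨_, rfl⟩
  rw [h2] at hσ
  simp only [h2] at n2
  have n20 : σ₂.nat 0 = (inputState K₁ K₂ s₁ t₁ s₂ t₂ δ).nat 0 :=
    (n2 0 (by simp) (by simp)).trans n1
  obtain ⟨T₀, hT₀, hI₀⟩ := exists_hasTable_initStart (st := (s₁, s₂)) (σ := σ₁)
    (FL := fun ν => σ₁.real (2 * d + 3) (ν.1 * K₂.locGraph.L + ν.2))
    (FH := fun ν => σ₁.real (2 * d + 4) (ν.1 * K₂.locGraph.L + ν.2))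
    (fun _ _ _ _ => rfl) (fun _ _ _ _ => rfl) hlo hoff
    ⟨by simp [startPair, cell, NatExp.Below], by simp [startPair, cell, NatExp.Below],
      by simp only [startPair, cell, NatExp.eval, n1]; rfl,
      by simp only [startPair, cell, NatExp.eval, n1]; rfl,
      s₁.2.trans_le K₁.locGraph.V_le, s₂.2.trans_le K₂.locGraph.V_le⟩
  rw [h2] at hT₀
  obtain ⟨T, hT, hI⟩ := exists_hasTable_fillTable hT₀ hI₀
    (hasSize_inputState_fst.congr n20) (hasSize_inputState_snd.congr n20)
    (L₁.congr (n2 _ (by simp) (by simp)) (n2 _ (by simp) (by simp)))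
    (L₂.congr (n2 _ (by simp) (by simp)) (n2 _ (by simp) (by simp)))
    (by rw [n2 _ (by simp) (by simp)]; exact O₁) (by rw [n2 _ (by simp) (by simp)]; exact O₂)
  rw [hσ] at hT
  exact ⟨_, _, T, pos₁, pos₂, hT, hI, hfree, O₁.rank, O₂.rank, O₁.pos_lt, O₂.pos_lt⟩

end Frechet

namespace Frechet

open RealRAM

/-- The memory after the table has been filled. -/
noncomputable def filledState {d : ℕ} (K₁ K₂ : DAGComplex d) (s₁ t₁ : Fin K₁.numVertices)
    (s₂ t₂ : Fin K₂.numVertices) (δ : ℝ) : State :=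
  (fillTable d).den ((initStart d).den ((prepare d).den (inputState K₁ K₂ s₁ t₁ s₂ t₂ δ)))

section Main

variable {d : ℕ} {K₁ K₂ : DAGComplex d} {s₁ t₁ : Fin K₁.numVertices} {s₂ t₂ : Fin K₂.numVertices}
  {δ : ℝ}

theorem filledState_nat {b : ℕ} (hb : b < 8 ∨ 24 < b) :
    (filledState K₁ K₂ s₁ t₁ s₂ t₂ δ).nat b = (inputState K₁ K₂ s₁ t₁ s₂ t₂ δ).nat b := by
  rw [filledState,
    Code.den_nat (natFree_fillTable (by omega) (by omega) (by omega) (by omega)),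
    Code.den_nat (natFree_initStart (by omega) (by omega)), Code.den_nat (natFree_prepare hb)]

theorem filledState_real {b : ℕ} (hb : b < 2 * d + 3) :
    (filledState K₁ K₂ s₁ t₁ s₂ t₂ δ).real b = (inputState K₁ K₂ s₁ t₁ s₂ t₂ δ).real b := by
  rw [filledState, Code.den_real (realFree_fillTable hb).2, Code.den_real (realFree_fillTable hb).1,
    Code.den_real (realFree_prepare hb)]

theorem storesReparam_of_hasOutput {σ : State} {s V N : ℕ} {a : ℕ → ℕ} {x : ℕ → ℝ}
    (h : HasOutput d σ s V a x N) (h3 : σ.nat 5 3 = N + 1) {f : C(unitInterval, unitInterval)}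
    (hf : ∀ y : unitInterval, (f y : ℝ) = pl (breakpoint V a x N) (N + 1) ((N + 1 : ℕ) * y)) :
    StoresReparam σ (2 * d + 1 + s) f := by
  intro y
  rw [polyline_apply, h3, hf y]
  exact pl_congr (fun i hi => (h.breakpoint i hi).symm) _

theorem storesPath_of_hasOutput {σ : State} {s N : ℕ} {K : DAGComplex d}
    {u v : Fin K.numVertices} {a : ℕ → ℕ} {x : ℕ → ℝ}
    (h : HasOutput d σ s K.numVertices a x N) {π : DirectedPath K u v}
    (hl : π.length = visits K.numVertices a N)
    (hw : ∀ i : Fin (π.length + 1), σ.nat (s + 6) i = π.vertex i) :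
    StoresPath σ (1 + s) (s + 6) π :=
  ⟨h.length.trans hl.symm, hw⟩

/-- If the end is reached, then the program outputs paths and reparameterizations. -/
theorem exists_output {σ : State} {FL FH : ℕ × ℕ → ℝ} {T : Table} {pos₁ pos₂ : ℕ → ℕ}
    (hσ : filledState K₁ K₂ s₁ t₁ s₂ t₂ δ = σ)
    (hT : HasTable d σ K₁.locGraph K₂.locGraph FL FH T)
    (hI : T.Inv K₁.locGraph K₂.locGraph FL FH (s₁, s₂) (IsCell K₁.locGraph K₂.locGraph))
    (hfree : IsFreeSpace K₁.locGraph K₂.locGraph K₁.position K₂.position δ FL FH)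
    (hρ₁ : K₁.locGraph.IsRank pos₁) (hρ₂ : K₂.locGraph.IsRank pos₂)
    (hlt₁ : ∀ c < K₁.locGraph.L, pos₁ c < K₁.locGraph.L)
    (hlt₂ : ∀ c < K₂.locGraph.L, pos₂ c < K₂.locGraph.L) (hlo : T.lo (t₁, t₂) ≤ 1) :
    answer ((output d).den σ) = 1 ∧
    ∃ (π₁ : DirectedPath K₁ s₁ t₁) (π₂ : DirectedPath K₂ s₂ t₂)
      (f g : C(unitInterval, unitInterval)),
      StoresPath ((output d).den σ) 1 6 π₁ ∧ StoresPath ((output d).den σ) 2 7 π₂ ∧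
      StoresReparam ((output d).den σ) (2 * d + 1) f ∧
      StoresReparam ((output d).den σ) (2 * d + 2) g ∧
      frechetDist π₁.curve π₂.curve ≤ δ ∧
      IsMonotoneReparam f ∧ IsMonotoneReparam g ∧ width π₁.curve π₂.curve f g ≤ δ := by
  have n0 : ∀ b, b < 8 ∨ 24 < b → σ.nat b = (inputState K₁ K₂ s₁ t₁ s₂ t₂ δ).nat b :=
    fun b hb => by rw [← hσ, filledState_nat hb]
  have r0 : ∀ b, 2 * d < b → b < 2 * d + 3 → σ.real b 0 = 0 := fun b hb hb' => by
    rw [← hσ, filledState_real hb', inputState_real hb]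
  have ls₁ := s₁.2.trans_le K₁.locGraph.V_le
  have ls₂ := s₂.2.trans_le K₂.locGraph.V_le
  have lt₁ := t₁.2.trans_le K₁.locGraph.V_le
  have lt₂ := t₂.2.trans_le K₂.locGraph.V_le
  obtain ⟨ν, hC, hν0, hν⟩ := exists_hasChain_traceBack (tt := (t₁, t₂)) hT
    (hasSize_inputState_fst.congr (n0 0 (by simp))) (hasSize_inputState_snd.congr (n0 0 (by simp)))
    hI ⟨ls₁, ls₂⟩ ⟨lt₁, lt₂⟩ hlo (by rw [n0 0 (by simp)]; rfl) (by rw [n0 0 (by simp)]; rfl)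
  set N := K₁.locGraph.L + K₂.locGraph.L with hN
  obtain ⟨hreach, hνN, hmove⟩ := hI.chain hρ₁ hρ₂ (ν := ν) (N := N) (by rwa [hν0])
    (fun k _ => hν k) (by
      rw [hν0, hN]
      exact Nat.add_le_add (hlt₁ _ lt₁).le (hlt₂ _ lt₂).le)
  obtain ⟨o₁, o₂, h3, h5⟩ := output_spec hC
    (by rw [n0 28 (by simp)]; exact inputState_nat (by simp) 0)
    (by rw [n0 29 (by simp)]; exact inputState_nat (by simp) 0)
    (r0 _ (by omega) (by omega)) (r0 _ (by omega) (by omega))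
    (by rw [n0 0 (by simp), hνN]; rfl) (by rw [n0 0 (by simp), hνN]; rfl)
    (by rw [hνN]; exact s₁.2) (by rw [hνN]; exact s₂.2)
  obtain ⟨τ, hτ⟩ : ∃ τ, (output d).den σ = τ := ⟨_, rfl⟩
  rw [hτ] at o₁ o₂ h3 h5 ⊢
  have hsub : ∀ k < N, N - k = N - (k + 1) + 1 ∧ N - (k + 1) < N := fun k hk => by omega
  have hfr : ∀ k ≤ N, _ := fun k (hk : k ≤ N) =>
    (hfree (ν (N - k)).1 (ν (N - k)).2 (hC.fst_lt _ (Nat.sub_le N k))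
      (hC.snd_lt _ (Nat.sub_le N k)) (T.lo (ν (N - k)))).mp
      (hI.free _ (hreach _ (Nat.sub_le N k)))
  have w₁ : K₁.locGraph.IsWalk (fun k => (ν (N - k)).1) (fun k => T.lo (ν (N - k))) N :=
    ⟨by simp only [Nat.sub_zero, hνN]; exact s₁.2, by simp only [Nat.sub_self, hν0]; exact t₁.2,
      fun k hk => (hfr k hk).1, fun k hk => (hfr k hk).2.1, fun k hk => by
        simp only [(hsub k hk).1]
        exact (hmove _ (hsub k hk).2).1⟩
  have w₂ : K₂.locGraph.IsWalk (fun k => (ν (N - k)).2) (fun k => T.lo (ν (N - k))) N :=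
    ⟨by simp only [Nat.sub_zero, hνN]; exact s₂.2, by simp only [Nat.sub_self, hν0]; exact t₂.2,
      fun k hk => (hfr k hk).1, fun k hk => (hfr k hk).2.1, fun k hk => by
        simp only [(hsub k hk).1]
        exact (hmove _ (hsub k hk).2).2⟩
  obtain ⟨e₁, p₁⟩ := w₁.exists_isPath hρ₁ o₁.vertex
  obtain ⟨e₂, p₂⟩ := w₂.exists_isPath hρ₂ o₂.vertex
  obtain ⟨π₁, l₁, v₁, c₁⟩ := K₁.exists_directedPath p₁ (s := s₁) (t := t₁)
    (by
      have := o₁.vertex 0 (Nat.zero_le _) w₁.first_lt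
      rwa [Nat.sub_zero, hνN] at this)
    (by
      have := o₁.vertex N le_rfl w₁.last_lt
      rwa [Nat.sub_self, hν0] at this)
  obtain ⟨π₂, l₂, v₂, c₂⟩ := K₂.exists_directedPath p₂ (s := s₂) (t := t₂)
    (by
      have := o₂.vertex 0 (Nat.zero_le _) w₂.first_lt
      rwa [Nat.sub_zero, hνN] at this)
    (by
      have := o₂.vertex N le_rfl w₂.last_lt
      rwa [Nat.sub_self, hν0] at this)
  obtain ⟨f, mf, hf⟩ := exists_isMonotoneReparam (m := N + 1)
    (φ := breakpoint K₁.locGraph.V (fun k => (ν (N - k)).1) (fun k => T.lo (ν (N - k))) N)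
    (fun i hi => w₁.breakpoint_le_succ hρ₁ o₁.vertex hi) w₁.breakpoint_zero
    (LocGraph.breakpoint_last _ _ _ _)
  obtain ⟨g, mg, hg⟩ := exists_isMonotoneReparam (m := N + 1)
    (φ := breakpoint K₂.locGraph.V (fun k => (ν (N - k)).2) (fun k => T.lo (ν (N - k))) N)
    (fun i hi => w₂.breakpoint_le_succ hρ₂ o₂.vertex hi) w₂.breakpoint_zero
    (LocGraph.breakpoint_last _ _ _ _)
  have hwidth : width π₁.curve π₂.curve f g ≤ δ := by
    refine ciSup_le fun y => ?_
    rw [c₁, c₂, hf, hg]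
    exact dist_le_of_walks hρ₁ hρ₂ w₁ w₂ o₁.vertex o₂.vertex (fun k hk => (hfr k hk).2.2)
      (mul_nonneg (Nat.cast_nonneg _) y.2.1) (mul_le_of_le_one_right (Nat.cast_nonneg _) y.2.2)
  exact ⟨h5, π₁, π₂, f, g, storesPath_of_hasOutput o₁ l₁ v₁, storesPath_of_hasOutput o₂ l₂ v₂,
    storesReparam_of_hasOutput o₁ h3 hf, storesReparam_of_hasOutput o₂ h3 hg,
    frechetDist_le_of_width_le mf mg hwidth, mf, mg, hwidth⟩

theorem mainCode_spec (hδ : 0 ≤ δ) {σ : State}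
    (hσ : (mainCode d).den (inputState K₁ K₂ s₁ t₁ s₂ t₂ δ) = σ) :
    (answer σ = 0 ∨ answer σ = 1) ∧
    (answer σ = 1 ↔ ∃ (π₁ : DirectedPath K₁ s₁ t₁) (π₂ : DirectedPath K₂ s₂ t₂),
      frechetDist π₁.curve π₂.curve ≤ δ) ∧
    (answer σ = 1 → ∃ (π₁ : DirectedPath K₁ s₁ t₁) (π₂ : DirectedPath K₂ s₂ t₂)
      (f g : C(unitInterval, unitInterval)),
      StoresPath σ 1 6 π₁ ∧ StoresPath σ 2 7 π₂ ∧
      StoresReparam σ (2 * d + 1) f ∧ StoresReparam σ (2 * d + 2) g ∧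
      frechetDist π₁.curve π₂.curve ≤ δ ∧
      IsMonotoneReparam f ∧ IsMonotoneReparam g ∧ width π₁.curve π₂.curve f g ≤ δ) := by
  simp only [mainCode, Code.den] at hσ
  obtain ⟨τ, hτ⟩ : ∃ τ, filledState K₁ K₂ s₁ t₁ s₂ t₂ δ = τ := ⟨_, rfl⟩
  obtain ⟨FL, FH, T, pos₁, pos₂, hT, hI, hfree, hρ₁, hρ₂, hlt₁, hlt₂⟩ := exists_hasTable hδ hτ
  have h0 : τ.nat 0 = (inputState K₁ K₂ s₁ t₁ s₂ t₂ δ).nat 0 := by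
    rw [← hτ, filledState_nat (by simp)]
  have h5 : τ.nat 5 0 = 0 := by
    rw [← hτ, filledState_nat (by simp), inputState_nat le_rfl]
  rw [filledState] at hτ
  rw [hτ] at hσ
  have htest : Test.Holds τ (.realLe (.get (2 * d + 5) (pairIndex (cell 0 3, cell 0 7)))
      (.const 1)) ↔ T.lo (t₁, t₂) ≤ 1 := by
    have lt₁ := t₁.2.trans_le K₁.locGraph.V_le
    have lt₂ := t₂.2.trans_le K₂.locGraph.V_le
    have e1 : τ.nat 0 3 = t₁ := by rw [h0]; rfl
    have e2 : τ.nat 0 7 = t₂ := by rw [h0]; rfl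
    simp only [Test.Holds, RealExp.eval, pairIndex, NatExp.eval, cell, e1, e2, hT.offsets _ lt₁,
      hT.lo _ _ lt₁ lt₂, Nat.cast_one]
  by_cases hlo : T.lo (t₁, t₂) ≤ 1
  · rw [if_pos (htest.mpr hlo)] at hσ
    obtain ⟨h1, π₁, π₂, f, g, h⟩ := exists_output hτ hT hI hfree hρ₁ hρ₂ hlt₁ hlt₂ hlo
    rw [hσ] at h1 h
    exact ⟨.inr h1, ⟨fun _ => ⟨π₁, π₂, h.2.2.2.2.1⟩, fun _ => h1⟩, fun _ => ⟨π₁, π₂, f, g, h⟩⟩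
  · rw [if_neg (htest.not.mpr hlo)] at hσ
    have ha : answer σ = 0 := by rw [← hσ]; exact h5
    have hne : answer σ ≠ 1 := by rw [ha]; exact zero_ne_one
    refine ⟨.inl ha, ⟨fun h => absurd h hne, ?_⟩, fun h => absurd h hne⟩
    rintro ⟨π₁, π₂, h⟩
    exact absurd (lo_le_one_of_frechetDist_le hfree hI.closed hI.start π₁ π₂ h) hlo

end Main

end Frechet

theorem mainTheorem7 (d : ℕ) :
    ∃ (P : RealRAM.Program) (C : ℕ),
      ∀ (K₁ K₂ : Frechet.DAGComplex d) (s₁ t₁ : Fin K₁.numVertices) (s₂ t₂ : Fin K₂.numVertices)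
        (δ : ℝ), 0 ≤ δ →
        ∃ (σ : RealRAM.State) (T : ℕ),
          RealRAM.Exec P (Frechet.inputState K₁ K₂ s₁ t₁ s₂ t₂ δ) σ T ∧
          T ≤ C * (max 1 (max K₁.numEdges K₂.numEdges)) ^ 2 ∧
          (Frechet.answer σ = 0 ∨ Frechet.answer σ = 1) ∧
          (Frechet.answer σ = 1 ↔
            ∃ (π₁ : Frechet.DirectedPath K₁ s₁ t₁) (π₂ : Frechet.DirectedPath K₂ s₂ t₂),
              Frechet.frechetDist π₁.curve π₂.curve ≤ δ) ∧
          (Frechet.answer σ = 1 →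
            ∃ (π₁ : Frechet.DirectedPath K₁ s₁ t₁) (π₂ : Frechet.DirectedPath K₂ s₂ t₂)
              (f g : C(unitInterval, unitInterval)),
              Frechet.StoresPath σ 1 6 π₁ ∧ Frechet.StoresPath σ 2 7 π₂ ∧
              Frechet.StoresReparam σ (2 * d + 1) f ∧ Frechet.StoresReparam σ (2 * d + 2) g ∧
              Frechet.frechetDist π₁.curve π₂.curve ≤ δ ∧
              Frechet.IsMonotoneReparam f ∧ Frechet.IsMonotoneReparam g ∧
              Frechet.width π₁.curve π₂.curve f g ≤ δ) := by
  refine ⟨(Frechet.mainCode d).toProgram, (Frechet.mainCode d).weight * 49,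
    fun K₁ K₂ s₁ t₁ s₂ t₂ δ hδ => ?_⟩
  set n := max 1 (max K₁.numEdges K₂.numEdges) with hn
  -- Connectivity bounds the number of locations by `2 * n + 1` on each side.
  have hloops : K₁.numVertices + K₁.numEdges + (K₂.numVertices + K₂.numEdges) + 1 ≤ 7 * n := by
    have := K₁.numVertices_le
    have := K₂.numVertices_le
    omega
  obtain ⟨T, hT, hE⟩ := (Frechet.mainCode_wellFormed d).exec
    (σ := Frechet.inputState K₁ K₂ s₁ t₁ s₂ t₂ δ) (M := 7 * n) (by omega)
    (Frechet.mainCode_loopsLe d hloops)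
  refine ⟨_, T, hE, hT.trans (le_of_eq ?_), Frechet.mainCode_spec hδ rfl⟩
  rw [Frechet.mainCode_depth]
  ring
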